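/- Let $T$ be a compact abelian Lie group, not necessarily connected. Let $K_T^*=R(T)\otimes_{\mathbb Z}\mathbb C$ be the $T$-equivariant $K$-theory of a point with complex coefficients, where $R(T)$ is the Grothendieck ring of finite-dimensional continuous complex representations of $T$. Let $\mathcal C_T=\operatorname{Spec}_m K_T^*$ be the complex affine variety with coordinate ring $K_T^*$, whose points are the $\mathbb C$-algebra homomorphisms $y:K_T^*\to\mathbb C$ (equivalently, the maximal ideals of $K_T^*$). A function $f:\mathcal C_T\to\mathbb C$ is holomorphic if every point of $\mathcal C_T$ has a neighborhood of the form $\{y : (y(g_1),\dots,y(g_k))\in V\}$, with $g_1,\dots,g_k\in K_T^*$ and $V\subseteq\mathbb C^k$ open, on which $f(y)=F(y(g_1),\dots,y(g_k))$ for a holomorphic function $F:V\to\mathbb C$. Let $\Gamma\mathcal K_T^*=\Gamma\mathcal O^h_{\mathcal C_T}$ be the ring of global holomorphic functions on $\mathcal C_T$. Then the natural ring homomorphism $K_T^*\to\Gamma\mathcal O^h_{\mathcal C_T}$, $a\mapsto(y\mapsto y(a))$, makes $\Gamma\mathcal O^h_{\mathcal C_T}$ a faithfully flat $K_T^*$-algebra.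 -/

import Mathlib

open scoped TensorProduct ContDiff

noncomputable section

/-- A finite-dimensional continuous complex representation of a topological group `T`, on the
vector space `ℂ^dim`; equivalently, a complex `T`-vector bundle over a point. Every
finite-dimensional continuous complex representation is isomorphic to one of these. -/
structure ComplexRep (T : Type*) [Group T] [TopologicalSpace T] where
  /-- the dimension -/
  dim : ℕ
  /-- the action -/
  ρ : Representation ℂ T (Fin dim → ℂ)
  continuous_action : ∀ v, Continuous fun t => ρ t v

namespace ComplexRep

variable {T : Type*} [Group T] [TopologicalSpace T]

/-- `V` is isomorphic to the direct sum of `W₁` and `W₂`. -/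
def IsDirectSum (V W₁ W₂ : ComplexRep T) : Prop :=
  Nonempty (V.ρ.Equiv (W₁.ρ.prod W₂.ρ))

/-- `V` is isomorphic to the tensor product of `W₁` and `W₂` (with the diagonal action). -/
def IsTensorProduct (V W₁ W₂ : ComplexRep T) : Prop :=
  Nonempty (V.ρ.Equiv (W₁.ρ.tprod W₂.ρ))

/-- `V` is isomorphic to the trivial one-dimensional representation. -/
def IsTrivialLine (V : ComplexRep T) : Prop :=
  Nonempty (V.ρ.Equiv (Representation.trivial ℂ T ℂ))

end ComplexRep

/-- The relations that define the Grothendieck ring of finite-dimensional continuous complex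
representations: `[V] = [W₁] + [W₂]` if `V ≅ W₁ ⊕ W₂`, `[V] = [W₁] [W₂]` if `V ≅ W₁ ⊗ W₂`, and
`[V] = 1` if `V` is the trivial one-dimensional representation. As `0 ≅ 0 ⊕ 0`, the first family
gives `[0] = 0`, so that it contains `[V] = [W]` for `V ≅ W ≅ W ⊕ 0`. -/
def repRelations (T : Type*) [Group T] [TopologicalSpace T] :
    Set (MvPolynomial (ComplexRep T) ℤ) :=
  {p | ∃ V W₁ W₂ : ComplexRep T, V.IsDirectSum W₁ W₂ ∧
      p = MvPolynomial.X V - (MvPolynomial.X W₁ + MvPolynomial.X W₂)} ∪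
  {p | ∃ V W₁ W₂ : ComplexRep T, V.IsTensorProduct W₁ W₂ ∧
      p = MvPolynomial.X V - MvPolynomial.X W₁ * MvPolynomial.X W₂} ∪
  {p | ∃ V : ComplexRep T, V.IsTrivialLine ∧ p = MvPolynomial.X V - 1}

/-- The representation ring `R(T)`, i.e. the integral equivariant K-theory of a point: the
Grothendieck ring of finite-dimensional continuous complex representations of `T`. It is presented
as a commutative ring by the classes `[V]` and the relations for direct sums, tensor products and
the unit. (Sums and products of classes are classes, so each element is a difference `[V] - [W]`,
and this is the additive Grothendieck group with the multiplication given by the tensor product.) -/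
abbrev RepresentationRing (T : Type*) [Group T] [TopologicalSpace T] : Type _ :=
  MvPolynomial (ComplexRep T) ℤ ⧸ Ideal.span (repRelations T)

/-- The coefficient ring `K_T^*` of `T`-equivariant K-theory with complex coefficients,
`K_T^*(point, ℤ) ⊗ ℂ = R(T) ⊗ ℂ` (the odd part of the K-theory of a point vanishes). -/
abbrev KT (T : Type*) [Group T] [TopologicalSpace T] : Type _ :=
  ℂ ⊗[ℤ] RepresentationRing T

/-- The complex points of (the spectrum of) a commutative `ℂ`-algebra `A`. For a finitely
generated algebra, taking kernels identifies them with the maximal ideals of `A`. -/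
abbrev ComplexPoints (A : Type*) [CommRing A] [Algebra ℂ A] : Type _ := A →ₐ[ℂ] ℂ

/-- A function `f` on the complex points of `A` is holomorphic if it is, near every point, of the
form `F (g₁, …, g_k)` with `g₁, …, g_k` in `A` and `F` a holomorphic function on an open subset of
`ℂ^k`. Here "near `x`" means on an open set `{y | (g₁ y, …, g_k y) ∈ V}` that contains `x`; such
sets form a basis of the classical topology. These are the global sections of the sheaf of
holomorphic functions on the affine variety with coordinate ring `A` (a reduced finitely generated
algebra): locally, the restrictions of holomorphic functions of an ambient affine space. -/
def IsHolomorphicOnPoints {A : Type*} [CommRing A] [Algebra ℂ A] (f : ComplexPoints A → ℂ) :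
    Prop :=
  ∀ x : ComplexPoints A, ∃ (k : ℕ) (g : Fin k → A) (V : Set (Fin k → ℂ)) (F : (Fin k → ℂ) → ℂ),
    IsOpen V ∧ (fun i => x (g i)) ∈ V ∧ DifferentiableOn ℂ F V ∧
      ∀ y : ComplexPoints A, (fun i => y (g i)) ∈ V → f y = F (fun i => y (g i))

theorem isHolomorphicOnPoints_apply {A : Type*} [CommRing A] [Algebra ℂ A] (a : A) :
    IsHolomorphicOnPoints (fun y : ComplexPoints A => y a) := fun _ =>
  ⟨1, fun _ => a, Set.univ, fun z => z 0, isOpen_univ, trivial, by fun_prop, fun _ _ => rfl⟩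

/-- Combining two holomorphic functions by an everywhere holomorphic function of two variables. -/
theorem IsHolomorphicOnPoints.comp₂ {A : Type*} [CommRing A] [Algebra ℂ A]
    {f₁ f₂ : ComplexPoints A → ℂ} (h₁ : IsHolomorphicOnPoints f₁)
    (h₂ : IsHolomorphicOnPoints f₂) {Φ : ℂ × ℂ → ℂ} (hΦ : Differentiable ℂ Φ) :
    IsHolomorphicOnPoints (fun y => Φ (f₁ y, f₂ y)) := by
  intro x
  obtain ⟨k, g, V, F, hV, hx, hF, hf⟩ := h₁ x
  obtain ⟨l, g', V', F', hV', hx', hF', hf'⟩ := h₂ x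
  let p : (Fin (k + l) → ℂ) → (Fin k → ℂ) := fun z i => z (Fin.castAdd l i)
  let q : (Fin (k + l) → ℂ) → (Fin l → ℂ) := fun z i => z (Fin.natAdd k i)
  have hp : Differentiable ℂ p := by fun_prop
  have hq : Differentiable ℂ q := by fun_prop
  have ep : ∀ y : ComplexPoints A,
      p (fun i => y (Fin.append g g' i)) = fun i => y (g i) := by
    intro y; funext i; simp [p]
  have eq : ∀ y : ComplexPoints A,
      q (fun i => y (Fin.append g g' i)) = fun i => y (g' i) := by
    intro y; funext i; simp [q]
  refine ⟨k + l, Fin.append g g', p ⁻¹' V ∩ q ⁻¹' V', fun z => Φ (F (p z), F' (q z)),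
    (hV.preimage hp.continuous).inter (hV'.preimage hq.continuous), ⟨?_, ?_⟩, ?_, ?_⟩
  · simpa only [Set.mem_preimage, ep] using hx
  · simpa only [Set.mem_preimage, eq] using hx'
  · exact hΦ.comp_differentiableOn
      ((hF.comp hp.differentiableOn fun z hz => hz.1).prodMk
        (hF'.comp hq.differentiableOn fun z hz => hz.2))
  · rintro y ⟨hy, hy'⟩
    simp only [Set.mem_preimage, ep, eq] at hy hy' ⊢
    rw [hf y hy, hf' y hy']

/-- The ring of global holomorphic functions on the complex points of `A`, with pointwise
operations. -/
def HolomorphicFunctions (A : Type*) [CommRing A] [Algebra ℂ A] :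
    Subalgebra ℂ (ComplexPoints A → ℂ) where
  carrier := {f | IsHolomorphicOnPoints f}
  mul_mem' h₁ h₂ := h₁.comp₂ h₂ (Φ := fun z => z.1 * z.2) (by fun_prop)
  add_mem' h₁ h₂ := h₁.comp₂ h₂ (Φ := fun z => z.1 + z.2) (by fun_prop)
  algebraMap_mem' c := by
    have h := isHolomorphicOnPoints_apply (algebraMap ℂ A c)
    simp only [AlgHom.commutes] at h
    exact h

/-- The natural map from `A` to the holomorphic functions on its complex points: `a` goes to the
function `y ↦ y a`. -/
def toHolomorphicFunctions (A : Type*) [CommRing A] [Algebra ℂ A] :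
    A →ₐ[ℂ] HolomorphicFunctions A where
  toFun a := ⟨fun y => y a, isHolomorphicOnPoints_apply a⟩
  map_one' := by ext y; simp
  map_mul' a b := by ext y; simp
  map_zero' := by ext y; simp
  map_add' a b := by ext y; simp
  commutes' c := by ext y; simp

end

/-!
The complexified representation ring `A` of a compact abelian Lie group `T` is the group algebra of
the character group of `T`, and the character group is finitely generated.

* The characters span because the continuous representations of `T` are diagonalisable: orbits are
  bounded, so there are no Jordan blocks. They are independent because traces separate them
  (`RepresentationRing.basis`).
* On a coordinate ball, the characters have logarithms, which are real-valued local homomorphisms.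
  These form a finite-dimensional space by the theorem of Arzelà and Ascoli, and only finitely many
  characters have a logarithm in its unit ball. Hence the character group is an extension of a
  discrete subgroup of a vector space by a finite group (`PontryaginDual.finite_int`).

So `A` has a multiplicative basis indexed by `ℤ^r × F` with `F` finite, and its complex points are
a disjoint union of complex tori, one for each character of `F`. A holomorphic function is the sum
of its Laurent series, whose coefficients decrease faster than every geometric progression
(`Laurent.seriesExpansion`).

Faithfulness is the Nullstellensatz: a maximal ideal has a common zero. For flatness, no coherence
or completeness theorem for analytic functions is used. By the equational criterion, it suffices
that each relation `∑ f i * x i = 0` with `f i` in `A` and `x i` holomorphic comes from relations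
in `A`. Linear maps that write vectors as combinations of syzygies, up to a term that depends only
on `∑ f i * x i`, can be applied term by term to the Laurent series of `x` if they have moderate
growth (`SeriesExpansion.exists_of_sum_eq_zero`).

The main point is therefore *division with bounds* over `A`: every submodule of a finite free module
has finitely many generators and `ℂ`-linear coefficient functions, bounded with respect to weighted
`ℓ¹`-norms. For polynomial rings this is an induction on the number of variables
(`HasBoundedDivision.polynomial`): the leading coefficients are divided with bounds over the smaller
ring, and the iteration has controlled norms once the last variable has a large enough weight.
It passes from polynomials to `A` through a presentation that maps monomials to basis vectors
(`MonomialPresentation.hasTemperedDivision`).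
-/

noncomputable section

/-! ### Bounded division by submodules over polynomial rings -/

/-- Division by submodules with bounds: every submodule `N` of a finite free `B`-module is the
image of a map `ψ` of finite free modules that has, on `N`, a section `s` which is defined and
`ℂ`-linear on the whole free module and bounded for a family of seminorms in `S` that dominates
all of `S`. -/
def HasBoundedDivision (B : Type*) [CommRing B] [Algebra ℂ B] (S : Set (RingSeminorm B)) : Prop :=
  ∀ (ι : Type) [Fintype ι] (N : Submodule B (ι → B)),
    ∃ (κ : Type) (_ : Fintype κ) (ψ : (κ → B) →ₗ[B] (ι → B)) (s : (ι → B) →ₗ[ℂ] (κ → B)),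
      (∀ v, ψ v ∈ N) ∧ (∀ h ∈ N, ψ (s h) = h) ∧
      ∀ ν ∈ S, ∃ ν' ∈ S, (∀ b, ν b ≤ ν' b) ∧
        ∃ C : ℝ, ∀ h, ∑ j, ν' (s h j) ≤ C * ∑ i, ν' (h i)

/-- Over the field `ℂ`, a linear projection onto the subspace divides, with bound `1`. -/
theorem hasBoundedDivision_complex (S : Set (RingSeminorm ℂ)) : HasBoundedDivision ℂ S := by
  intro ι _ N
  obtain ⟨p, hp⟩ := N.subtype.exists_leftInverse_of_injective N.ker_subtype
  refine ⟨ι, inferInstance, N.subtype ∘ₗ p, LinearMap.id, fun v => (p v).2, fun h hh => ?_,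
    fun ν hν => ⟨ν, hν, fun _ => le_rfl, 1, fun h => by simp⟩⟩
  have := LinearMap.congr_fun hp ⟨h, hh⟩
  simpa using congrArg Subtype.val this

theorem LinearMap.apply_eq_sum_mul_single {A ι κ : Type*} [CommRing A] [Fintype ι] [DecidableEq ι]
    (φ : (ι → A) →ₗ[A] (κ → A)) (v : ι → A) (j : κ) :
    φ v j = ∑ i, v i * φ (Pi.single i 1) j := by
  conv_lhs => rw [← Finset.univ_sum_single v, map_sum, Finset.sum_apply]
  refine Finset.sum_congr rfl fun i _ => ?_
  have : Pi.single i (v i) = v i • (Pi.single i 1 : ι → A) := by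
    rw [← Pi.single_smul', smul_eq_mul, mul_one]
  rw [this, map_smul, Pi.smul_apply, smul_eq_mul]

theorem RingSeminorm.sum_le {B : Type*} [CommRing B] (ν : RingSeminorm B) {α : Type*}
    (s : Finset α) (f : α → B) : ν (∑ i ∈ s, f i) ≤ ∑ i ∈ s, ν (f i) :=
  Finset.le_sum_of_subadditive ν (map_zero ν).le (map_add_le_add ν) s f

namespace Polynomial

variable {B : Type*} [CommRing B]

/-- The weighted `ℓ¹`-norm `∑ ν (p_d) r ^ d` of a polynomial over a seminormed ring. -/
def l1Norm (ν : RingSeminorm B) (r : ℝ) (p : Polynomial B) : ℝ := p.sum fun d a => ν a * r ^ d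

theorem l1Norm_eq (ν : RingSeminorm B) (r : ℝ) (p : Polynomial B) (D : ℕ)
    (h : p.natDegree < D) : l1Norm ν r p = ∑ d ∈ Finset.range D, ν (p.coeff d) * r ^ d :=
  p.sum_over_range' (f := fun d a => ν a * r ^ d) (by simp) D h

theorem l1Norm_add_le (ν : RingSeminorm B) {r : ℝ} (hr : 0 ≤ r) (p q : Polynomial B) :
    l1Norm ν r (p + q) ≤ l1Norm ν r p + l1Norm ν r q := by
  set D := max (p + q).natDegree (max p.natDegree q.natDegree) + 1
  rw [l1Norm_eq ν r _ D (by omega), l1Norm_eq ν r p D (by omega), l1Norm_eq ν r q D (by omega),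
    ← Finset.sum_add_distrib]
  gcongr with i
  rw [coeff_add, ← add_mul]
  gcongr
  exact map_add_le_add ν _ _

theorem sum_coeff_monomial_mul (ν : RingSeminorm B) (r : ℝ) (d k : ℕ) (a : B) (q : Polynomial B) :
    ∑ e ∈ Finset.range (d + k), ν ((monomial d a * q).coeff e) * r ^ e =
      ∑ e ∈ Finset.range k, ν (a * q.coeff e) * r ^ (d + e) := by
  rw [Finset.sum_range_add, Finset.sum_eq_zero, zero_add]
  · refine Finset.sum_congr rfl fun e _ => ?_
    rw [add_comm d e, coeff_monomial_mul]
  · intro e he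
    rw [← C_mul_X_pow_eq_monomial, mul_assoc, coeff_C_mul, coeff_X_pow_mul',
      if_neg (by simpa using he)]
    simp

theorem l1Norm_monomial_mul_le (ν : RingSeminorm B) {r : ℝ} (hr : 0 ≤ r) (d : ℕ) (a : B)
    (q : Polynomial B) : l1Norm ν r (monomial d a * q) ≤ ν a * r ^ d * l1Norm ν r q := by
  have h : (monomial d a * q).natDegree < d + (q.natDegree + 1) := by
    have := natDegree_mul_le (p := monomial d a) (q := q)
    have := natDegree_monomial_le a (m := d)
    omega
  rw [l1Norm_eq ν r _ _ h, sum_coeff_monomial_mul, l1Norm_eq ν r q _ (Nat.lt_succ_self _),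
    Finset.mul_sum]
  refine Finset.sum_le_sum fun e _ => ?_
  calc ν (a * q.coeff e) * r ^ (d + e) ≤ (ν a * ν (q.coeff e)) * r ^ (d + e) := by
        gcongr; exact map_mul_le_mul ν _ _
    _ = _ := by rw [pow_add]; ring

/-- The weighted `ℓ¹`-norm `∑ ν (p_d) r ^ d` as a ring seminorm. -/
def l1Seminorm (ν : RingSeminorm B) (r : ℝ) (hr : 0 ≤ r) : RingSeminorm (Polynomial B) where
  toFun p := l1Norm ν r p
  map_zero' := by simp [l1Norm]
  neg' p := by simp [l1Norm, Polynomial.sum_def]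
  add_le' := l1Norm_add_le ν hr
  mul_le' p q := by
    conv_lhs => rw [p.as_sum_range, Finset.sum_mul]
    refine (Finset.le_sum_of_subadditive (l1Norm ν r) (by simp [l1Norm])
      (l1Norm_add_le ν hr) _ _).trans ?_
    rw [l1Norm_eq ν r p _ (Nat.lt_succ_self _), Finset.sum_mul]
    exact Finset.sum_le_sum fun d _ => l1Norm_monomial_mul_le ν hr d _ q

theorem l1Seminorm_eq (ν : RingSeminorm B) (r : ℝ) (hr : 0 ≤ r) (p : Polynomial B) :
    l1Seminorm ν r hr p = l1Norm ν r p := rfl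

theorem l1Seminorm_apply (ν : RingSeminorm B) (r : ℝ) (hr : 0 ≤ r) (p : Polynomial B) (D : ℕ)
    (h : p.natDegree < D) :
    l1Seminorm ν r hr p = ∑ d ∈ Finset.range D, ν (p.coeff d) * r ^ d :=
  l1Norm_eq ν r p D h

theorem l1Seminorm_monomial (ν : RingSeminorm B) (r : ℝ) (hr : 0 ≤ r) (d : ℕ) (a : B) :
    l1Seminorm ν r hr (monomial d a) = ν a * r ^ d :=
  sum_monomial_index (n := d) a (fun d a => ν a * r ^ d) (by simp)

/-- The `d`-th coefficients of a vector of polynomials. -/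
def vecCoeff (ι : Type) (d : ℕ) : (ι → B[X]) →ₗ[B] (ι → B) :=
  LinearMap.compLeft (lcoeff B d) ι

@[simp]
theorem vecCoeff_apply {ι : Type} (d : ℕ) (h : ι → B[X]) (i : ι) :
    vecCoeff ι d h i = (h i).coeff d := rfl

/-- The module of coefficient vectors at `x ^ k` of the elements of degree at most `k` of a
submodule of `B[X]^ι`. -/
def leadingModule {ι : Type} (N : Submodule B[X] (ι → B[X])) (k : ℕ) : Submodule B (ι → B) where
  carrier := {v | ∃ h ∈ N, (∀ e, k < e → vecCoeff ι e h = 0) ∧ vecCoeff ι k h = v}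
  zero_mem' := ⟨0, N.zero_mem, by simp, by simp⟩
  add_mem' := by
    rintro _ _ ⟨h, hN, hd, rfl⟩ ⟨h', hN', hd', rfl⟩
    exact ⟨h + h', N.add_mem hN hN', fun e he => by rw [map_add, hd e he, hd' e he, add_zero],
      map_add _ _ _⟩
  smul_mem' := by
    rintro b _ ⟨h, hN, hd, rfl⟩
    exact ⟨b • h, (N.restrictScalars B).smul_mem b hN,
      fun e he => by rw [map_smul, hd e he, smul_zero], map_smul _ _ _⟩

theorem leadingModule_mono {ι : Type} (N : Submodule B[X] (ι → B[X])) :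
    Monotone (leadingModule N) := by
  refine monotone_nat_of_le_succ fun k => ?_
  rintro _ ⟨h, hN, hd, rfl⟩
  refine ⟨(X : B[X]) • h, N.smul_mem _ hN, fun e he => ?_, ?_⟩
  · obtain ⟨e, rfl⟩ : ∃ e', e = e' + 1 := ⟨e - 1, by omega⟩
    ext i
    simpa using congrFun (hd e (by omega)) i
  · ext i
    simp

section Division

variable {ι κ : Type} {n : ℕ}

/-- The slot `min d n`, the index of the leading coefficient module in degree `d`. -/
def slot (n d : ℕ) : Fin (n + 1) := ⟨min d n, by omega⟩

/-- The vector of coefficients of degree `d`, put into its slot. -/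
def slotVec (ι : Type) (n d : ℕ) : (ι → B[X]) →ₗ[B] (ι × Fin (n + 1) → B) where
  toFun h y := if y.2 = slot n d then (h y.1).coeff d else 0
  map_add' h h' := by ext y; simp only [Pi.add_apply, coeff_add]; split_ifs <;> simp
  map_smul' c h := by
    ext y; simp only [Pi.smul_apply, coeff_smul, RingHom.id_apply]; split_ifs <;> simp

theorem slotVec_apply (n d : ℕ) (h : ι → B[X]) (y : ι × Fin (n + 1)) :
    slotVec ι n d h y = if y.2 = slot n d then (h y.1).coeff d else 0 := rfl

theorem sum_slotVec [Fintype ι] (ν : RingSeminorm B) (d : ℕ) (h : ι → B[X]) :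
    ∑ y, ν (slotVec ι n d h y) = ∑ i, ν ((h i).coeff d) := by
  rw [Fintype.sum_prod_type]
  refine Finset.sum_congr rfl fun i _ => ?_
  rw [Finset.sum_eq_single (slot n d)]
  · simp [slotVec_apply]
  · intro k _ hk
    simp [slotVec_apply, hk]
  · simp

/-- A bound for the degrees of the entries of a vector. -/
def vecBound [Fintype ι] (h : ι → B[X]) : ℕ := Finset.univ.sup (fun i => (h i).natDegree) + 1

theorem vecCoeff_of_vecBound_le [Fintype ι] (h : ι → B[X]) {e : ℕ} (he : vecBound h ≤ e) :
    vecCoeff ι e h = 0 := by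
  ext i
  have := Finset.le_sup (f := fun i => (h i).natDegree) (Finset.mem_univ i)
  simp only [vecBound] at he
  exact coeff_eq_zero_of_natDegree_lt (by omega)

variable [Algebra ℂ B] (s : (ι × Fin (n + 1) → B) →ₗ[ℂ] (κ → B))
  (Ψ : (κ × Fin (n + 1) → B[X]) →ₗ[B[X]] (ι → B[X]))

/-- The quotients that divide the degree `d` coefficients. -/
def divStep (d : ℕ) : (ι → B[X]) →ₗ[ℂ] (κ × Fin (n + 1) → B[X]) where
  toFun h x := if x.2 = slot n d then monomial (d - min d n) (s (slotVec ι n d h) x.1) else 0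
  map_add' h h' := by
    ext x : 1
    rw [map_add, map_add]
    simp only [Pi.add_apply, map_add]
    split_ifs <;> simp
  map_smul' c h := by
    ext x : 1
    rw [LinearMap.map_smul_of_tower, map_smul]
    simp only [Pi.smul_apply, RingHom.id_apply]
    split_ifs
    · rw [smul_monomial]
    · rw [smul_zero]

theorem divStep_apply (d : ℕ) (h : ι → B[X]) (x : κ × Fin (n + 1)) :
    divStep s d h x =
      if x.2 = slot n d then monomial (d - min d n) (s (slotVec ι n d h) x.1) else 0 := rfl

/-- Division of the coefficients of degree less than `d`, from the top degree downwards. -/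
def divBelow : ℕ → (ι → B[X]) →ₗ[ℂ] (κ × Fin (n + 1) → B[X])
  | 0 => 0
  | d + 1 => divStep s d + divBelow d ∘ₗ (LinearMap.id - Ψ.restrictScalars ℂ ∘ₗ divStep s d)

theorem divBelow_succ_apply (d : ℕ) (h : ι → B[X]) : divBelow s Ψ (d + 1) h =
    divStep s d h + divBelow s Ψ d (h - Ψ (divStep s d h)) := rfl

theorem divStep_eq_zero {d : ℕ} {h : ι → B[X]} (hd : vecCoeff ι d h = 0) : divStep s d h = 0 := by
  have : slotVec ι n d h = 0 := by
    ext y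
    have := congrFun hd y.1
    rw [vecCoeff_apply] at this
    simp [slotVec_apply, this]
  ext x : 1
  rw [divStep_apply, this, map_zero]
  simp

theorem divBelow_eq_of_le {d D : ℕ} {h : ι → B[X]} (hd : ∀ e, d ≤ e → vecCoeff ι e h = 0)
    (hD : d ≤ D) : divBelow s Ψ D h = divBelow s Ψ d h := by
  induction D, hD using Nat.le_induction with
  | base => rfl
  | succ D hD ih =>
    rw [divBelow_succ_apply, divStep_eq_zero s (hd D hD), map_zero, sub_zero, zero_add, ih]

/-- Division of all coefficients, from the top degree downwards. -/
def divAll [Fintype ι] : (ι → B[X]) →ₗ[ℂ] (κ × Fin (n + 1) → B[X]) where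
  toFun h := divBelow s Ψ (vecBound h) h
  map_add' h h' := by
    set D := max (vecBound (h + h')) (max (vecBound h) (vecBound h'))
    rw [← divBelow_eq_of_le s Ψ (D := D) (fun e => vecCoeff_of_vecBound_le (h + h')) (by simp [D]),
      ← divBelow_eq_of_le s Ψ (D := D) (fun e => vecCoeff_of_vecBound_le h) (by simp [D]),
      ← divBelow_eq_of_le s Ψ (D := D) (fun e => vecCoeff_of_vecBound_le h') (by simp [D]), map_add]
  map_smul' c h := by
    set D := max (vecBound (c • h)) (vecBound h)
    rw [← divBelow_eq_of_le s Ψ (D := D) (fun e => vecCoeff_of_vecBound_le (c • h)) (by simp [D]),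
      ← divBelow_eq_of_le s Ψ (D := D) (fun e => vecCoeff_of_vecBound_le h) (by simp [D]), map_smul,
      RingHom.id_apply]

theorem divAll_apply [Fintype ι] (h : ι → B[X]) : divAll s Ψ h = divBelow s Ψ (vecBound h) h := rfl

/-- If each division step removes the top coefficient of the elements of `N`, then the division
recovers the elements of `N` from their quotients. -/
theorem map_divBelow (N : Submodule B[X] (ι → B[X])) (hΨ : ∀ v, Ψ v ∈ N)
    (hstep : ∀ d, ∀ h ∈ N, (∀ e, d < e → vecCoeff ι e h = 0) →
      ∀ e, d ≤ e → vecCoeff ι e (h - Ψ (divStep s d h)) = 0) (D : ℕ) :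
    ∀ h ∈ N, (∀ e, D ≤ e → vecCoeff ι e h = 0) → Ψ (divBelow s Ψ D h) = h := by
  induction D with
  | zero =>
    intro h _ hd
    have : h = 0 := by
      ext i e
      exact congrFun (hd e (Nat.zero_le e)) i
    rw [this, map_zero, map_zero]
  | succ D ih =>
    intro h hN hd
    rw [divBelow_succ_apply, map_add, ih _ (N.sub_mem hN (hΨ _)) (hstep D h hN fun e he => hd e he)]
    abel

/-- The part of degree less than `D` of the weighted `ℓ¹`-norm of a vector. -/
def lowNorm [Fintype ι] (ν : RingSeminorm B) (r : ℝ) (D : ℕ) (h : ι → B[X]) : ℝ :=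
  ∑ i, ∑ e ∈ Finset.range D, ν ((h i).coeff e) * r ^ e

/-- If each division step perturbs the lower coefficients by at most half of the coefficient that
it removes, then the geometric series bounds the quotients. -/
theorem divBelow_bound [Fintype ι] [Fintype κ] (ν : RingSeminorm B) {r C : ℝ} (hr : 0 ≤ r)
    (hC : 0 ≤ C)
    (h₁ : ∀ d h, ∑ x, l1Norm ν r (divStep s d h x) ≤ C * ∑ i, ν ((h i).coeff d) * r ^ d)
    (h₂ : ∀ d h, lowNorm ν r d (Ψ (divStep s d h)) ≤ 1 / 2 * ∑ i, ν ((h i).coeff d) * r ^ d)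
    (D : ℕ) : ∀ h, ∑ x, l1Norm ν r (divBelow s Ψ D h x) ≤ 2 * C * lowNorm ν r D h := by
  induction D with
  | zero => intro h; simp [divBelow, lowNorm, l1Norm]
  | succ D ih =>
    intro h
    set u := ∑ i, ν ((h i).coeff D) * r ^ D
    have hlow : lowNorm ν r (D + 1) h = lowNorm ν r D h + u := by
      simp only [lowNorm, Finset.sum_range_succ, Finset.sum_add_distrib, u]
    have hsub : lowNorm ν r D (h - Ψ (divStep s D h)) ≤
        lowNorm ν r D h + lowNorm ν r D (Ψ (divStep s D h)) := by
      simp only [lowNorm, ← Finset.sum_add_distrib]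
      gcongr with i _ e _
      rw [← add_mul, Pi.sub_apply, coeff_sub]
      gcongr
      exact map_sub_le_add ν _ _
    calc ∑ x, l1Norm ν r (divBelow s Ψ (D + 1) h x)
        ≤ ∑ x, (l1Norm ν r (divStep s D h x) +
            l1Norm ν r (divBelow s Ψ D (h - Ψ (divStep s D h)) x)) := by
          gcongr with x
          rw [divBelow_succ_apply]
          exact l1Norm_add_le ν hr _ _
      _ ≤ C * u + 2 * C * (lowNorm ν r D h + 1 / 2 * u) := by
          rw [Finset.sum_add_distrib]
          refine add_le_add (h₁ D h) ((ih _).trans ?_)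
          gcongr
          exact hsub.trans (by gcongr; exact h₂ D h)
      _ = 2 * C * lowNorm ν r (D + 1) h := by rw [hlow]; ring

section Lifts

variable [Fintype κ] (G : κ → Fin (n + 1) → ι → B[X])

theorem linearCombination_divStep (d : ℕ) (h : ι → B[X]) (i : ι) :
    Fintype.linearCombination B[X] (fun x : κ × Fin (n + 1) => G x.1 x.2) (divStep s d h) i =
      ∑ j, monomial (d - min d n) (s (slotVec ι n d h) j) * G j (slot n d) i := by
  rw [Fintype.linearCombination_apply, Finset.sum_apply, Fintype.sum_prod_type]
  refine Finset.sum_congr rfl fun j _ => ?_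
  rw [Finset.sum_eq_single (slot n d)]
  · simp [divStep_apply]
  · intro k _ hk
    simp [divStep_apply, hk]
  · simp

theorem sum_l1Norm_divStep_le [Fintype ι] (ν : RingSeminorm B) {r C : ℝ} (hr : 1 ≤ r)
    (hs : ∀ h, ∑ j, ν (s h j) ≤ C * ∑ i, ν (h i)) (d : ℕ) (h : ι → B[X]) :
    ∑ x, l1Norm ν r (divStep s d h x) ≤ C * ∑ i, ν ((h i).coeff d) * r ^ d := by
  rw [Fintype.sum_prod_type]
  calc ∑ j, ∑ k, l1Norm ν r (divStep s d h (j, k))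
      = ∑ j, ν (s (slotVec ι n d h) j) * r ^ (d - min d n) := by
        refine Finset.sum_congr rfl fun j _ => ?_
        rw [Finset.sum_eq_single (slot n d)]
        · rw [divStep_apply, if_pos rfl]
          exact l1Seminorm_monomial ν r (by linarith) _ _
        · intro k _ hk
          simp [divStep_apply, hk, l1Norm]
        · simp
    _ ≤ ∑ j, ν (s (slotVec ι n d h) j) * r ^ d := by
        gcongr ∑ j, ν (s (slotVec ι n d h) j) * ?_
        exact pow_le_pow_right₀ hr (by omega)
    _ ≤ C * (∑ y, ν (slotVec ι n d h y)) * r ^ d := by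
        rw [← Finset.sum_mul]
        gcongr
        exact hs _
    _ = _ := by rw [sum_slotVec, ← Finset.sum_mul, mul_assoc]

/-- A division step multiplies representatives `G` of the leading coefficients by monomials, so its
effect on the lower coefficients gains a factor `1 / r`; this beats the constants if `r` is
large. -/
theorem lowNorm_linearCombination_divStep_le [Fintype ι] (ν : RingSeminorm B) {r C : ℝ}
    (hr : 1 ≤ r) (hs : ∀ h, ∑ j, ν (s h j) ≤ C * ∑ i, ν (h i))
    (hrC : 2 * C * (∑ j, ∑ k : Fin (n + 1), ∑ i, ∑ e ∈ Finset.range k, ν ((G j k i).coeff e)) ≤ r)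
    (d : ℕ) (h : ι → B[X]) :
    lowNorm ν r d
      (Fintype.linearCombination B[X] (fun x : κ × Fin (n + 1) => G x.1 x.2) (divStep s d h)) ≤
      1 / 2 * ∑ i, ν ((h i).coeff d) * r ^ d := by
  set M := ∑ j, ∑ k : Fin (n + 1), ∑ i, ∑ e ∈ Finset.range k, ν ((G j k i).coeff e)
  have hM : ∀ j, ∑ i, ∑ e ∈ Finset.range (slot n d), ν ((G j (slot n d) i).coeff e) ≤ M := by
    intro j
    refine le_trans ?_ (Finset.single_le_sum (f := fun j => ∑ k : Fin (n + 1), ∑ i,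
      ∑ e ∈ Finset.range k, ν ((G j k i).coeff e)) (fun j _ => ?_) (Finset.mem_univ j))
    · exact Finset.single_le_sum (f := fun k : Fin (n + 1) => ∑ i,
        ∑ e ∈ Finset.range k, ν ((G j k i).coeff e)) (fun k _ => Finset.sum_nonneg fun i _ =>
          Finset.sum_nonneg fun e _ => apply_nonneg ν _) (Finset.mem_univ (slot n d))
    · exact Finset.sum_nonneg fun k _ => Finset.sum_nonneg fun i _ =>
          Finset.sum_nonneg fun e _ => apply_nonneg ν _
  have hM0 : 0 ≤ M := Finset.sum_nonneg fun j _ => Finset.sum_nonneg fun k _ =>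
    Finset.sum_nonneg fun i _ => Finset.sum_nonneg fun e _ => apply_nonneg ν _
  set w := s (slotVec ι n d h)
  have hw : ∑ j, ν (w j) ≤ C * ∑ i, ν ((h i).coeff d) := by
    rw [← sum_slotVec (n := n)]; exact hs _
  rcases d with _ | d
  · simp only [lowNorm, Finset.range_zero, Finset.sum_empty, Finset.sum_const_zero]
    exact mul_nonneg (by norm_num) (Finset.sum_nonneg fun i _ =>
      mul_nonneg (apply_nonneg ν _) (by positivity))
  set k := min (d + 1) n with hk
  have key : ∀ i j, ∑ e ∈ Finset.range (d + 1),
      ν ((monomial (d + 1 - k) (w j) * G j (slot n (d + 1)) i).coeff e) * r ^ e ≤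
      ν (w j) * (∑ e ∈ Finset.range k, ν ((G j (slot n (d + 1)) i).coeff e)) * r ^ d := by
    intro i j
    have hd : d + 1 = (d + 1 - k) + k := by omega
    conv_lhs => enter [1]; rw [hd]
    rw [sum_coeff_monomial_mul, Finset.mul_sum, Finset.sum_mul]
    refine Finset.sum_le_sum fun e he => ?_
    have := Finset.mem_range.1 he
    have : r ^ (d + 1 - k + e) ≤ r ^ d := pow_le_pow_right₀ hr (by omega)
    have h0 := map_mul_le_mul ν (w j) ((G j (slot n (d + 1)) i).coeff e)
    gcongr
  calc _ ≤ ∑ i, ∑ e ∈ Finset.range (d + 1), ∑ j,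
        ν ((monomial (d + 1 - k) (w j) * G j (slot n (d + 1)) i).coeff e) * r ^ e := by
        rw [lowNorm]
        gcongr with i _ e _
        rw [linearCombination_divStep, finsetSum_coeff, ← Finset.sum_mul]
        gcongr
        exact ν.sum_le _ _
    _ = ∑ j, ∑ i, ∑ e ∈ Finset.range (d + 1),
        ν ((monomial (d + 1 - k) (w j) * G j (slot n (d + 1)) i).coeff e) * r ^ e := by
        rw [Finset.sum_comm]
        simp_rw [Finset.sum_comm (s := Finset.range (d + 1))]
        rw [Finset.sum_comm]
    _ ≤ ∑ j, ∑ i, ν (w j) * (∑ e ∈ Finset.range k, ν ((G j (slot n (d + 1)) i).coeff e)) * r ^ d :=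
        Finset.sum_le_sum fun j _ => Finset.sum_le_sum fun i _ => key i j
    _ = ∑ j, ν (w j) *
          (∑ i, ∑ e ∈ Finset.range k, ν ((G j (slot n (d + 1)) i).coeff e)) * r ^ d := by
        refine Finset.sum_congr rfl fun j _ => ?_
        rw [Finset.mul_sum, Finset.sum_mul]
    _ ≤ ∑ j, ν (w j) * M * r ^ d := by
        gcongr with j
        exact hM j
    _ = (∑ j, ν (w j)) * (M * r ^ d) := by
        rw [Finset.sum_mul]; exact Finset.sum_congr rfl fun j _ => by ring
    _ ≤ (C * ∑ i, ν ((h i).coeff (d + 1))) * (M * r ^ d) := by gcongr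
    _ = (∑ i, ν ((h i).coeff (d + 1))) * r ^ d * (C * M) := by ring
    _ ≤ (∑ i, ν ((h i).coeff (d + 1))) * r ^ d * (1 / 2 * r) := by
        refine mul_le_mul_of_nonneg_left (by linarith)
          (mul_nonneg (Finset.sum_nonneg fun i _ => apply_nonneg ν _) (by positivity))
    _ = _ := by rw [← Finset.sum_mul]; ring

end Lifts

end Division

end Polynomial

open Polynomial in
/-- Bounded division passes from a Noetherian ring `B` to `B[X]`: the modules of leading
coefficients of a submodule of `B[X]^ι` are constant in large degrees, and dividing by all of them
at once divides the top coefficient of a vector. This is repeated in falling degrees; for a large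
weight of the variable, the perturbation of the lower coefficients is a contraction. -/
theorem HasBoundedDivision.polynomial {B : Type*} [CommRing B] [Algebra ℂ B] [IsNoetherianRing B]
    {S : Set (RingSeminorm B)} (hB : HasBoundedDivision B S) :
    HasBoundedDivision B[X] {μ | ∃ ν ∈ S, ∃ (r : ℝ) (hr : 0 ≤ r), μ = l1Seminorm ν r hr} := by
  classical
  intro ι _ N
  obtain ⟨n, hn⟩ := monotone_stabilizes_iff_noetherian.2
    (inferInstance : IsNoetherian B (ι → B)) ⟨leadingModule N, leadingModule_mono N⟩
  replace hn : ∀ d, leadingModule N d = leadingModule N (min d n) := by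
    intro d
    rcases le_total d n with h | h
    · rw [min_eq_left h]
    · rw [min_eq_right h]; exact (hn d h).symm
  -- the leading coefficient modules for all relevant degrees, as one submodule
  let L : Submodule B (ι × Fin (n + 1) → B) :=
    { carrier := {v | ∀ k : Fin (n + 1), (fun i => v (i, k)) ∈ leadingModule N k}
      zero_mem' := fun k => (leadingModule N k).zero_mem
      add_mem' := fun h h' k => (leadingModule N k).add_mem (h k) (h' k)
      smul_mem' := fun b _ h k => (leadingModule N k).smul_mem b (h k) }
  obtain ⟨κ, _, ψ, s, hψ, hs, hbd⟩ := hB _ L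
  have hlift : ∀ (j : κ) (k : Fin (n + 1)), ∃ g ∈ N, (∀ e, (k : ℕ) < e → vecCoeff ι e g = 0) ∧
      vecCoeff ι k g = fun i => ψ (Pi.single j 1) (i, k) := by
    exact fun j k => hψ (Pi.single j 1) k
  choose G hGN hGd hGc using hlift
  set Ψ := Fintype.linearCombination B[X] (fun x : κ × Fin (n + 1) => G x.1 x.2) with hΨ
  have hΨN : ∀ v, Ψ v ∈ N := fun v => by
    rw [hΨ, Fintype.linearCombination_apply]
    exact N.sum_mem fun x _ => N.smul_mem _ (hGN _ _)
  have hstep : ∀ d, ∀ h ∈ N, (∀ e, d < e → vecCoeff ι e h = 0) →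
      ∀ e, d ≤ e → vecCoeff ι e (h - Ψ (divStep s d h)) = 0 := by
    intro d h hN hd e he
    have hL : slotVec ι n d h ∈ L := by
      intro k
      by_cases hk : k = slot n d
      · subst hk
        have : vecCoeff ι d h ∈ leadingModule N (min d n) := hn d ▸ ⟨h, hN, hd, rfl⟩
        have e : (fun i => slotVec ι n d h (i, slot n d)) = vecCoeff ι d h := by
          ext i; rw [slotVec_apply, if_pos rfl, vecCoeff_apply]
        rw [e]
        exact this
      · have : (fun i => slotVec ι n d h (i, k)) = 0 := by ext i; simp [slotVec_apply, hk]
        rw [this]; exact (leadingModule N k).zero_mem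
    ext i
    rw [vecCoeff_apply, Pi.sub_apply, hΨ, linearCombination_divStep, coeff_sub, finsetSum_coeff]
    obtain ⟨f, rfl⟩ : ∃ f, e = f + (d - min d n) := ⟨e - (d - min d n), by omega⟩
    simp_rw [coeff_monomial_mul]
    rcases eq_or_lt_of_le (show min d n ≤ f by omega) with hf | hf
    · have e₁ : ∀ j, (G j (slot n d) i).coeff f = ψ (Pi.single j 1) (i, slot n d) := by
        intro j
        rw [← hf]
        exact congrFun (hGc j (slot n d)) i
      have e₂ := congrFun (hs _ hL) (i, slot n d)
      rw [ψ.apply_eq_sum_mul_single, slotVec_apply, if_pos rfl] at e₂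
      have e₃ : f + (d - min d n) = d := by omega
      rw [e₃, ← e₂, Pi.zero_apply, sub_eq_zero]
      refine Finset.sum_congr rfl fun j _ => ?_
      rw [e₁ j]
    · have e₁ : ∀ j, (G j (slot n d) i).coeff f = 0 := fun j =>
        congrFun (hGd j (slot n d) f hf) i
      have e₂ : (h i).coeff (f + (d - min d n)) = 0 :=
        congrFun (hd (f + (d - min d n)) (by omega)) i
      simp [e₁, e₂]
  refine ⟨κ × Fin (n + 1), inferInstance, Ψ, divAll s Ψ, hΨN, fun h hN => ?_, ?_⟩
  · rw [divAll_apply]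
    exact map_divBelow s Ψ N hΨN hstep (vecBound h) h hN fun e => vecCoeff_of_vecBound_le h
  · rintro _ ⟨ν, hν, r, hr, rfl⟩
    obtain ⟨ν', hν', hle, C, hC⟩ := hbd ν hν
    have hC' : ∀ h, ∑ j, ν' (s h j) ≤ |C| * ∑ i, ν' (h i) := fun h =>
      (hC h).trans (mul_le_mul_of_nonneg_right (le_abs_self C)
        (Finset.sum_nonneg fun i _ => apply_nonneg ν' _))
    obtain ⟨R, hrR, hR1, hRM⟩ : ∃ R, r ≤ R ∧ 1 ≤ R ∧ 2 * |C| *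
        (∑ j, ∑ k : Fin (n + 1), ∑ i, ∑ e ∈ Finset.range k, ν' ((G j k i).coeff e)) ≤ R :=
      ⟨max r (max 1 _), le_max_left _ _, (le_max_left _ _).trans (le_max_right _ _),
        (le_max_right _ _).trans (le_max_right _ _)⟩
    have hR0 : 0 ≤ R := by linarith
    refine ⟨l1Seminorm ν' R hR0, ⟨ν', hν', R, hR0, rfl⟩, fun b => ?_, 2 * |C|, fun h => ?_⟩
    · rw [l1Seminorm_apply ν r hr b _ (Nat.lt_succ_self _),
        l1Seminorm_apply ν' R hR0 b _ (Nat.lt_succ_self _)]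
      gcongr with d _
      exact hle _
    · simp only [l1Seminorm_eq, divAll_apply]
      have b₁ := sum_l1Norm_divStep_le s ν' hR1 hC'
      have b₂ := lowNorm_linearCombination_divStep_le s G ν' hR1 hC' hRM
      refine (divBelow_bound s Ψ ν' hR0 (abs_nonneg C) b₁ b₂ _ h).trans ?_
      refine mul_le_mul_of_nonneg_left (Finset.sum_le_sum fun i _ => ?_) (by positivity)
      refine (l1Norm_eq ν' R (h i) (vecBound h) ?_).ge
      have := Finset.le_sup (f := fun i => (h i).natDegree) (Finset.mem_univ i)
      exact Nat.lt_succ_of_le this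

/-! ### Tempered division over polynomial rings and their monomial quotients -/

section WeightedNorm

variable {A Λ : Type*} [CommRing A] [Algebra ℂ A]

/-- The norm `∑ |u_x| R ^ w x` of an element with coordinates `u_x` in a weighted basis. -/
def basisNorm (b : Module.Basis Λ ℂ A) (w : Λ → ℕ) (R : ℝ) (u : A) : ℝ :=
  (b.repr u).sum fun x c => ‖c‖ * R ^ w x

variable (b : Module.Basis Λ ℂ A) (w : Λ → ℕ)

theorem basisNorm_eq_sum {R : ℝ} {u : A} {s : Finset Λ} (hs : (b.repr u).support ⊆ s) :
    basisNorm b w R u = ∑ x ∈ s, ‖b.repr u x‖ * R ^ w x :=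
  Finsupp.sum_of_support_subset _ hs _ (by simp)

theorem basisNorm_nonneg {R : ℝ} (hR : 0 ≤ R) (u : A) : 0 ≤ basisNorm b w R u :=
  Finset.sum_nonneg fun _ _ => by positivity

theorem basisNorm_zero (R : ℝ) : basisNorm b w R 0 = 0 := by simp [basisNorm]

theorem basisNorm_add_le {R : ℝ} (hR : 0 ≤ R) (u v : A) :
    basisNorm b w R (u + v) ≤ basisNorm b w R u + basisNorm b w R v := by
  classical
  set s := (b.repr (u + v)).support ∪ ((b.repr u).support ∪ (b.repr v).support)
  rw [basisNorm_eq_sum b w (s := s) (u := u + v) Finset.subset_union_left,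
    basisNorm_eq_sum b w (s := s) (u := u)
      (Finset.subset_union_left.trans Finset.subset_union_right),
    basisNorm_eq_sum b w (s := s) (u := v)
      (Finset.subset_union_right.trans Finset.subset_union_right), ← Finset.sum_add_distrib]
  refine Finset.sum_le_sum fun x _ => ?_
  rw [map_add, Finsupp.add_apply, ← add_mul]
  gcongr
  exact norm_add_le _ _

theorem basisNorm_smul (R : ℝ) (c : ℂ) (u : A) :
    basisNorm b w R (c • u) = ‖c‖ * basisNorm b w R u := by
  rw [basisNorm_eq_sum b w (s := (b.repr u).support) (u := c • u), basisNorm, Finsupp.sum,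
    Finset.mul_sum]
  · refine Finset.sum_congr rfl fun x _ => ?_
    rw [map_smul, Finsupp.smul_apply, norm_smul, mul_assoc]
  · rw [map_smul]
    exact Finsupp.support_smul

theorem basisNorm_basis (R : ℝ) (x : Λ) : basisNorm b w R (b x) = R ^ w x := by
  simp [basisNorm, Finsupp.sum_single_index]

theorem basisNorm_mono {R R' : ℝ} (hR : 0 ≤ R) (h : R ≤ R') (u : A) :
    basisNorm b w R u ≤ basisNorm b w R' u :=
  Finset.sum_le_sum fun _ _ => by dsimp only; gcongr

/-- The weighted norm of a basis dominates every subadditive function that it dominates on the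
multiples of the basis vectors. -/
theorem le_basisNorm {f : A → ℝ} (h0 : f 0 ≤ 0) (hadd : ∀ u v, f (u + v) ≤ f u + f v) {C R : ℝ}
    (hf : ∀ x (c : ℂ), f (c • b x) ≤ C * (‖c‖ * R ^ w x)) (u : A) :
    f u ≤ C * basisNorm b w R u := by
  conv_lhs => rw [← b.linearCombination_repr u]
  rw [Finsupp.linearCombination_apply, Finsupp.sum, basisNorm, Finsupp.sum, Finset.mul_sum]
  exact (Finset.le_sum_of_subadditive f h0 hadd _ _).trans (Finset.sum_le_sum fun x _ => hf x _)

/-- Division by submodules of finite free modules, by operators that are continuous for the family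
of the weighted norms of a basis. -/
def HasTemperedDivision : Prop :=
  ∀ (ι : Type) [Fintype ι] (N : Submodule A (ι → A)),
    ∃ (κ : Type) (_ : Fintype κ) (ψ : (κ → A) →ₗ[A] (ι → A)) (s : (ι → A) →ₗ[ℂ] (κ → A)),
      (∀ v, ψ v ∈ N) ∧ (∀ h ∈ N, ψ (s h) = h) ∧
      ∀ R : ℝ, 1 ≤ R → ∃ R' C : ℝ, 1 ≤ R' ∧ 0 ≤ C ∧
        ∀ h, ∑ j, basisNorm b w R (s h j) ≤ C * ∑ i, basisNorm b w R' (h i)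

/-- If the seminorms that bound a division are equivalent, as a family, to the weighted norms of a
basis, then the division is tempered. -/
theorem HasBoundedDivision.hasTemperedDivision {S : Set (RingSeminorm A)}
    (hS : HasBoundedDivision A S)
    (h₁ : ∀ R : ℝ, 1 ≤ R → ∃ ν ∈ S, ∀ u, basisNorm b w R u ≤ ν u)
    (h₂ : ∀ ν ∈ S, ∃ R : ℝ, 1 ≤ R ∧ ∀ u, ν u ≤ basisNorm b w R u) : HasTemperedDivision b w := by
  intro ι _ N
  obtain ⟨κ, _, ψ, s, hψ, hs, hbd⟩ := hS ι N
  refine ⟨κ, inferInstance, ψ, s, hψ, hs, fun R hR => ?_⟩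
  obtain ⟨ν, hν, hRν⟩ := h₁ R hR
  obtain ⟨ν', hν', hle, C, hC⟩ := hbd ν hν
  obtain ⟨R', hR', hR'ν⟩ := h₂ ν' hν'
  refine ⟨R', |C|, hR', abs_nonneg C, fun h => ?_⟩
  calc ∑ j, basisNorm b w R (s h j) ≤ ∑ j, ν' (s h j) :=
        Finset.sum_le_sum fun j _ => (hRν _).trans (hle _)
    _ ≤ C * ∑ i, ν' (h i) := hC h
    _ ≤ |C| * ∑ i, ν' (h i) := mul_le_mul_of_nonneg_right (le_abs_self C)
        (Finset.sum_nonneg fun i _ => apply_nonneg ν' _)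
    _ ≤ _ := by gcongr with i; exact hR'ν _

end WeightedNorm

section Transport

variable {B B' : Type*} [CommRing B] [CommRing B'] [Algebra ℂ B] [Algebra ℂ B']

/-- The pullback of a ring seminorm along an isomorphism. -/
def RingSeminorm.pullback (ν : RingSeminorm B) (e : B' ≃ₐ[ℂ] B) : RingSeminorm B' where
  toFun u := ν (e u)
  map_zero' := by simp
  neg' u := by simp
  add_le' u v := by rw [map_add]; exact map_add_le_add ν _ _
  mul_le' u v := by rw [map_mul]; exact map_mul_le_mul ν _ _

theorem RingSeminorm.pullback_apply (ν : RingSeminorm B) (e : B' ≃ₐ[ℂ] B) (u : B') :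
    ν.pullback e u = ν (e u) := rfl

theorem HasBoundedDivision.pullback {S : Set (RingSeminorm B)} (h : HasBoundedDivision B S)
    (e : B' ≃ₐ[ℂ] B) : HasBoundedDivision B' ((fun ν => ν.pullback e) '' S) := by
  intro ι _ N
  let N' : Submodule B (ι → B) :=
    { carrier := {v | (fun i => e.symm (v i)) ∈ N}
      zero_mem' := by
        have : (fun i : ι => e.symm ((0 : ι → B) i)) = 0 := by ext; simp
        rw [Set.mem_ofPred_eq, this]; exact N.zero_mem
      add_mem' := fun {v v'} hv hv' => by
        have : (fun i => e.symm ((v + v') i)) =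
          (fun i => e.symm (v i)) + (fun i => e.symm (v' i)) := by ext; simp
        rw [Set.mem_ofPred_eq, this]; exact N.add_mem hv hv'
      smul_mem' := fun c v hv => by
        have : (fun i => e.symm ((c • v) i)) = e.symm c • (fun i => e.symm (v i)) := by ext; simp
        rw [Set.mem_ofPred_eq, this]; exact N.smul_mem _ hv }
  obtain ⟨κ, _, ψ, s, hψ, hs, hbd⟩ := h ι N'
  refine ⟨κ, inferInstance,
    { toFun := fun v i => e.symm (ψ (fun j => e (v j)) i)
      map_add' := fun v v' => ?_
      map_smul' := fun c v => ?_ },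
    { toFun := fun v j => e.symm (s (fun i => e (v i)) j)
      map_add' := fun v v' => ?_
      map_smul' := fun c v => ?_ }, fun v => hψ _, fun h hh => ?_, ?_⟩
  · have : (fun j => e ((v + v') j)) = (fun j => e (v j)) + (fun j => e (v' j)) := by ext; simp
    ext i
    change e.symm (ψ (fun j => e ((v + v') j)) i) = _
    rw [this, map_add, Pi.add_apply, map_add]
    rfl
  · have : (fun j => e ((c • v) j)) = e c • (fun j => e (v j)) := by ext; simp
    ext i
    change e.symm (ψ (fun j => e ((c • v) j)) i) = _
    rw [this, map_smul, Pi.smul_apply, smul_eq_mul, map_mul, e.symm_apply_apply]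
    rfl
  · have : (fun j => e ((v + v') j)) = (fun j => e (v j)) + (fun j => e (v' j)) := by ext; simp
    ext i
    change e.symm (s (fun j => e ((v + v') j)) i) = _
    rw [this, map_add, Pi.add_apply, map_add]
    rfl
  · have : (fun j => e ((c • v) j)) = c • (fun j => e (v j)) := by ext; simp
    ext i
    change e.symm (s (fun j => e ((c • v) j)) i) = _
    rw [this, map_smul, Pi.smul_apply, map_smul]
    rfl
  · have h1 : (fun i => e (h i)) ∈ N' := by
      change (fun i => e.symm (e (h i))) ∈ N
      simpa using hh
    ext i
    simp [hs _ h1]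
  · rintro _ ⟨ν, hν, rfl⟩
    obtain ⟨ν', hν', hle, C, hC⟩ := hbd ν hν
    refine ⟨_, ⟨ν', hν', rfl⟩, fun u => hle _, C, fun h => ?_⟩
    simpa [RingSeminorm.pullback_apply] using hC fun i => e (h i)

end Transport

namespace MvPolynomial

theorem basisNorm_eq (n : ℕ) (R : ℝ) (p : MvPolynomial (Fin n) ℂ) :
    basisNorm (basisMonomials (Fin n) ℂ) Finsupp.degree R p =
      ∑ α ∈ p.support, ‖p.coeff α‖ * R ^ α.degree := rfl

theorem degree_cons {n : ℕ} (d : ℕ) (β : Fin n →₀ ℕ) :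
    (Finsupp.cons d β).degree = d + β.degree := by
  rw [Finsupp.degree_eq_sum, Finsupp.degree_eq_sum, Fin.sum_univ_succ]
  simp

theorem finSuccEquiv_monomial_cons {n : ℕ} (d : ℕ) (β : Fin n →₀ ℕ) (c : ℂ) :
    finSuccEquiv ℂ n (monomial (Finsupp.cons d β) c) = Polynomial.monomial d (monomial β c) := by
  ext e γ
  rw [finSuccEquiv_coeff_coeff, coeff_monomial, Polynomial.coeff_monomial]
  by_cases h : d = e
  · subst h
    rw [if_pos rfl, coeff_monomial]
    simp [Finsupp.cons_right_injective d |>.eq_iff]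
  · rw [if_neg h, if_neg, coeff_zero]
    intro h'
    exact h (by simpa using congrArg (fun f => f 0) h')

/-- The norm of the monomial basis in `n + 1` variables is an iterated `ℓ¹`-norm: the same norm in
`n` variables, applied to the coefficients of the additional variable. -/
theorem basisNorm_le_l1Norm {n : ℕ} {R : ℝ} (hR : 0 ≤ R) (ν : RingSeminorm (MvPolynomial (Fin n) ℂ))
    (hν : ∀ u, basisNorm (basisMonomials (Fin n) ℂ) Finsupp.degree R u ≤ ν u)
    (p : MvPolynomial (Fin (n + 1)) ℂ) :
    basisNorm (basisMonomials (Fin (n + 1)) ℂ) Finsupp.degree R p ≤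
      Polynomial.l1Norm ν R (finSuccEquiv ℂ n p) := by
  set q := finSuccEquiv ℂ n p
  rw [Polynomial.l1Norm_eq ν R q _ (Nat.lt_succ_self _)]
  calc basisNorm (basisMonomials (Fin (n + 1)) ℂ) Finsupp.degree R p
      = ∑ x ∈ (Finset.range (q.natDegree + 1)).sigma fun d => (q.coeff d).support,
          ‖(q.coeff x.1).coeff x.2‖ * R ^ x.2.degree * R ^ x.1 := by
        rw [basisNorm_eq]
        refine Finset.sum_bij' (fun α _ => (⟨α 0, α.tail⟩ : Σ _ : ℕ, Fin n →₀ ℕ))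
          (fun x _ => Finsupp.cons x.1 x.2) ?_ ?_ ?_ ?_ ?_
        · intro α hα
          rw [Finset.mem_sigma]
          have h1 : α.tail ∈ (q.coeff (α 0)).support := by
            rw [mem_support_coeff_finSuccEquiv, Finsupp.cons_tail]; exact hα
          refine ⟨Finset.mem_range_succ_iff.2 (Polynomial.le_natDegree_of_ne_zero fun h0 => ?_), h1⟩
          simp [h0] at h1
        · intro x hx
          exact mem_support_coeff_finSuccEquiv.1 (Finset.mem_sigma.1 hx).2
        · intro α _
          exact Finsupp.cons_tail α
        · intro x _
          simp
        · intro α _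
          rw [finSuccEquiv_coeff_coeff, Finsupp.cons_tail, mul_assoc, ← pow_add]
          congr 2
          conv_lhs => rw [← Finsupp.cons_tail α, degree_cons]
          ring
    _ = ∑ d ∈ Finset.range (q.natDegree + 1),
          basisNorm (basisMonomials (Fin n) ℂ) Finsupp.degree R (q.coeff d) * R ^ d := by
        rw [Finset.sum_sigma]
        refine Finset.sum_congr rfl fun d _ => ?_
        rw [basisNorm_eq, Finset.sum_mul]
    _ ≤ _ := by
        gcongr with d
        exact hν _

/-- Polynomial rings in finitely many variables over `ℂ` have bounded division, for a family of
seminorms equivalent to the weighted norms of the monomial basis. -/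
theorem exists_hasBoundedDivision (n : ℕ) : ∃ S : Set (RingSeminorm (MvPolynomial (Fin n) ℂ)),
    HasBoundedDivision (MvPolynomial (Fin n) ℂ) S ∧
    (∀ R : ℝ, 1 ≤ R → ∃ ν ∈ S, ∀ u,
      basisNorm (basisMonomials (Fin n) ℂ) Finsupp.degree R u ≤ ν u) ∧
    ∀ ν ∈ S, ∃ R : ℝ, 1 ≤ R ∧ ∀ u,
      ν u ≤ basisNorm (basisMonomials (Fin n) ℂ) Finsupp.degree R u := by
  induction n with
  | zero =>
    let ν₀ : RingSeminorm ℂ :=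
      { toFun := fun c => ‖c‖
        map_zero' := norm_zero
        neg' := norm_neg
        add_le' := norm_add_le
        mul_le' := norm_mul_le }
    have key : ∀ (R : ℝ) (u : MvPolynomial (Fin 0) ℂ),
        basisNorm (basisMonomials (Fin 0) ℂ) Finsupp.degree R u =
          ν₀.pullback (isEmptyAlgEquiv ℂ (Fin 0)) u := by
      intro R u
      obtain ⟨c, rfl⟩ := C_surjective (Fin 0) u
      have h : (C c : MvPolynomial (Fin 0) ℂ) = c • basisMonomials (Fin 0) ℂ 0 := by
        rw [coe_basisMonomials, smul_monomial, smul_eq_mul, mul_one]; rfl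
      rw [RingSeminorm.pullback_apply, h, basisNorm_smul, basisNorm_basis, map_zero, pow_zero,
        mul_one, ← h]
      change ‖c‖ = ‖isEmptyAlgEquiv ℂ (Fin 0) (C c)‖
      exact congrArg norm ((isEmptyAlgEquiv ℂ (Fin 0)).commutes c).symm
    refine ⟨_, (hasBoundedDivision_complex {ν₀}).pullback (isEmptyAlgEquiv ℂ (Fin 0)),
      fun R hR => ⟨_, ⟨ν₀, rfl, rfl⟩, fun u => (key R u).le⟩, ?_⟩
    rintro _ ⟨ν, rfl, rfl⟩
    exact ⟨1, le_rfl, fun u => (key 1 u).ge⟩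
  | succ n ih =>
    obtain ⟨S, hS, h₁, h₂⟩ := ih
    refine ⟨_, hS.polynomial.pullback (finSuccEquiv ℂ n), fun R hR => ?_, ?_⟩
    · obtain ⟨ν, hν, hle⟩ := h₁ R hR
      exact ⟨_, ⟨_, ⟨ν, hν, R, by linarith, rfl⟩, rfl⟩, basisNorm_le_l1Norm (by linarith) ν hle⟩
    · rintro _ ⟨_, ⟨ν, hν, r, hr, rfl⟩, rfl⟩
      obtain ⟨R, hR, hle⟩ := h₂ ν hν
      refine ⟨max R r, hR.trans (le_max_left _ _), fun u => ?_⟩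
      rw [← one_mul (basisNorm _ _ _ _)]
      refine le_basisNorm _ _ (map_zero _).le (map_add_le_add _) (fun α c => ?_) u
      rw [RingSeminorm.pullback_apply, coe_basisMonomials, smul_monomial, smul_eq_mul, mul_one,
        ← Finsupp.cons_tail α, finSuccEquiv_monomial_cons, Polynomial.l1Seminorm_monomial,
        degree_cons]
      have h3 : ν (monomial α.tail c) ≤ ‖c‖ * R ^ α.tail.degree := by
        refine (hle _).trans ?_
        have : monomial α.tail c = c • basisMonomials (Fin n) ℂ α.tail := by simp [smul_monomial]
        rw [this, basisNorm_smul, basisNorm_basis]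
      have hR0 : 0 ≤ R := by linarith
      calc ν (monomial α.tail c) * r ^ α 0 ≤ ‖c‖ * R ^ α.tail.degree * r ^ α 0 := by gcongr
        _ ≤ ‖c‖ * max R r ^ α.tail.degree * max R r ^ α 0 := by
            gcongr
            · exact le_max_left _ _
            · exact le_max_right _ _
        _ = _ := by rw [pow_add]; ring

/-- Polynomial rings in finitely many variables over `ℂ` have tempered division. -/
theorem hasTemperedDivision (n : ℕ) :
    HasTemperedDivision (basisMonomials (Fin n) ℂ) Finsupp.degree := by
  obtain ⟨S, hS, h₁, h₂⟩ := exists_hasBoundedDivision n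
  exact hS.hasTemperedDivision _ _ h₁ h₂

end MvPolynomial

/-- A presentation of an algebra with a weighted basis by polynomials, in which the monomials go to
basis vectors, with comparable degrees and weights. -/
structure MonomialPresentation {A Λ : Type*} [CommRing A] [Algebra ℂ A] (b : Module.Basis Λ ℂ A)
    (w : Λ → ℕ) (n : ℕ) where
  /-- the map from the polynomial ring -/
  π : MvPolynomial (Fin n) ℂ →ₐ[ℂ] A
  /-- the exponent of a monomial that lifts the given basis vector -/
  σ : Λ → Fin n →₀ ℕ
  /-- the given monomials are lifts -/
  π_σ : ∀ x, π (MvPolynomial.monomial (σ x) 1) = b x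
  /-- degrees of lifts are bounded by weights; the summand `1` leaves room for a generator of
  weight zero -/
  degree_σ_le : ∀ x, (σ x).degree ≤ w x + 1
  /-- monomials go to basis vectors, with weights bounded by degrees -/
  exists_basis : ∀ α, ∃ x, π (MvPolynomial.monomial α 1) = b x ∧ w x ≤ α.degree

namespace MonomialPresentation

variable {A Λ : Type*} [CommRing A] [Algebra ℂ A] {b : Module.Basis Λ ℂ A} {w : Λ → ℕ} {n : ℕ}
  (P : MonomialPresentation b w n)

/-- The linear section that lifts basis vectors to monomials. -/
def lift : A →ₗ[ℂ] MvPolynomial (Fin n) ℂ := b.constr ℂ fun x => MvPolynomial.monomial (P.σ x) 1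

theorem π_lift (u : A) : P.π (P.lift u) = u := by
  have : P.π.toLinearMap ∘ₗ P.lift = LinearMap.id := b.ext fun x => by simp [lift, P.π_σ]
  exact LinearMap.congr_fun this u

theorem basisNorm_lift_le {R : ℝ} (hR : 1 ≤ R) (u : A) :
    basisNorm (MvPolynomial.basisMonomials (Fin n) ℂ) Finsupp.degree R (P.lift u) ≤
      R * basisNorm b w R u := by
  have hR0 : 0 ≤ R := by linarith
  refine le_basisNorm b w (f := fun u => basisNorm _ _ R (P.lift u))
    (by simp [basisNorm_zero])
    (fun u v => by rw [map_add]; exact basisNorm_add_le _ _ hR0 _ _) (fun x c => ?_) u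
  have : P.lift (b x) = MvPolynomial.basisMonomials (Fin n) ℂ (P.σ x) := by simp [lift]
  rw [map_smul, basisNorm_smul, this, basisNorm_basis, mul_left_comm, ← pow_succ']
  exact mul_le_mul_of_nonneg_left (pow_le_pow_right₀ hR (P.degree_σ_le x)) (norm_nonneg c)

theorem basisNorm_π_le {R : ℝ} (hR : 1 ≤ R) (p : MvPolynomial (Fin n) ℂ) :
    basisNorm b w R (P.π p) ≤
      basisNorm (MvPolynomial.basisMonomials (Fin n) ℂ) Finsupp.degree R p := by
  have hR0 : 0 ≤ R := by linarith
  rw [← one_mul (basisNorm (MvPolynomial.basisMonomials (Fin n) ℂ) _ _ _)]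
  refine le_basisNorm _ _ (f := fun p => basisNorm b w R (P.π p))
    (by simp [basisNorm_zero])
    (fun u v => by rw [map_add]; exact basisNorm_add_le _ _ hR0 _ _) (fun α c => ?_) p
  obtain ⟨x, hx, hw⟩ := P.exists_basis α
  rw [map_smul, MvPolynomial.coe_basisMonomials, hx, basisNorm_smul, basisNorm_basis, one_mul]
  gcongr

/-- Tempered division passes from a polynomial ring to a quotient in which the monomials go to the
vectors of a basis. -/
theorem hasTemperedDivision (P : MonomialPresentation b w n) : HasTemperedDivision b w := by
  classical
  intro ι _ N
  let N' : Submodule (MvPolynomial (Fin n) ℂ) (ι → MvPolynomial (Fin n) ℂ) :=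
    { carrier := {v | (fun i => P.π (v i)) ∈ N}
      zero_mem' := by
        have : (fun i : ι => P.π ((0 : ι → MvPolynomial (Fin n) ℂ) i)) = 0 := by ext; simp
        rw [Set.mem_ofPred_eq, this]; exact N.zero_mem
      add_mem' := fun {v v'} hv hv' => by
        have : (fun i => P.π ((v + v') i)) = (fun i => P.π (v i)) + (fun i => P.π (v' i)) := by
          ext; simp
        rw [Set.mem_ofPred_eq, this]; exact N.add_mem hv hv'
      smul_mem' := fun c v hv => by
        have : (fun i => P.π ((c • v) i)) = P.π c • (fun i => P.π (v i)) := by ext; simp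
        rw [Set.mem_ofPred_eq, this]; exact N.smul_mem _ hv }
  obtain ⟨κ, _, ψ, s, hψ, hs, hbd⟩ := MvPolynomial.hasTemperedDivision n ι N'
  let lι : (ι → A) →ₗ[ℂ] (ι → MvPolynomial (Fin n) ℂ) := P.lift.compLeft ι
  let πκ : (κ → MvPolynomial (Fin n) ℂ) →ₗ[ℂ] (κ → A) := P.π.toLinearMap.compLeft κ
  refine ⟨κ, inferInstance, Fintype.linearCombination A fun j i => P.π (ψ (Pi.single j 1) i),
    πκ ∘ₗ s ∘ₗ lι, fun v => ?_, fun h hh => ?_, fun R hR => ?_⟩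
  · rw [Fintype.linearCombination_apply]
    exact N.sum_mem fun j _ => N.smul_mem _ (hψ (Pi.single j 1))
  · have h1 : lι h ∈ N' := by
      change (fun i => P.π (P.lift (h i))) ∈ N
      simpa only [P.π_lift] using hh
    ext i
    have e := congrFun (hs _ h1) i
    rw [ψ.apply_eq_sum_mul_single] at e
    have e' := congrArg P.π e
    rw [map_sum] at e'
    rw [Fintype.linearCombination_apply, Finset.sum_apply]
    refine Eq.trans (Finset.sum_congr rfl fun j _ => ?_) (e'.trans (P.π_lift _))
    rw [Pi.smul_apply, smul_eq_mul, map_mul]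
    rfl
  · obtain ⟨R', C, hR', hC, hle⟩ := hbd R hR
    have hR'0 : 0 ≤ R' := by linarith
    refine ⟨R', C * R', hR', by positivity, fun h => ?_⟩
    calc ∑ j, basisNorm b w R (P.π (s (lι h) j)) ≤ ∑ j, basisNorm _ _ R (s (lι h) j) := by
          gcongr with j
          exact P.basisNorm_π_le hR _
      _ ≤ C * ∑ i, basisNorm _ _ R' (P.lift (h i)) := hle _
      _ ≤ C * ∑ i, R' * basisNorm b w R' (h i) := by
          gcongr with i
          exact P.basisNorm_lift_le hR' _
      _ = _ := by rw [← Finset.mul_sum, mul_assoc]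

end MonomialPresentation

/-! ### Convergent series of algebra elements as holomorphic functions -/

namespace MvPolynomial

variable {n : ℕ}

theorem norm_eval_le {R : ℝ} {z : Fin n → ℂ} (hz : ∀ i, ‖z i‖ ≤ R)
    (p : MvPolynomial (Fin n) ℂ) :
    ‖eval z p‖ ≤ basisNorm (basisMonomials (Fin n) ℂ) Finsupp.degree R p := by
  rw [← one_mul (basisNorm _ _ _ _)]
  refine le_basisNorm _ _ (f := fun p => ‖eval z p‖) (by simp)
    (fun u v => by rw [map_add]; exact norm_add_le _ _) (fun α c => ?_) p
  rw [coe_basisMonomials, smul_monomial, smul_eq_mul, mul_one, eval_monomial, one_mul, norm_mul]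
  gcongr
  rw [Finsupp.prod_fintype _ _ (by simp), norm_prod, Finsupp.degree_eq_sum,
    ← Finset.prod_pow_eq_pow_sum]
  refine Finset.prod_le_prod (fun i _ => norm_nonneg _) fun i _ => ?_
  rw [norm_pow]
  gcongr
  exact hz i

theorem differentiable_eval (p : MvPolynomial (Fin n) ℂ) :
    Differentiable ℂ fun z : Fin n → ℂ => eval z p := by
  induction p using MvPolynomial.induction_on with
  | C c => simp
  | add p q hp hq => simp only [map_add]; fun_prop
  | mul_X p i hp => simp only [map_mul, eval_X]; fun_prop

/-- The derivative of a monomial of degree `k` has the bound of the monomial, up to a factor `k`;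
the estimate gives away a factor `R` in favour of a simple induction. -/
theorem norm_fderiv_eval_monomial_le {R : ℝ} (hR : 1 ≤ R) {z : Fin n → ℂ} (hz : ∀ i, ‖z i‖ ≤ R)
    (k : ℕ) : ∀ α : Fin n →₀ ℕ, α.degree = k →
      ‖fderiv ℂ (fun z : Fin n → ℂ => eval z (monomial α (1 : ℂ))) z‖ ≤ k * R ^ k := by
  induction k with
  | zero =>
    intro α hα
    rw [Finsupp.degree_eq_zero_iff] at hα
    subst hα
    simp
  | succ k ih =>
    intro α hα
    obtain ⟨i, hi⟩ : ∃ i, α i ≠ 0 := by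
      by_contra! h
      have : α = 0 := Finsupp.ext h
      simp [this] at hα
    obtain ⟨β, rfl⟩ : ∃ β, α = β + Finsupp.single i 1 := ⟨α - Finsupp.single i 1,
      (tsub_add_cancel_of_le (by simpa using Nat.one_le_iff_ne_zero.2 hi)).symm⟩
    have hβ : β.degree = k := by simpa using hα
    have hfun : (fun z : Fin n → ℂ => eval z (monomial (β + Finsupp.single i 1) (1 : ℂ))) =
        fun z => eval z (monomial β (1 : ℂ)) * z i := by
      ext z
      rw [← mul_one (1 : ℂ), ← monomial_mul, map_mul, mul_one]
      congr 1
      exact eval_X (f := z) i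
    have hd := ((differentiable_eval (monomial β (1 : ℂ))) z).hasFDerivAt.fun_mul
      (hasFDerivAt_apply (𝕜 := ℂ) i z)
    rw [hfun, hd.fderiv]
    have h1 : ‖eval z (monomial β (1 : ℂ))‖ ≤ R ^ k := by
      refine (norm_eval_le hz _).trans ?_
      rw [← hβ, ← basisNorm_basis (basisMonomials (Fin n) ℂ) Finsupp.degree R β,
        coe_basisMonomials]
    have h2 : ‖(ContinuousLinearMap.proj i : (Fin n → ℂ) →L[ℂ] ℂ)‖ ≤ 1 :=
      ContinuousLinearMap.opNorm_le_bound _ zero_le_one fun v => by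
        simpa using norm_le_pi_norm v i
    have h3 := ih β hβ
    calc _ ≤ ‖eval z (monomial β (1 : ℂ))‖ * ‖(ContinuousLinearMap.proj i : (Fin n → ℂ) →L[ℂ] ℂ)‖ +
          ‖z i‖ * ‖fderiv ℂ (fun z : Fin n → ℂ => eval z (monomial β (1 : ℂ))) z‖ := by
          refine (norm_add_le _ _).trans ?_
          rw [norm_smul, norm_smul]
      _ ≤ R ^ k * 1 + R * (k * R ^ k) := by
          gcongr
          exact hz i
      _ ≤ R ^ k * R + R * (k * R ^ k) := by gcongr
      _ = _ := by push_cast; ring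

theorem norm_fderiv_eval_le {R : ℝ} (hR : 1 ≤ R) {z : Fin n → ℂ} (hz : ∀ i, ‖z i‖ ≤ R)
    (p : MvPolynomial (Fin n) ℂ) :
    ‖fderiv ℂ (fun z : Fin n → ℂ => eval z p) z‖ ≤
      basisNorm (basisMonomials (Fin n) ℂ) Finsupp.degree (2 * R) p := by
  rw [← one_mul (basisNorm _ _ _ _)]
  refine le_basisNorm _ _ (f := fun p => ‖fderiv ℂ (fun z : Fin n → ℂ => eval z p) z‖)
    (by simp) (fun u v => ?_) (fun α c => ?_) p
  · have : (fun z : Fin n → ℂ => eval z (u + v)) = (fun z => eval z u) + fun z => eval z v := by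
      ext; simp
    rw [this, fderiv_add (differentiable_eval u z) (differentiable_eval v z)]
    exact norm_add_le _ _
  · have : (fun z : Fin n → ℂ => eval z (c • basisMonomials (Fin n) ℂ α)) =
        c • fun z => eval z (monomial α (1 : ℂ)) := by
      ext; simp
    rw [this, fderiv_const_smul (differentiable_eval _ z), norm_smul, one_mul]
    gcongr
    refine (norm_fderiv_eval_monomial_le hR hz _ α rfl).trans ?_
    -- doubling the radius absorbs the factor `k ≤ 2 ^ k`
    rw [mul_pow]
    gcongr
    exact_mod_cast Nat.lt_two_pow_self.le

/-- A series of polynomials that converges in all weighted norms has an entire sum. -/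
theorem differentiable_tsum_eval {J : Type*} (p : J → MvPolynomial (Fin n) ℂ)
    (hp : ∀ R : ℝ, 1 ≤ R →
      Summable fun j => basisNorm (basisMonomials (Fin n) ℂ) Finsupp.degree R (p j)) :
    Differentiable ℂ fun z : Fin n → ℂ => ∑' j, eval z (p j) := by
  intro z
  set R := ‖z‖ + 1
  have hR : 1 ≤ R := by simp [R]
  have hball : ∀ x ∈ Metric.ball (0 : Fin n → ℂ) R, ∀ i, ‖x i‖ ≤ R := fun x hx i =>
    (norm_le_pi_norm x i).trans (mem_ball_zero_iff.1 hx).le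
  exact (hasFDerivAt_tsum_of_isPreconnected (hp (2 * R) (by linarith)) Metric.isOpen_ball
    (convex_ball (0 : Fin n → ℂ) R).isPreconnected
    (fun j x _ => ((differentiable_eval (p j)) x).hasFDerivAt)
    (fun j x hx => norm_fderiv_eval_le hR (hball x hx) (p j))
    (mem_ball_zero_iff.2 (by simp [R] : ‖z‖ < R))
    (Summable.of_norm_bounded (hp R hR) fun j => norm_eval_le (hball z
      (mem_ball_zero_iff.2 (by simp [R] : ‖z‖ < R))) (p j))
    (mem_ball_zero_iff.2 (by simp [R] : ‖z‖ < R))).differentiableAt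

end MvPolynomial

namespace MonomialPresentation

variable {A Λ : Type*} [CommRing A] [Algebra ℂ A] {b : Module.Basis Λ ℂ A} {w : Λ → ℕ} {n : ℕ}
  (P : MonomialPresentation b w n)

theorem apply_eq_eval (y : ComplexPoints A) (u : A) :
    y u = MvPolynomial.eval (fun i => y (P.π (MvPolynomial.X i))) (P.lift u) := by
  have : y.comp P.π = MvPolynomial.aeval fun i => y (P.π (MvPolynomial.X i)) :=
    MvPolynomial.algHom_ext fun i => by simp
  have h := DFunLike.congr_fun this (P.lift u)
  rw [AlgHom.comp_apply, P.π_lift] at h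
  rw [h, MvPolynomial.aeval_eq_eval]

/-- Evaluation at a point is continuous for the weighted norms. -/
theorem exists_norm_apply_le (P : MonomialPresentation b w n) (y : ComplexPoints A) :
    ∃ R C : ℝ, 1 ≤ R ∧ 0 ≤ C ∧ ∀ u, ‖y u‖ ≤ C * basisNorm b w R u := by
  set z : Fin n → ℂ := fun i => y (P.π (MvPolynomial.X i)) with hz
  have hR : 1 ≤ ‖z‖ + 1 := by simp
  refine ⟨‖z‖ + 1, ‖z‖ + 1, hR, by positivity, fun u => ?_⟩
  rw [P.apply_eq_eval y u]
  exact (MvPolynomial.norm_eval_le (fun i => (norm_le_pi_norm z i).trans (by simp)) _).trans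
    (P.basisNorm_lift_le hR u)

theorem summable_apply (P : MonomialPresentation b w n) {J : Type*} {a : J → ℂ} {u : J → A}
    (h : ∀ R : ℝ, 1 ≤ R → Summable fun j => ‖a j‖ * basisNorm b w R (u j)) (y : ComplexPoints A) :
    Summable fun j => a j * y (u j) := by
  obtain ⟨R, C, hR, hC, hy⟩ := P.exists_norm_apply_le y
  refine Summable.of_norm_bounded ((h R hR).mul_left C) fun j => ?_
  rw [norm_mul, mul_left_comm]
  gcongr
  exact hy _

/-- A series of elements of the algebra that converges in all weighted norms is a holomorphic
function. -/
theorem isHolomorphicOnPoints_tsum (P : MonomialPresentation b w n) {J : Type*} {a : J → ℂ}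
    {u : J → A} (h : ∀ R : ℝ, 1 ≤ R → Summable fun j => ‖a j‖ * basisNorm b w R (u j)) :
    IsHolomorphicOnPoints fun y : ComplexPoints A => ∑' j, a j * y (u j) := by
  intro _
  refine ⟨n, fun i => P.π (MvPolynomial.X i), Set.univ,
    fun z => ∑' j, MvPolynomial.eval z (a j • P.lift (u j)), isOpen_univ, trivial,
    (MvPolynomial.differentiable_tsum_eval _ fun R hR => ?_).differentiableOn, fun y _ => ?_⟩
  · refine Summable.of_nonneg_of_le (fun j => basisNorm_nonneg _ _ (by linarith) _) (fun j => ?_)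
      ((h R hR).mul_left R)
    rw [basisNorm_smul, mul_left_comm]
    gcongr
    exact P.basisNorm_lift_le hR _
  · refine tsum_congr fun j => ?_
    rw [MvPolynomial.smul_eval, ← P.apply_eq_eval y]

end MonomialPresentation

/-! ### Flatness of the holomorphic functions, from series expansions and tempered division -/

section WeightedNorm

variable {A Λ : Type*} [CommRing A] [Algebra ℂ A] (b : Module.Basis Λ ℂ A) (w : Λ → ℕ)

theorem basisNorm_mul_le [Add Λ] (hb : ∀ x y, b (x + y) = b x * b y)
    (hw : ∀ x y, w (x + y) ≤ w x + w y) {R : ℝ} (hR : 1 ≤ R) (u v : A) :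
    basisNorm b w R (u * v) ≤ basisNorm b w R u * basisNorm b w R v := by
  have hR0 : 0 ≤ R := by linarith
  rw [mul_comm (basisNorm b w R u)]
  refine le_basisNorm b w (f := fun u => basisNorm b w R (u * v)) (by simp [basisNorm_zero])
    (fun u u' => by rw [add_mul]; exact basisNorm_add_le _ _ hR0 _ _) (fun x c => ?_) u
  rw [smul_mul_assoc, basisNorm_smul, mul_left_comm]
  gcongr
  rw [mul_comm (basisNorm b w R v)]
  refine le_basisNorm b w (f := fun v => basisNorm b w R (b x * v)) (by simp [basisNorm_zero])
    (fun u u' => by rw [mul_add]; exact basisNorm_add_le _ _ hR0 _ _) (fun y c => ?_) v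
  rw [mul_smul_comm, basisNorm_smul, ← hb, basisNorm_basis, mul_left_comm, ← pow_add]
  exact mul_le_mul_of_nonneg_left (pow_le_pow_right₀ hR (hw x y)) (norm_nonneg c)

/-- Continuity of an operator on vectors, for the weighted norms of a basis. -/
def IsTempered {ι κ : Type} [Fintype ι] [Fintype κ] (M : (ι → A) →ₗ[ℂ] (κ → A)) : Prop :=
  ∀ R : ℝ, 1 ≤ R → ∃ R' C : ℝ, 1 ≤ R' ∧ 0 ≤ C ∧
    ∀ h, ∑ j, basisNorm b w R (M h j) ≤ C * ∑ i, basisNorm b w R' (h i)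

variable {b w} {ι κ τ : Type} [Fintype ι] [Fintype κ] [Fintype τ]

theorem IsTempered.id : IsTempered b w (LinearMap.id : (ι → A) →ₗ[ℂ] (ι → A)) :=
  fun R hR => ⟨R, 1, hR, zero_le_one, fun h => by simp⟩

theorem IsTempered.comp {M : (κ → A) →ₗ[ℂ] (τ → A)} {M' : (ι → A) →ₗ[ℂ] (κ → A)}
    (hM : IsTempered b w M) (hM' : IsTempered b w M') : IsTempered b w (M ∘ₗ M') := by
  intro R hR
  obtain ⟨R₁, C₁, hR₁, hC₁, h₁⟩ := hM R hR
  obtain ⟨R₂, C₂, hR₂, hC₂, h₂⟩ := hM' R₁ hR₁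
  refine ⟨R₂, C₁ * C₂, hR₂, by positivity, fun h => (h₁ _).trans ?_⟩
  rw [mul_assoc]
  gcongr
  exact h₂ h

theorem IsTempered.sub {M M' : (ι → A) →ₗ[ℂ] (κ → A)}
    (hM : IsTempered b w M) (hM' : IsTempered b w M') : IsTempered b w (M - M') := by
  intro R hR
  have hR0 : 0 ≤ R := by linarith
  obtain ⟨R₁, C₁, hR₁, hC₁, h₁⟩ := hM R hR
  obtain ⟨R₂, C₂, hR₂, hC₂, h₂⟩ := hM' R hR
  refine ⟨max R₁ R₂, C₁ + C₂, hR₁.trans (le_max_left _ _), by positivity, fun h => ?_⟩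
  calc ∑ j, basisNorm b w R ((M - M') h j)
      ≤ ∑ j, (basisNorm b w R (M h j) + basisNorm b w R (M' h j)) := by
        gcongr with j
        rw [LinearMap.sub_apply, Pi.sub_apply, sub_eq_add_neg]
        refine (basisNorm_add_le b w hR0 _ _).trans (add_le_add le_rfl (le_of_eq ?_))
        rw [← neg_one_smul ℂ, basisNorm_smul]
        simp
    _ ≤ C₁ * (∑ i, basisNorm b w R₁ (h i)) + C₂ * ∑ i, basisNorm b w R₂ (h i) := by
        rw [Finset.sum_add_distrib]
        exact add_le_add (h₁ h) (h₂ h)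
    _ ≤ C₁ * (∑ i, basisNorm b w (max R₁ R₂) (h i)) +
          C₂ * ∑ i, basisNorm b w (max R₁ R₂) (h i) := by
        gcongr with i _ i _
        · exact basisNorm_mono b w (by linarith) (le_max_left _ _) _
        · exact basisNorm_mono b w (by linarith) (le_max_right _ _) _
    _ = _ := by ring

/-- Maps of finite free modules are tempered. -/
theorem isTempered_restrictScalars [Add Λ] (hb : ∀ x y, b (x + y) = b x * b y)
    (hw : ∀ x y, w (x + y) ≤ w x + w y) (φ : (ι → A) →ₗ[A] (κ → A)) :
    IsTempered b w (φ.restrictScalars ℂ) := by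
  classical
  intro R hR
  have hR0 : 0 ≤ R := by linarith
  have hs0 : ∀ i, 0 ≤ ∑ j, basisNorm b w R (φ (Pi.single i 1) j) := fun i =>
    Finset.sum_nonneg fun j _ => basisNorm_nonneg b w hR0 _
  refine ⟨R, ∑ i, ∑ j, basisNorm b w R (φ (Pi.single i 1) j), hR,
    Finset.sum_nonneg fun i _ => hs0 i, fun h => ?_⟩
  calc ∑ j, basisNorm b w R (φ h j)
      ≤ ∑ j, ∑ i, basisNorm b w R (h i) * basisNorm b w R (φ (Pi.single i 1) j) := by
        gcongr with j
        rw [φ.apply_eq_sum_mul_single]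
        refine (Finset.le_sum_of_subadditive (basisNorm b w R) (basisNorm_zero b w R).le
          (basisNorm_add_le b w hR0) _ _).trans ?_
        gcongr with i
        exact basisNorm_mul_le b w hb hw hR _ _
    _ = ∑ i, basisNorm b w R (h i) * ∑ j, basisNorm b w R (φ (Pi.single i 1) j) := by
        rw [Finset.sum_comm]
        simp_rw [Finset.mul_sum]
    _ ≤ ∑ i, basisNorm b w R (h i) * ∑ i, ∑ j, basisNorm b w R (φ (Pi.single i 1) j) := by
        gcongr with i
        · exact basisNorm_nonneg b w hR0 _
        · exact Finset.single_le_sum (f := fun i => ∑ j, basisNorm b w R (φ (Pi.single i 1) j))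
            (fun i _ => hs0 i) (Finset.mem_univ i)
    _ = _ := by rw [← Finset.sum_mul, mul_comm]

end WeightedNorm

/-- Expansions of the holomorphic functions in series over a multiplicative basis: rapidly
decreasing coefficients, linear in the function and translated by the multiplication with basis
vectors. -/
structure SeriesExpansion {A Λ : Type*} [CommRing A] [Algebra ℂ A] [Add Λ]
    (b : Module.Basis Λ ℂ A) (w : Λ → ℕ) where
  /-- the coefficients of a function -/
  coeff : HolomorphicFunctions A →ₗ[ℂ] (Λ → ℂ)
  /-- the coefficients decrease faster than every geometric progression in the weight -/
  summable : ∀ f (R : ℝ), 1 ≤ R → Summable fun x => ‖coeff f x‖ * R ^ w x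
  /-- the series converges to the function -/
  hasSum : ∀ (f : HolomorphicFunctions A) (y : ComplexPoints A),
    HasSum (fun x => coeff f x * y (b x)) (f.1 y)
  /-- multiplication by a basis vector translates the coefficients -/
  coeff_mul : ∀ f x y, coeff (toHolomorphicFunctions A (b x) * f) (x + y) = coeff f y

namespace SeriesExpansion

variable {A Λ : Type*} [CommRing A] [Algebra ℂ A] [AddGroup Λ] {b : Module.Basis Λ ℂ A} {w : Λ → ℕ}
  (E : SeriesExpansion b w) {ι κ : Type} [Fintype ι] [Fintype κ]

/-- Continuity of a linear functional, for the weighted norms of a basis. -/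
def IsTemperedFunctional (b : Module.Basis Λ ℂ A) (w : Λ → ℕ) (L : A →ₗ[ℂ] ℂ) : Prop :=
  ∃ R C : ℝ, 1 ≤ R ∧ 0 ≤ C ∧ ∀ u, ‖L u‖ ≤ C * basisNorm b w R u

theorem summable_basisNorm (hb : ∀ x y, b (x + y) = b x * b y)
    (hw : ∀ x y, w (x + y) ≤ w x + w y) (f : HolomorphicFunctions A) (u : A) {R : ℝ} (hR : 1 ≤ R) :
    Summable fun x => ‖E.coeff f x‖ * basisNorm b w R (u * b x) := by
  have hR0 : 0 ≤ R := by linarith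
  refine Summable.of_nonneg_of_le (fun x => mul_nonneg (norm_nonneg _) (basisNorm_nonneg _ _ hR0 _))
    (fun x => ?_) ((E.summable f R hR).mul_left (basisNorm b w R u))
  rw [mul_left_comm]
  gcongr
  refine (basisNorm_mul_le b w hb hw hR _ _).trans ?_
  rw [basisNorm_basis]

theorem summable_functional (hb : ∀ x y, b (x + y) = b x * b y)
    (hw : ∀ x y, w (x + y) ≤ w x + w y) {L : A →ₗ[ℂ] ℂ} (hL : IsTemperedFunctional b w L)
    (f : HolomorphicFunctions A) (u : A) : Summable fun x => E.coeff f x * L (u * b x) := by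
  obtain ⟨R, C, hR, hC, h⟩ := hL
  refine Summable.of_norm_bounded ((E.summable_basisNorm hb hw f u hR).mul_left C) fun x => ?_
  rw [norm_mul, mul_left_comm]
  gcongr
  exact h _

/-- The extension of continuous functionals to holomorphic functions is compatible with the
multiplication by elements of the algebra. -/
theorem tsum_coeff_mul (hb : ∀ x y, b (x + y) = b x * b y)
    (hw : ∀ x y, w (x + y) ≤ w x + w y) {L : A →ₗ[ℂ] ℂ} (hL : IsTemperedFunctional b w L)
    (f : HolomorphicFunctions A) (u : A) :
    ∑' x, E.coeff f x * L (u * b x) =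
      ∑' x, E.coeff (toHolomorphicFunctions A u * f) x * L (b x) := by
  have hs : ∀ f, Summable fun x => E.coeff f x * L (b x) := fun f => by
    simpa using E.summable_functional hb hw hL f 1
  induction b.mem_span u using Submodule.span_induction with
  | mem u hu =>
    obtain ⟨x, rfl⟩ := hu
    rw [← (Equiv.addLeft x).tsum_eq (fun y => E.coeff _ y * L (b y))]
    refine tsum_congr fun y => ?_
    rw [Equiv.coe_addLeft, E.coeff_mul, hb]
  | zero => simp
  | add u v _ _ hu hv =>
    simp only [add_mul, map_add, mul_add, Pi.add_apply]
    rw [Summable.tsum_add (E.summable_functional hb hw hL f u)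
      (E.summable_functional hb hw hL f v), Summable.tsum_add (hs _) (hs _), hu, hv]
  | smul c u _ hu =>
    simp only [map_smul, smul_mul_assoc, Pi.smul_apply, smul_eq_mul, mul_left_comm _ c]
    simp only [mul_assoc, tsum_mul_left, hu]

/-- A continuous operator can be applied termwise to the expansion of a function. -/
theorem summable_coordinate [DecidableEq ι] {M : (ι → A) →ₗ[ℂ] (κ → A)} (hM : IsTempered b w M)
    (f : HolomorphicFunctions A) (i : ι) (j : κ) (R : ℝ) (hR : 1 ≤ R) :
    Summable fun l => ‖E.coeff f l‖ * basisNorm b w R (M (Pi.single i (b l)) j) := by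
  have hR0 : 0 ≤ R := by linarith
  obtain ⟨R', C, hR', hC, hle⟩ := hM R hR
  refine Summable.of_nonneg_of_le
    (fun l => mul_nonneg (norm_nonneg _) (basisNorm_nonneg _ _ hR0 _)) (fun l => ?_)
    ((E.summable f R' hR').mul_left C)
  rw [mul_left_comm]
  gcongr
  have h1 : ∑ i', basisNorm b w R' ((Pi.single i (b l) : ι → A) i') = R' ^ w l := by
    rw [Finset.sum_eq_single i, Pi.single_eq_same, basisNorm_basis]
    · intro i' _ hi'
      rw [Pi.single_eq_of_ne hi', basisNorm_zero]
    · simp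
  have h2 := hle (Pi.single i (b l))
  rw [h1] at h2
  exact (Finset.single_le_sum (f := fun j => basisNorm b w R (M (Pi.single i (b l)) j))
    (fun j _ => basisNorm_nonneg _ _ hR0 _) (Finset.mem_univ j)).trans h2

/-- Relations among holomorphic functions with coefficients in the algebra are trivial: a
contracting homotopy of `A^κ → A^ι → A` by continuous operators extends to the series. -/
theorem exists_of_sum_eq_zero (E : SeriesExpansion b w) (hb : ∀ x y, b (x + y) = b x * b y)
    (hw : ∀ x y, w (x + y) ≤ w x + w y) {n : ℕ} (P : MonomialPresentation b w n)
    {ι : Type} [Fintype ι] (f : ι → A) (x : ι → HolomorphicFunctions A)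
    (h : ∑ i, toHolomorphicFunctions A (f i) * x i = 0) :
    ∃ (κ : Type) (_ : Fintype κ) (a : ι → κ → A) (y : κ → HolomorphicFunctions A),
      (∀ i, x i = ∑ j, toHolomorphicFunctions A (a i j) * y j) ∧ ∀ j, ∑ i, f i * a i j = 0 := by
  classical
  have hdiv : HasTemperedDivision b w := P.hasTemperedDivision
  let φ : (ι → A) →ₗ[A] (Unit → A) := LinearMap.pi fun _ => Fintype.linearCombination A f
  have hφ : ∀ v u, φ v u = ∑ i, v i * f i := fun v u => by
    simp [φ, Fintype.linearCombination_apply]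
  -- a continuous section of `φ` on its image
  obtain ⟨κ₁, _, ψ₁, s₁, hψ₁, hs₁, ht₁⟩ := hdiv Unit (LinearMap.range φ)
  choose c hc using fun j => hψ₁ (Pi.single j 1)
  let γ : (κ₁ → A) →ₗ[A] (ι → A) := Fintype.linearCombination A c
  have hγ : ∀ v, φ (γ v) = ψ₁ v := by
    have : φ ∘ₗ γ = ψ₁ := by
      refine LinearMap.pi_ext' fun j => LinearMap.ext_ring ?_
      simp [γ, hc]
    exact fun v => LinearMap.congr_fun this v
  let Φ : (ι → A) →ₗ[ℂ] (Unit → A) := φ.restrictScalars ℂ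
  let T : (Unit → A) →ₗ[ℂ] (ι → A) := γ.restrictScalars ℂ ∘ₗ s₁
  have hΦ : IsTempered b w Φ := isTempered_restrictScalars hb hw φ
  have hT : IsTempered b w T := (isTempered_restrictScalars hb hw γ).comp ht₁
  have hφT : ∀ v, φ (T (Φ v)) = φ v := fun v => by
    rw [← hs₁ (φ v) ⟨v, rfl⟩, ← hγ]
    rfl
  -- division by the relations
  obtain ⟨κ₂, _, ψ₂, s₂, hψ₂, hs₂, ht₂⟩ := hdiv ι (LinearMap.ker φ)
  let Q : (ι → A) →ₗ[ℂ] (κ₂ → A) := s₂ ∘ₗ (LinearMap.id - T ∘ₗ Φ)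
  have hQ : IsTempered b w Q := IsTempered.comp ht₂ (IsTempered.id.sub (hT.comp hΦ))
  have hid : ∀ v, v = T (Φ v) + ψ₂ (Q v) := fun v => by
    have hk : v - T (Φ v) ∈ LinearMap.ker φ := by
      rw [LinearMap.mem_ker, map_sub, hφT, sub_self]
    have : ψ₂ (Q v) = v - T (Φ v) := hs₂ _ hk
    rw [this]; abel
  let Y : κ₂ → HolomorphicFunctions A := fun j => ∑ i,
    ⟨fun y => ∑' l, E.coeff (x i) l * y (Q (Pi.single i (b l)) j),
      P.isHolomorphicOnPoints_tsum (E.summable_coordinate hQ (x i) i j)⟩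
  refine ⟨κ₂, inferInstance, fun i j => ψ₂ (Pi.single j 1) i, Y, fun i₀ => ?_, fun j => ?_⟩
  · apply Subtype.ext
    funext y
    -- the part of the homotopy that factors through the relation contributes nothing
    have hL : IsTemperedFunctional b w
        (y.toLinearMap ∘ₗ LinearMap.proj i₀ ∘ₗ T ∘ₗ LinearMap.pi fun _ : Unit => LinearMap.id) := by
      obtain ⟨R, C, hR, hC, hy⟩ := P.exists_norm_apply_le y
      obtain ⟨R', C', hR', hC', hle⟩ := hT R hR
      have hR0 : 0 ≤ R := by linarith
      refine ⟨R', C * C', hR', by positivity, fun u => (hy _).trans ?_⟩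
      rw [mul_assoc]
      gcongr
      refine (Finset.single_le_sum (f := fun i => basisNorm b w R (T (fun _ => u) i))
        (fun j _ => basisNorm_nonneg _ _ hR0 _) (Finset.mem_univ i₀)).trans ((hle _).trans ?_)
      simp
    have hzero : ∑ i, ∑' l, E.coeff (x i) l * y (T (Φ (Pi.single i (b l))) i₀) = 0 := by
      have e1 : ∀ i l, y (T (Φ (Pi.single i (b l))) i₀) =
          (y.toLinearMap ∘ₗ LinearMap.proj i₀ ∘ₗ T ∘ₗ
            LinearMap.pi fun _ : Unit => LinearMap.id) (f i * b l) := by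
        intro i l
        have : Φ (Pi.single i (b l)) = fun _ => f i * b l := by
          ext u
          change φ _ u = _
          rw [hφ, Finset.sum_eq_single i]
          · simp [mul_comm]
          · intro i' _ hi'
            simp [Pi.single_eq_of_ne hi']
          · simp
        rw [this]
        rfl
      have hs : ∀ g, Summable fun l => E.coeff g l * (y.toLinearMap ∘ₗ LinearMap.proj i₀ ∘ₗ T ∘ₗ
          LinearMap.pi fun _ : Unit => LinearMap.id) (b l) := fun g => by
        simpa only [one_mul] using E.summable_functional hb hw hL g 1
      simp_rw [e1, E.tsum_coeff_mul hb hw hL]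
      rw [← Summable.tsum_finsetSum fun i _ => hs _]
      simp_rw [← Finset.sum_mul, ← Finset.sum_apply, ← map_sum, h]
      simp
    have hxi : ∀ i, (if i = i₀ then (x i₀).1 y else 0) =
        ∑' l, E.coeff (x i) l * y ((Pi.single i (b l) : ι → A) i₀) := by
      intro i
      split_ifs with hi
      · subst hi
        simp_rw [Pi.single_eq_same]
        exact (E.hasSum (x i) y).tsum_eq.symm
      · simp_rw [Pi.single_eq_of_ne (Ne.symm hi)]
        simp
    have hsT : ∀ i, Summable fun l => E.coeff (x i) l * y (T (Φ (Pi.single i (b l))) i₀) :=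
      fun i => P.summable_apply (E.summable_coordinate (hT.comp hΦ) (x i) i i₀) y
    have hsQ : ∀ i j, Summable fun l => E.coeff (x i) l * y (Q (Pi.single i (b l)) j) :=
      fun i j => P.summable_apply (E.summable_coordinate hQ (x i) i j) y
    calc (x i₀).1 y = ∑ i, (if i = i₀ then (x i₀).1 y else 0) := by simp
      _ = ∑ i, ∑' l, E.coeff (x i) l * y ((Pi.single i (b l) : ι → A) i₀) :=
          Finset.sum_congr rfl fun i _ => hxi i
      _ = ∑ i, ∑' l, (E.coeff (x i) l * y (T (Φ (Pi.single i (b l))) i₀) +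
            ∑ j, y (ψ₂ (Pi.single j 1) i₀) * (E.coeff (x i) l * y (Q (Pi.single i (b l)) j))) := by
          refine Finset.sum_congr rfl fun i _ => tsum_congr fun l => ?_
          conv_lhs => rw [hid (Pi.single i (b l)), Pi.add_apply, ψ₂.apply_eq_sum_mul_single,
            map_add, mul_add, map_sum, Finset.mul_sum]
          congr 1
          refine Finset.sum_congr rfl fun j _ => ?_
          rw [map_mul]; ring
      _ = ∑ i, (∑' l, E.coeff (x i) l * y (T (Φ (Pi.single i (b l))) i₀)) +
            ∑ i, ∑ j, y (ψ₂ (Pi.single j 1) i₀) *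
              ∑' l, E.coeff (x i) l * y (Q (Pi.single i (b l)) j) := by
          rw [← Finset.sum_add_distrib]
          refine Finset.sum_congr rfl fun i _ => ?_
          rw [Summable.tsum_add (hsT i) (summable_sum fun j _ => (hsQ i j).mul_left _),
            Summable.tsum_finsetSum fun j _ => (hsQ i j).mul_left _]
          simp_rw [tsum_mul_left]
      _ = _ := by
          rw [hzero, zero_add, Finset.sum_comm]
          simp only [Y, ← Finset.mul_sum]
          simp [toHolomorphicFunctions]
  · have := hψ₂ (Pi.single j 1)
    rw [LinearMap.mem_ker] at this
    have h' := congrFun this ()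
    rw [hφ] at h'
    simpa [mul_comm] using h'

end SeriesExpansion

/-- Nullstellensatz: a maximal ideal of a finitely generated `ℂ`-algebra is contained in the kernel
of a complex point. -/
theorem exists_complexPoint {A : Type*} [CommRing A] [Algebra ℂ A] [Algebra.FiniteType ℂ A]
    (m : Ideal A) [m.IsMaximal] : ∃ y : ComplexPoints A, ∀ a ∈ m, y a = 0 := by
  let := Ideal.Quotient.field m
  have := finite_of_finite_type_of_isJacobsonRing ℂ (A ⧸ m)
  let e : ℂ ≃ₐ[ℂ] A ⧸ m := AlgEquiv.ofBijective (Algebra.ofId ℂ (A ⧸ m))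
    (IsAlgClosed.algebraMap_bijective_of_isIntegral (k := ℂ))
  refine ⟨(e.symm : A ⧸ m →ₐ[ℂ] ℂ).comp (Ideal.Quotient.mkₐ ℂ m), fun a ha => ?_⟩
  have : Ideal.Quotient.mkₐ ℂ m a = 0 := Ideal.Quotient.eq_zero_iff_mem.2 ha
  rw [AlgHom.comp_apply, this, map_zero]

/-- If the holomorphic functions have expansions in a multiplicative basis, then they are faithfully
flat: relations are trivial, and by the Nullstellensatz each proper ideal has a zero. -/
theorem SeriesExpansion.faithfullyFlat {A Λ : Type*} [CommRing A] [Algebra ℂ A] [AddGroup Λ]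
    {b : Module.Basis Λ ℂ A} {w : Λ → ℕ} (E : SeriesExpansion b w)
    (hb : ∀ x y, b (x + y) = b x * b y) (hw : ∀ x y, w (x + y) ≤ w x + w y) {n : ℕ}
    (P : MonomialPresentation b w n) : (toHolomorphicFunctions A).toRingHom.FaithfullyFlat := by
  have : Algebra.FiniteType ℂ A := .of_surjective P.π fun u => ⟨P.lift u, P.π_lift u⟩
  let _ : Algebra A (HolomorphicFunctions A) := (toHolomorphicFunctions A).toRingHom.toAlgebra
  have hsmul : ∀ (a : A) (f : HolomorphicFunctions A), a • f = toHolomorphicFunctions A a * f :=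
    fun _ _ => rfl
  change Module.FaithfullyFlat A (HolomorphicFunctions A)
  have hflat : Module.Flat A (HolomorphicFunctions A) := by
    rw [Module.Flat.iff_forall_isTrivialRelation]
    intro l f x h
    obtain ⟨κ, _, a, y, h₁, h₂⟩ := E.exists_of_sum_eq_zero hb hw P f x h
    let e := (Fintype.equivFin κ).symm
    refine ⟨_, fun i j => a i (e j), fun j => y (e j), fun i => ?_, fun j => h₂ _⟩
    rw [h₁ i]
    exact (e.sum_comp fun j => a i j • y j).symm
  refine ⟨fun m hm htop => ?_⟩
  obtain ⟨y, hy⟩ := exists_complexPoint m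
  have h1 : (1 : HolomorphicFunctions A) ∈ m • (⊤ : Submodule A (HolomorphicFunctions A)) := by
    rw [htop]; trivial
  have key : ∀ f ∈ m • (⊤ : Submodule A (HolomorphicFunctions A)), f.1 y = 0 := by
    intro f hf
    induction hf using Submodule.smul_induction_on' with
    | smul a ha f _ =>
      rw [hsmul]
      change y a * f.1 y = 0
      rw [hy a ha, zero_mul]
    | add f _ g _ hf hg =>
      change f.1 y + g.1 y = 0
      rw [hf, hg, add_zero]
  exact one_ne_zero (key 1 h1)

/-! ### Laurent series of holomorphic functions on a complex torus -/

namespace Laurent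

open MeasureTheory

/-- The points of `ℂ^r` without vanishing coordinates. -/
def torus (r : ℕ) : Set (Fin r → ℂ) := {z | ∀ i, z i ≠ 0}

/-- The normalised Haar measure of the compact torus `(ℝ / ℤ)^r`. -/
abbrev haarTorus (r : ℕ) : Measure (UnitAddTorus (Fin r)) :=
  Measure.pi fun _ => AddCircle.haarAddCircle

theorem isOpen_torus (r : ℕ) : IsOpen (torus r) := by
  have : torus r = ⋂ i, {z | z i ≠ 0} := by ext; simp [torus]
  rw [this]
  exact isOpen_iInter_of_finite fun i => isOpen_ne.preimage (continuous_apply i)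

/-- The point with the given moduli and arguments. -/
def polar {r : ℕ} (ρ : Fin r → ℝ) (u : UnitAddTorus (Fin r)) : Fin r → ℂ :=
  fun i => ρ i * AddCircle.toCircle (u i)

theorem continuous_polar {r : ℕ} (ρ : Fin r → ℝ) : Continuous (polar ρ) := by
  unfold polar
  refine continuous_pi fun i => continuous_const.mul ?_
  exact continuous_subtype_val.comp (AddCircle.continuous_toCircle.comp (continuous_apply i))

theorem polar_mem {r : ℕ} {ρ : Fin r → ℝ} (hρ : ∀ i, 0 < ρ i) (u : UnitAddTorus (Fin r)) :
    polar ρ u ∈ torus r := fun i => by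
  simp [polar, (hρ i).ne']

/-- The mean over a circle around the origin of a function holomorphic outside the origin does not
depend on the radius. -/
theorem integral_circle_eq {k : ℂ → ℂ} (hk : DifferentiableOn ℂ k {0}ᶜ) {s t : ℝ} (hs : 0 < s)
    (ht : 0 < t) : ∫ θ : UnitAddCircle, k (s * AddCircle.toCircle θ) ∂AddCircle.haarAddCircle =
      ∫ θ : UnitAddCircle, k (t * AddCircle.toCircle θ) ∂AddCircle.haarAddCircle := by
  have havg : ∀ s : ℝ, ∫ θ : UnitAddCircle, k (s * AddCircle.toCircle θ)
      ∂AddCircle.haarAddCircle = Real.circleAverage k 0 s := by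
    intro s
    rw [AddCircle.integral_haarAddCircle, inv_one, one_smul,
      ← UnitAddCircle.intervalIntegral_preimage 0, Real.circleAverage_def, zero_add]
    have h := intervalIntegral.integral_comp_mul_left (a := 0) (b := 1)
      (fun θ => k (circleMap 0 s θ)) (c := 2 * Real.pi) (by positivity)
    rw [mul_zero, mul_one] at h
    rw [← h]
    refine intervalIntegral.integral_congr fun θ _ => ?_
    simp [AddCircle.toCircle_apply_mk, circleMap, Circle.coe_exp]
  have key : ∀ s t : ℝ, 0 < s → s ≤ t → Real.circleAverage k 0 t = Real.circleAverage k 0 s := by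
    intro s t hs hst
    rw [Real.circleAverage_eq_circleIntegral hs.ne',
      Real.circleAverage_eq_circleIntegral (hs.trans_le hst).ne',
      Complex.circleIntegral_sub_center_inv_smul_eq_of_differentiable_on_annulus_off_countable hs
        hst Set.countable_empty]
    · refine hk.continuousOn.mono fun z hz => ?_
      rintro rfl
      exact hz.2 (Metric.mem_ball_self hs)
    · intro z hz
      refine (hk z ?_).differentiableAt (isOpen_compl_singleton.mem_nhds ?_) <;>
      · rintro rfl
        exact hz.1.2 (Metric.mem_closedBall_self hs.le)
  rw [havg, havg]
  rcases le_total s t with h | h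
  · exact (key s t hs h).symm
  · exact key t s ht h

variable {r : ℕ} {g : (Fin r → ℂ) → ℂ}

theorem continuous_comp_polar (hg : DifferentiableOn ℂ g (torus r)) {ρ : Fin r → ℝ}
    (hρ : ∀ i, 0 < ρ i) : Continuous fun u => g (polar ρ u) :=
  hg.continuousOn.comp_continuous (continuous_polar ρ) (polar_mem hρ)

theorem integral_swap {F : UnitAddCircle → UnitAddTorus (Fin r) → ℂ}
    (hF : Continuous (Function.uncurry F)) :
    ∫ θ, ∫ u, F θ u ∂haarTorus r ∂AddCircle.haarAddCircle =
      ∫ u, ∫ θ, F θ u ∂AddCircle.haarAddCircle ∂haarTorus r :=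
  integral_integral_swap
    (hF.integrable_of_hasCompactSupport (HasCompactSupport.of_compactSpace _))

theorem integral_rotate (F : UnitAddTorus (Fin r) → ℂ) (v : UnitAddTorus (Fin r)) :
    ∫ u, F (u + v) ∂haarTorus r = ∫ u, F u ∂haarTorus r :=
  integral_add_right_eq_self F v

/-- The mean over a torus does not change with one of the radii. -/
theorem integral_polar_update (hg : DifferentiableOn ℂ g (torus r)) {ρ : Fin r → ℝ}
    (hρ : ∀ i, 0 < ρ i) (i : Fin r) {s : ℝ} (hs : 0 < s) :
    ∫ u, g (polar (Function.update ρ i s) u) ∂haarTorus r = ∫ u, g (polar ρ u) ∂haarTorus r := by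
  -- averaging over the rotations of the coordinate `i` turns both sides into the same integral
  have havg : ∀ ρ : Fin r → ℝ, (∀ i, 0 < ρ i) → ∫ u, g (polar ρ u) ∂haarTorus r =
      ∫ u, ∫ θ : UnitAddCircle, g (Function.update (polar ρ u) i (ρ i * AddCircle.toCircle θ))
        ∂AddCircle.haarAddCircle ∂haarTorus r := by
    intro ρ hρ
    have h1 : ∀ (u : UnitAddTorus (Fin r)) (θ : UnitAddCircle), polar ρ (u + Pi.single i θ) =
        Function.update (polar ρ u) i (ρ i * AddCircle.toCircle (θ + u i)) := by
      intro u θ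
      ext j
      by_cases hj : j = i
      · subst hj; simp [polar, add_comm]
      · simp [polar, hj]
    have hcont : Continuous (Function.uncurry fun (θ : UnitAddCircle)
        (u : UnitAddTorus (Fin r)) => g (polar ρ (u + Pi.single i θ))) :=
      (continuous_comp_polar hg hρ).comp
        (continuous_snd.add ((continuous_single i).comp continuous_fst))
    have hswap := integral_swap hcont
    have hinv : ∀ θ : UnitAddCircle, ∫ u, g (polar ρ (u + Pi.single i θ)) ∂haarTorus r =
        ∫ u, g (polar ρ u) ∂haarTorus r := fun θ =>
      integral_rotate (fun u => g (polar ρ u)) (Pi.single i θ)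
    rw [funext hinv, integral_const] at hswap
    simp only [h1] at hswap
    rw [probReal_univ, one_smul] at hswap
    rw [hswap]
    congr 1 with u
    exact integral_add_right_eq_self
      (fun θ => g (Function.update (polar ρ u) i (ρ i * AddCircle.toCircle θ))) (u i)
  have hρ' : ∀ j, 0 < Function.update ρ i s j := fun j => by
    by_cases hj : j = i
    · subst hj; simpa using hs
    · simpa [hj] using hρ j
  rw [havg _ hρ', havg _ hρ]
  congr 1 with u
  have h2 : ∀ c, Function.update (polar (Function.update ρ i s) u) i c =
      Function.update (polar ρ u) i c := by
    intro c
    ext j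
    by_cases hj : j = i
    · subst hj; simp
    · simp [polar, hj]
  simp only [h2, Function.update_self]
  refine integral_circle_eq (k := fun ζ => g (Function.update (polar ρ u) i ζ)) ?_ hs (hρ i)
  have hupd : Differentiable ℂ fun ζ : ℂ => Function.update (polar ρ u) i ζ :=
    fun ζ => (hasFDerivAt_update (polar ρ u) ζ).differentiableAt
  refine hg.comp hupd.differentiableOn fun ζ hζ j => ?_
  by_cases hj : j = i
  · subst hj; simpa using hζ
  · simpa [hj] using polar_mem hρ u j

/-- The mean of a holomorphic function over a torus does not depend on the radii. -/
theorem integral_polar_eq_one (hg : DifferentiableOn ℂ g (torus r)) {ρ : Fin r → ℝ}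
    (hρ : ∀ i, 0 < ρ i) : ∫ u, g (polar ρ u) ∂haarTorus r = ∫ u, g (polar 1 u) ∂haarTorus r := by
  have key : ∀ s : Finset (Fin r),
      ∫ u, g (polar (fun i => if i ∈ s then ρ i else 1) u) ∂haarTorus r =
        ∫ u, g (polar 1 u) ∂haarTorus r := by
    intro s
    induction s using Finset.induction_on with
    | empty => simp; rfl
    | insert i s hi ih =>
      rw [← ih]
      have h : (fun j => if j ∈ insert i s then ρ j else 1) =
          Function.update (fun j => if j ∈ s then ρ j else 1) i (ρ i) := by
        ext j
        by_cases hj : j = i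
        · subst hj; simp
        · simp [hj]
      rw [h]
      refine integral_polar_update hg (fun j => ?_) i (hρ i)
      split_ifs
      exacts [hρ j, one_pos]
  simpa using key Finset.univ

/-- The Laurent coefficients of a function on the complex torus. -/
def coeff (g : (Fin r → ℂ) → ℂ) (n : Fin r → ℤ) : ℂ :=
  ∫ u, g (polar 1 u) * ∏ i, polar 1 u i ^ (-n i) ∂haarTorus r

theorem differentiableOn_monomial (n : Fin r → ℤ) :
    DifferentiableOn ℂ (fun z : Fin r → ℂ => ∏ i, z i ^ n i) (torus r) := by
  classical
  intro z hz
  refine DifferentiableAt.differentiableWithinAt ?_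
  induction (Finset.univ : Finset (Fin r)) using Finset.induction_on with
  | empty => simp
  | insert i s hi ih =>
    simp only [Finset.prod_insert hi]
    refine DifferentiableAt.mul ?_ ih
    exact DifferentiableAt.comp (g := fun ζ : ℂ => ζ ^ n i) (f := fun z : Fin r → ℂ => z i) z
      (differentiableAt_zpow.2 (Or.inl (hz i))) (differentiableAt_apply i z)

theorem mFourier_eq (u : UnitAddTorus (Fin r)) (n : Fin r → ℤ) :
    UnitAddTorus.mFourier n u = ∏ i, (AddCircle.toCircle (u i) : ℂ) ^ n i := by
  simp [UnitAddTorus.mFourier, fourier_apply, AddCircle.toCircle_zsmul]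

/-- The Fourier coefficients on the torus with radii `ρ` are multiples of the Laurent
coefficients. -/
theorem mFourierCoeff_eq (hg : DifferentiableOn ℂ g (torus r)) {ρ : Fin r → ℝ}
    (hρ : ∀ i, 0 < ρ i) (n : Fin r → ℤ) :
    UnitAddTorus.mFourierCoeff (fun u => g (polar ρ u)) n = coeff g n * ∏ i, (ρ i : ℂ) ^ n i := by
  rw [coeff, ← integral_polar_eq_one (g := fun z => g z * ∏ i, z i ^ (-n i))
    (hg.mul (differentiableOn_monomial fun i => -n i)) hρ, ← integral_mul_const,
    UnitAddTorus.mFourierCoeff]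
  refine integral_congr_ae (μ := haarTorus r) (.of_forall fun u => ?_)
  have hp : polar ρ u = fun i => ↑(ρ i) * ((u i).toCircle : ℂ) := rfl
  simp only [mFourier_eq, hp, mul_zpow, Finset.prod_mul_distrib, smul_eq_mul, Pi.neg_apply]
  have h : (∏ i, (ρ i : ℂ) ^ (-n i)) * ∏ i, (ρ i : ℂ) ^ n i = 1 := by
    rw [← Finset.prod_mul_distrib]
    refine Finset.prod_eq_one fun i _ => ?_
    rw [← zpow_add₀ (by exact_mod_cast (hρ i).ne'), neg_add_cancel, zpow_zero]
  linear_combination (-(g fun i => ↑(ρ i) * ((u i).toCircle : ℂ)) *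
    ∏ i, ((u i).toCircle : ℂ) ^ (-n i)) * h

/-- Cauchy's estimate. -/
theorem exists_norm_coeff_le (hg : DifferentiableOn ℂ g (torus r)) {ρ : Fin r → ℝ}
    (hρ : ∀ i, 0 < ρ i) : ∃ C : ℝ, ∀ n, ‖coeff g n‖ * ∏ i, ρ i ^ n i ≤ C := by
  obtain ⟨C, hC⟩ := (isCompact_range (continuous_comp_polar hg hρ)).isBounded.exists_norm_le
  refine ⟨C, fun n => ?_⟩
  have h : ‖UnitAddTorus.mFourierCoeff (fun u => g (polar ρ u)) n‖ ≤ C := by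
    rw [← mul_one C, ← probReal_univ (μ := haarTorus r)]
    refine norm_integral_le_of_norm_le_const (μ := haarTorus r) (.of_forall fun u => ?_)
    have hn : ‖UnitAddTorus.mFourier (-n) u‖ = 1 := by
      rw [mFourier_eq, norm_prod]
      exact Finset.prod_eq_one fun i _ => by rw [norm_zpow, Circle.norm_coe, one_zpow]
    rw [norm_smul, hn, one_mul]
    exact hC _ ⟨u, rfl⟩
  rw [mFourierCoeff_eq hg hρ, norm_mul, norm_prod] at h
  convert h using 3 with i
  rw [norm_zpow, Complex.norm_real, Real.norm_of_nonneg (hρ _).le]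

/-- The weight `Σ |n_i|` of an exponent. -/
def weight (n : Fin r → ℤ) : ℕ := ∑ i, (n i).natAbs

theorem summable_pow_weight {q : ℝ} (h0 : 0 ≤ q) (h1 : q < 1) :
    Summable fun n : Fin r → ℤ => q ^ weight n := by
  have hZ : Summable fun k : ℤ => q ^ k.natAbs := by
    refine Summable.of_nat_of_neg ?_ ?_ <;>
    simpa using summable_geometric_of_lt_one h0 h1
  induction r with
  | zero => exact (hasSum_fintype _).summable
  | succ r ih =>
    rw [← (Fin.consEquiv fun _ => ℤ).summable_iff]
    have h := hZ.mul_of_nonneg ih (fun k => by positivity) fun n => by positivity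
    refine h.congr fun x => ?_
    simp [weight, Fin.sum_univ_succ, pow_add, Fin.consEquiv]

/-- The Laurent coefficients decrease faster than every geometric progression. -/
theorem summable_norm_coeff_mul (hg : DifferentiableOn ℂ g (torus r)) {R : ℝ} (hR : 1 ≤ R) :
    Summable fun n => ‖coeff g n‖ * R ^ weight n := by
  have hR0 : 0 < 2 * R := by linarith
  -- radii `2 R` or `(2 R)⁻¹` in each coordinate, according to the sign of the exponent
  let ρ : (Fin r → Bool) → Fin r → ℝ := fun ε i => if ε i then 2 * R else (2 * R)⁻¹
  have hρ : ∀ ε i, 0 < ρ ε i := fun ε i => by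
    dsimp only [ρ]
    split_ifs <;> positivity
  choose C hC using fun ε => exists_norm_coeff_le hg (hρ ε)
  have hle : ∀ n, ‖coeff g n‖ * (2 * R) ^ weight n ≤ ∑ ε, |C ε| := by
    intro n
    have h := hC (fun i => decide (0 ≤ n i)) n
    have hp : ∏ i, ρ (fun i => decide (0 ≤ n i)) i ^ n i = (2 * R) ^ weight n := by
      rw [weight, ← Finset.prod_pow_eq_pow_sum]
      refine Finset.prod_congr rfl fun i _ => ?_
      by_cases hi : 0 ≤ n i
      · simp only [ρ, hi, decide_true, if_true]
        rw [← zpow_natCast, Int.natCast_natAbs, abs_of_nonneg hi]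
      · simp only [ρ, hi, decide_false, Bool.false_eq_true, if_false]
        rw [← zpow_natCast, Int.natCast_natAbs, abs_of_neg (not_le.1 hi), inv_zpow']
    rw [hp] at h
    exact h.trans ((le_abs_self _).trans
      (Finset.single_le_sum (f := fun ε => |C ε|) (fun ε _ => abs_nonneg _) (Finset.mem_univ _)))
  refine Summable.of_nonneg_of_le (fun n => by positivity) (fun n => ?_)
    ((summable_pow_weight (r := r) (q := 1 / 2) (by norm_num) (by norm_num)).mul_left
      (∑ ε, |C ε|))
  calc ‖coeff g n‖ * R ^ weight n
      = ‖coeff g n‖ * (2 * R) ^ weight n * (1 / 2) ^ weight n := by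
        rw [mul_assoc, ← mul_pow]; congr 2; ring
    _ ≤ _ := by gcongr; exact hle n

theorem exists_eq_polar {z : Fin r → ℂ} (hz : z ∈ torus r) :
    ∃ (ρ : Fin r → ℝ) (u : UnitAddTorus (Fin r)), (∀ i, 0 < ρ i) ∧ polar ρ u = z := by
  refine ⟨fun i => ‖z i‖, fun i => ((2 * Real.pi)⁻¹ * (z i).arg : ℝ),
    fun i => norm_pos_iff.2 (hz i), ?_⟩
  ext i
  rw [polar, AddCircle.toCircle_apply_mk, Circle.coe_exp]
  conv_rhs => rw [← Complex.norm_mul_exp_arg_mul_I (z i)]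
  congr 3
  push_cast
  have : (Real.pi : ℂ) ≠ 0 := by exact_mod_cast Real.pi_ne_zero
  field_simp

/-- A holomorphic function on the complex torus is the sum of its Laurent series. -/
theorem hasSum_coeff (hg : DifferentiableOn ℂ g (torus r)) {z : Fin r → ℂ} (hz : z ∈ torus r) :
    HasSum (fun n => coeff g n * ∏ i, z i ^ n i) (g z) := by
  obtain ⟨ρ, u, hρ, rfl⟩ := exists_eq_polar hz
  let G : C(UnitAddTorus (Fin r), ℂ) := ⟨fun u => g (polar ρ u), continuous_comp_polar hg hρ⟩
  have hcoe : ∀ n, UnitAddTorus.mFourierCoeff G n = coeff g n * ∏ i, (ρ i : ℂ) ^ n i :=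
    mFourierCoeff_eq hg hρ
  -- a common bound for the radii and their inverses
  obtain ⟨R, hR1, hR⟩ : ∃ R : ℝ, 1 ≤ R ∧ ∀ i, ρ i ≤ R ∧ (ρ i)⁻¹ ≤ R := by
    refine ⟨1 + ∑ i, (ρ i + (ρ i)⁻¹), ?_, fun i => ?_⟩
    · have : 0 ≤ ∑ i, (ρ i + (ρ i)⁻¹) :=
        Finset.sum_nonneg fun i _ => by have := hρ i; positivity
      linarith
    · have h := Finset.single_le_sum (f := fun i => ρ i + (ρ i)⁻¹) (s := Finset.univ)
        (fun i _ => by have := hρ i; positivity) (Finset.mem_univ i)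
      have h1 := hρ i
      have h2 : 0 < (ρ i)⁻¹ := by positivity
      constructor <;> linarith
  have hs : Summable (UnitAddTorus.mFourierCoeff G) := by
    refine Summable.of_norm_bounded (summable_norm_coeff_mul hg hR1) fun n => ?_
    rw [hcoe, norm_mul, norm_prod, weight, ← Finset.prod_pow_eq_pow_sum]
    gcongr with i
    rw [norm_zpow, Complex.norm_real, Real.norm_of_nonneg (hρ i).le]
    rcases le_total 0 (n i) with hi | hi
    · conv_lhs => rw [← abs_of_nonneg hi, ← Int.natCast_natAbs, zpow_natCast]
      exact pow_le_pow_left₀ (hρ i).le (hR i).1 _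
    · have : ρ i ^ n i = (ρ i)⁻¹ ^ (n i).natAbs := by
        rw [← zpow_natCast, Int.natCast_natAbs, abs_of_nonpos hi, inv_zpow', neg_neg]
      rw [this]
      exact pow_le_pow_left₀ (inv_nonneg.2 (hρ i).le) (hR i).2 _
  refine (UnitAddTorus.hasSum_mFourier_series_apply_of_summable hs u).congr_fun ?_
  intro n
  rw [hcoe, mFourier_eq, smul_eq_mul, mul_assoc, ← Finset.prod_mul_distrib]
  simp only [polar, mul_zpow]

theorem coeff_monomial_mul (g : (Fin r → ℂ) → ℂ) (m n : Fin r → ℤ) :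
    coeff (fun z => (∏ i, z i ^ m i) * g z) (m + n) = coeff g n := by
  rw [coeff, coeff]
  congr 1 with u
  have h0 : ∀ i, polar 1 u i ≠ 0 := polar_mem (fun _ => one_pos) u
  rw [mul_comm (∏ i, _) (g _), mul_assoc, ← Finset.prod_mul_distrib]
  congr 2 with i
  rw [← zpow_add₀ (h0 i), Pi.add_apply]
  congr 1
  ring

theorem coeff_congr {g g' : (Fin r → ℂ) → ℂ} (h : Set.EqOn g g' (torus r)) :
    coeff g = coeff g' := by
  ext n
  rw [coeff, coeff]
  congr 1 with u
  rw [h (polar_mem (ρ := 1) (fun _ => one_pos) u)]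

theorem integrable_coeff (hg : DifferentiableOn ℂ g (torus r)) (n : Fin r → ℤ) :
    Integrable (fun u => g (polar 1 u) * ∏ i, polar 1 u i ^ (-n i)) (haarTorus r) :=
  (continuous_comp_polar (hg.mul (differentiableOn_monomial fun i => -n i))
    fun _ => one_pos).integrable_of_hasCompactSupport (HasCompactSupport.of_compactSpace _)

theorem coeff_add {g g' : (Fin r → ℂ) → ℂ} (hg : DifferentiableOn ℂ g (torus r))
    (hg' : DifferentiableOn ℂ g' (torus r)) (n : Fin r → ℤ) :
    coeff (fun z => g z + g' z) n = coeff g n + coeff g' n := by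
  rw [coeff, coeff, coeff, ← integral_add (integrable_coeff hg n) (integrable_coeff hg' n)]
  congr 1 with u
  ring

theorem coeff_const_mul (c : ℂ) (g : (Fin r → ℂ) → ℂ) (n : Fin r → ℤ) :
    coeff (fun z => c * g z) n = c * coeff g n := by
  rw [coeff, coeff, ← integral_const_mul]
  congr 1 with u
  ring

end Laurent

/-! ### Algebras of finitely generated abelian groups -/

section MultiplicativeBasis

variable {A Λ : Type*} [CommRing A] [Algebra ℂ A] [AddCommGroup Λ] {b : Module.Basis Λ ℂ A}

theorem basis_zero_eq_one (hb : ∀ x y, b (x + y) = b x * b y) : b 0 = 1 := by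
  have h : LinearMap.mulLeft ℂ (b 0) = LinearMap.id := b.ext fun x => by simp [← hb]
  simpa using LinearMap.congr_fun h 1

theorem basis_sum_smul (hb : ∀ x y, b (x + y) = b x * b y) {ι : Type*} (s : Finset ι) (v : ι → Λ)
    (α : ι → ℕ) : b (∑ i ∈ s, α i • v i) = ∏ i ∈ s, b (v i) ^ α i := by
  classical
  have hpow : ∀ (k : ℕ) x, b (k • x) = b x ^ k := by
    intro k x
    induction k with
    | zero => rw [zero_smul, pow_zero, basis_zero_eq_one hb]
    | succ k ih => rw [succ_nsmul, hb, ih, pow_succ]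
  induction s using Finset.induction_on with
  | empty => simpa using basis_zero_eq_one hb
  | insert i s hi ih => rw [Finset.sum_insert hi, Finset.prod_insert hi, hb, ih, hpow]

/-- The complex point of an algebra with a multiplicative basis given by a character of the group
of exponents. -/
def pointOfCharacter (hb : ∀ x y, b (x + y) = b x * b y) (φ : AddChar Λ ℂ) : ComplexPoints A :=
  AlgHom.ofLinearMap (b.constr ℂ (φ : Λ → ℂ))
    (by rw [← basis_zero_eq_one hb, b.constr_basis, φ.map_zero_eq_one])
    (by
      let L : A →ₗ[ℂ] ℂ := b.constr ℂ (φ : Λ → ℂ)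
      have h : (LinearMap.mul ℂ A).compr₂ L = (LinearMap.mul ℂ ℂ).compl₁₂ L L :=
        b.ext fun x => b.ext fun y => by
          simp [L, ← hb, b.constr_basis, φ.map_add_eq_mul]
      exact fun u v => LinearMap.congr_fun₂ h u v)

theorem pointOfCharacter_basis (hb : ∀ x y, b (x + y) = b x * b y) (φ : AddChar Λ ℂ) (x : Λ) :
    pointOfCharacter hb φ (b x) = φ x := b.constr_basis ℂ _ _

theorem pointOfCharacter_apply (hb : ∀ x y, b (x + y) = b x * b y) (φ : AddChar Λ ℂ) (a : A) :
    pointOfCharacter hb φ a = ∑ x ∈ (b.repr a).support, b.repr a x * φ x := by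
  change (b.constr ℂ (φ : Λ → ℂ) : A →ₗ[ℂ] ℂ) a = _
  rw [Module.Basis.constr_apply, Finsupp.sum]
  rfl

/-- A weighted multiplicative basis has a monomial presentation if finitely many exponents of
weight at most one generate all exponents, with lengths controlled by the weights. -/
theorem exists_monomialPresentation (hb : ∀ x y, b (x + y) = b x * b y) {w : Λ → ℕ}
    (hw0 : w 0 = 0) (hw : ∀ x y, w (x + y) ≤ w x + w y) {ι : Type*} [Fintype ι] (v : ι → Λ)
    (hv : ∀ i, w (v i) ≤ 1) (hgen : ∀ x, ∃ α : ι → ℕ, ∑ i, α i • v i = x ∧ ∑ i, α i ≤ w x + 1) :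
    Nonempty (MonomialPresentation b w (Fintype.card ι)) := by
  let e := Fintype.equivFin ι
  choose α hα hαw using hgen
  let π : MvPolynomial (Fin (Fintype.card ι)) ℂ →ₐ[ℂ] A :=
    MvPolynomial.aeval fun j => b (v (e.symm j))
  have hπ : ∀ β : Fin (Fintype.card ι) →₀ ℕ,
      π (MvPolynomial.monomial β 1) = b (∑ j, β j • v (e.symm j)) := by
    intro β
    rw [basis_sum_smul hb, MvPolynomial.aeval_monomial, map_one, one_mul,
      Finsupp.prod_fintype _ _ fun j => pow_zero _]
  have hdeg : ∀ β : Fin (Fintype.card ι) →₀ ℕ, β.degree = ∑ j, β j :=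
    fun β => Finsupp.degree_eq_sum β
  refine ⟨⟨π, fun x => Finsupp.equivFunOnFinite.symm fun j => α x (e.symm j), fun x => ?_,
    fun x => ?_, fun β => ⟨_, hπ β, ?_⟩⟩⟩
  · rw [hπ]
    refine congrArg b (Eq.trans ?_ (hα x))
    exact e.symm.sum_comp fun i => α x i • v i
  · rw [hdeg]
    refine le_trans (le_of_eq ?_) (hαw x)
    exact e.symm.sum_comp fun i => α x i
  · rw [hdeg]
    have hmul : ∀ (k : ℕ) x, w x ≤ 1 → w (k • x) ≤ k := by
      intro k x hx
      induction k with
      | zero => simp [hw0]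
      | succ k ih =>
        rw [succ_nsmul]
        exact (hw _ _).trans (add_le_add ih hx)
    have hsum : ∀ s : Finset (Fin (Fintype.card ι)),
        w (∑ j ∈ s, β j • v (e.symm j)) ≤ ∑ j ∈ s, β j := by
      intro s
      induction s using Finset.induction_on with
      | empty => simp [hw0]
      | insert i s hi ih =>
        rw [Finset.sum_insert hi, Finset.sum_insert hi]
        exact (hw _ _).trans (add_le_add (hmul _ _ (hv _)) ih)
    exact hsum _

end MultiplicativeBasis

namespace Laurent

variable {r : ℕ} {F : Type*} [AddCommGroup F]

/-- The character of `ℤ^r × F` given by a point of the complex torus and a character of `F`. -/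
def character {z : Fin r → ℂ} (hz : z ∈ torus r) (χ : AddChar F ℂ) :
    AddChar ((Fin r → ℤ) × F) ℂ where
  toFun x := (∏ i, z i ^ x.1 i) * χ x.2
  map_zero_eq_one' := by simp
  map_add_eq_mul' x y := by
    simp only [Prod.fst_add, Prod.snd_add, Pi.add_apply, χ.map_add_eq_mul, zpow_add₀ (hz _),
      Finset.prod_mul_distrib]
    ring

theorem character_apply {z : Fin r → ℂ} (hz : z ∈ torus r) (χ : AddChar F ℂ)
    (x : (Fin r → ℤ) × F) : character hz χ x = (∏ i, z i ^ x.1 i) * χ x.2 := rfl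

variable {A : Type*} [CommRing A] [Algebra ℂ A] {b : Module.Basis ((Fin r → ℤ) × F) ℂ A}

/-- Each complex point comes from a point of the complex torus and a character of `F`. -/
theorem exists_apply_basis (hb : ∀ x y, b (x + y) = b x * b y) (y : ComplexPoints A) :
    ∃ (z : Fin r → ℂ) (hz : z ∈ torus r) (χ : AddChar F ℂ),
      pointOfCharacter hb (character hz χ) = y := by
  have h0 : y (b 0) = 1 := by rw [basis_zero_eq_one hb, map_one]
  have hinv : ∀ x, y (b x) * y (b (-x)) = 1 := fun x => by
    rw [← map_mul, ← hb, add_neg_cancel, h0]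
  have hne : ∀ x, y (b x) ≠ 0 := fun x h => by simpa [h] using hinv x
  have hneg : ∀ x, y (b (-x)) = (y (b x))⁻¹ := fun x => eq_inv_of_mul_eq_one_right (hinv x)
  have hz : ∀ (k : ℤ) x, y (b (k • x)) = y (b x) ^ k := by
    have hn : ∀ (k : ℕ) x, y (b (k • x)) = y (b x) ^ k := by
      intro k x
      have := basis_sum_smul hb {()} (fun _ => x) fun _ => k
      simp only [Finset.sum_singleton, Finset.prod_singleton] at this
      rw [this, map_pow]
    intro k x
    obtain ⟨k, rfl | rfl⟩ := k.eq_nat_or_neg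
    · rw [natCast_zsmul, hn, zpow_natCast]
    · rw [neg_smul, natCast_zsmul, hneg, hn, zpow_neg, zpow_natCast]
  have ht : (fun i => y (b (Pi.single i 1, 0))) ∈ torus r := fun i => hne _
  refine ⟨fun i => y (b (Pi.single i 1, 0)), ht,
    ⟨fun t => y (b (0, t)), h0, fun s t => by rw [← map_mul, ← hb]; simp⟩, ?_⟩
  refine AlgHom.toLinearMap_injective (b.ext fun x => ?_)
  change pointOfCharacter hb _ (b x) = y (b x)
  rw [pointOfCharacter_basis, character_apply]
  change (∏ i, y (b (Pi.single i 1, 0)) ^ x.1 i) * y (b (0, x.2)) = y (b x)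
  have hx : x = ∑ i, x.1 i • ((Pi.single i 1, 0) : (Fin r → ℤ) × F) + (0, x.2) := by
    ext j
    · simp [Prod.fst_sum, Finset.sum_apply, Pi.single_apply]
    · simp [Prod.snd_sum]
  conv_rhs => rw [hx, hb, map_mul]
  congr 1
  have hs : ∀ s : Finset (Fin r), y (b (∑ i ∈ s, x.1 i • ((Pi.single i 1, 0) : (Fin r → ℤ) × F))) =
      ∏ i ∈ s, y (b (Pi.single i 1, 0)) ^ x.1 i := by
    intro s
    induction s using Finset.induction_on with
    | empty => simpa using h0
    | insert i s hi ih => rw [Finset.sum_insert hi, Finset.prod_insert hi, hb, map_mul, ih, hz]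
  exact (hs _).symm

open Classical in
/-- The restriction of a function on the complex points to the copy of the complex torus that
belongs to the character `χ` of `F`, extended by zero to `ℂ^r`. -/
def restrict (hb : ∀ x y, b (x + y) = b x * b y) (f : ComplexPoints A → ℂ) (χ : AddChar F ℂ)
    (z : Fin r → ℂ) : ℂ :=
  if hz : z ∈ torus r then f (pointOfCharacter hb (character hz χ)) else 0

theorem restrict_of_mem (hb : ∀ x y, b (x + y) = b x * b y) (f : ComplexPoints A → ℂ)
    (χ : AddChar F ℂ) {z : Fin r → ℂ} (hz : z ∈ torus r) :
    restrict hb f χ z = f (pointOfCharacter hb (character hz χ)) := dif_pos hz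

theorem differentiableOn_restrict (hb : ∀ x y, b (x + y) = b x * b y) {f : ComplexPoints A → ℂ}
    (hf : IsHolomorphicOnPoints f) (χ : AddChar F ℂ) :
    DifferentiableOn ℂ (restrict hb f χ) (torus r) := by
  intro z hz
  obtain ⟨k, g, V, Φ, hV, hzV, hΦ, hfΦ⟩ := hf (pointOfCharacter hb (character hz χ))
  let G : (Fin r → ℂ) → Fin k → ℂ := fun z i =>
    ∑ x ∈ (b.repr (g i)).support, b.repr (g i) x * ((∏ i, z i ^ x.1 i) * χ x.2)
  have hG : ∀ z (hz : z ∈ torus r), (fun i => pointOfCharacter hb (character hz χ) (g i)) = G z :=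
    fun z hz => funext fun i => pointOfCharacter_apply hb _ _
  have hGd : DifferentiableOn ℂ G (torus r) := by
    refine differentiableOn_pi.2 fun i => DifferentiableOn.fun_sum fun x _ => ?_
    exact ((differentiableOn_monomial x.1).mul_const _).const_mul _
  rw [hG z hz] at hzV
  have hnhds : torus r ∈ nhds z := (isOpen_torus r).mem_nhds hz
  have hGz : DifferentiableAt ℂ G z := (hGd z hz).differentiableAt hnhds
  have hev : restrict hb f χ =ᶠ[nhds z] Φ ∘ G := by
    filter_upwards [hnhds, hGz.continuousAt.preimage_mem_nhds (hV.mem_nhds hzV)] with u hu huV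
    rw [restrict_of_mem hb f χ hu, hfΦ _ (by rw [hG u hu]; exact huV), hG u hu]
    rfl
  exact ((((hΦ _ hzV).differentiableAt (hV.mem_nhds hzV)).comp z hGz).congr_of_eventuallyEq
    hev).differentiableWithinAt

variable [Finite F]

/-- The coefficients of a holomorphic function on the complex points: Laurent coefficients in the
direction of `ℤ^r`, and Fourier coefficients in the direction of the finite group `F`. -/
def pointCoeff (hb : ∀ x y, b (x + y) = b x * b y) (f : ComplexPoints A → ℂ)
    (x : (Fin r → ℤ) × F) : ℂ :=
  (Nat.card F : ℂ)⁻¹ * ∑ χ : AddChar F ℂ, χ (-x.2) * coeff (restrict hb f χ) x.1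

theorem summable_pointCoeff (hb : ∀ x y, b (x + y) = b x * b y) {f : ComplexPoints A → ℂ}
    (hf : IsHolomorphicOnPoints f) {R : ℝ} (hR : 1 ≤ R) :
    Summable fun x => ‖pointCoeff hb f x‖ * R ^ weight x.1 := by
  have hR0 : 0 ≤ R := by linarith
  have := Fintype.ofFinite F
  have h := summable_sum (s := Finset.univ) fun (χ : AddChar F ℂ) _ =>
    summable_norm_coeff_mul (differentiableOn_restrict hb hf χ) hR
  have h2 := (h.mul_left ‖(Nat.card F : ℂ)⁻¹‖).mul_of_nonneg
    (g := fun _ : F => (1 : ℝ)) (hasSum_fintype _).summable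
    (fun n => mul_nonneg (norm_nonneg _) (Finset.sum_nonneg fun χ _ => by positivity))
    fun _ => zero_le_one
  refine Summable.of_nonneg_of_le (fun x => by positivity) (fun x => ?_) h2
  rw [mul_one, pointCoeff, norm_mul, mul_assoc, ← Finset.sum_mul]
  gcongr
  refine (norm_sum_le _ _).trans (Finset.sum_le_sum fun χ _ => ?_)
  rw [norm_mul, AddChar.norm_apply, one_mul]

theorem hasSum_pointCoeff (hb : ∀ x y, b (x + y) = b x * b y) {f : ComplexPoints A → ℂ}
    (hf : IsHolomorphicOnPoints f) (y : ComplexPoints A) :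
    HasSum (fun x => pointCoeff hb f x * y (b x)) (f y) := by
  classical
  have := Fintype.ofFinite F
  obtain ⟨z, hz, χ₀, rfl⟩ := exists_apply_basis hb y
  simp only [pointOfCharacter_basis, character_apply]
  have h1 : ∀ t : F, HasSum
      (fun n : Fin r → ℤ => pointCoeff hb f (n, t) * ((∏ i, z i ^ n i) * χ₀ t))
      ((Nat.card F : ℂ)⁻¹ * (∑ χ : AddChar F ℂ, χ (-t) * restrict hb f χ z) * χ₀ t) := by
    intro t
    have h := ((hasSum_sum (s := Finset.univ) fun (χ : AddChar F ℂ) _ =>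
      (hasSum_coeff (differentiableOn_restrict hb hf χ) hz).mul_left (χ (-t))).mul_left
        ((Nat.card F : ℂ)⁻¹)).mul_right (χ₀ t)
    refine h.congr_fun fun n => ?_
    rw [pointCoeff]
    simp only [← mul_assoc, ← Finset.sum_mul]
  have h2 := hasSum_sum (s := Finset.univ) fun (t : F) _ =>
    ((Prod.mk_left_injective (β := F) (α := Fin r → ℤ) t).hasSum_iff
      (f := fun x => if x.2 = t then pointCoeff hb f x * ((∏ i, z i ^ x.1 i) * χ₀ x.2) else 0)
      (fun x hx => if_neg fun h => hx ⟨x.1, by rw [← h]⟩)).1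
      ((h1 t).congr_fun fun n => by simp)
  have hsum : ∑ t, ((Nat.card F : ℂ)⁻¹ * (∑ χ : AddChar F ℂ, χ (-t) * restrict hb f χ z) * χ₀ t)
      = f (pointOfCharacter hb (character hz χ₀)) := by
    have horth : ∀ χ : AddChar F ℂ, ∑ t, χ (-t) * χ₀ t =
        if χ = χ₀ then (Nat.card F : ℂ) else 0 := by
      intro χ
      have h := AddChar.sum_eq_ite (χ₀ - χ)
      simp only [AddChar.sub_apply, sub_eq_zero, mul_comm (χ₀ _)] at h
      rw [h, Nat.card_eq_fintype_card]
      simp only [eq_comm]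
    have hcard : (Nat.card F : ℂ) ≠ 0 := by exact_mod_cast Nat.card_pos.ne'
    simp only [mul_assoc, Finset.sum_mul, ← Finset.mul_sum]
    rw [Finset.sum_comm]
    have h3 : ∀ χ : AddChar F ℂ, ∑ t, χ (-t) * (restrict hb f χ z * χ₀ t) =
        (∑ t, χ (-t) * χ₀ t) * restrict hb f χ z := fun χ => by
      rw [Finset.sum_mul]
      exact Finset.sum_congr rfl fun t _ => by ring
    simp only [h3, horth, ite_mul, zero_mul, Finset.sum_ite_eq', Finset.mem_univ, if_true]
    rw [← mul_assoc, inv_mul_cancel₀ hcard, one_mul, restrict_of_mem hb f χ₀ hz]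
  rw [hsum] at h2
  refine h2.congr_fun fun x => ?_
  simp

theorem pointCoeff_mul (hb : ∀ x y, b (x + y) = b x * b y) (f : HolomorphicFunctions A)
    (x y : (Fin r → ℤ) × F) :
    pointCoeff hb (toHolomorphicFunctions A (b x) * f).1 (x + y) = pointCoeff hb f.1 y := by
  rw [pointCoeff, pointCoeff]
  congr 1
  refine Finset.sum_congr rfl fun χ _ => ?_
  have h : coeff (restrict hb (toHolomorphicFunctions A (b x) * f).1 χ) =
      coeff fun z => (∏ i, z i ^ x.1 i) * (χ x.2 * restrict hb f.1 χ z) := by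
    refine coeff_congr fun z hz => ?_
    rw [restrict_of_mem hb _ χ hz, restrict_of_mem hb _ χ hz, ← mul_assoc,
      ← character_apply hz χ x, ← pointOfCharacter_basis hb]
    rfl
  rw [h, Prod.fst_add, coeff_monomial_mul, coeff_const_mul, ← mul_assoc, ← χ.map_add_eq_mul]
  congr 2
  simp

/-- Expansion of the holomorphic functions on the spectrum of the group algebra of `ℤ^r × F`. -/
def seriesExpansion (hb : ∀ x y, b (x + y) = b x * b y) :
    SeriesExpansion b fun x => weight x.1 where
  coeff :=
    { toFun := fun f => pointCoeff hb f.1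
      map_add' := fun f g => by
        ext x
        change pointCoeff hb _ x = pointCoeff hb _ x + pointCoeff hb _ x
        simp only [pointCoeff, ← mul_add, ← Finset.sum_add_distrib]
        congr 1
        refine Finset.sum_congr rfl fun χ _ => ?_
        rw [← coeff_add (differentiableOn_restrict hb f.2 χ) (differentiableOn_restrict hb g.2 χ)]
        refine congrArg (χ (-x.2) * ·) (congrFun (coeff_congr (r := r) fun z hz => ?_) x.1)
        simp only [restrict_of_mem hb _ χ hz]
        rfl
      map_smul' := fun c f => by
        ext x
        simp only [pointCoeff, Pi.smul_apply, smul_eq_mul, RingHom.id_apply]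
        rw [mul_left_comm c, Finset.mul_sum _ _ c]
        congr 1
        refine Finset.sum_congr rfl fun χ _ => ?_
        rw [mul_left_comm c, ← coeff_const_mul c]
        refine congrArg (χ (-x.2) * ·) (congrFun (coeff_congr (r := r) fun z hz => ?_) x.1)
        simp only [restrict_of_mem hb _ χ hz]
        rfl }
  summable f _ hR := summable_pointCoeff hb f.2 hR
  hasSum f y := hasSum_pointCoeff hb f.2 y
  coeff_mul f x y := pointCoeff_mul hb f x y

/-- The weights on `ℤ^r × F` come from generators: the unit vectors, their negatives, and all
elements of `F`. -/
theorem exists_monomialPresentation (hb : ∀ x y, b (x + y) = b x * b y) :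
    ∃ n, Nonempty (MonomialPresentation b (fun x => weight x.1) n) := by
  classical
  have := Fintype.ofFinite F
  let v : (Fin r ⊕ Fin r) ⊕ F → (Fin r → ℤ) × F := Sum.elim
    (Sum.elim (fun i => (Pi.single i 1, 0)) fun i => (-Pi.single i 1, 0)) fun t => (0, t)
  have hsingle : ∀ i : Fin r, weight (Pi.single i (1 : ℤ)) = 1 := by
    intro i
    rw [weight, Finset.sum_eq_single i] <;> simp +contextual
  refine ⟨_, _root_.exists_monomialPresentation hb (by simp [weight]) (fun x y => ?_) v ?_ ?_⟩
  · rw [weight, weight, weight, ← Finset.sum_add_distrib]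
    exact Finset.sum_le_sum fun i _ => Int.natAbs_add_le _ _
  · rintro ((i | i) | t)
    · exact (hsingle i).le
    · refine le_of_eq (Eq.trans ?_ (hsingle i))
      simp [v, weight]
    · simp [v, weight]
  · rintro ⟨n, t⟩
    refine ⟨Sum.elim (Sum.elim (fun i => (n i).toNat) fun i => (-n i).toNat) (Pi.single t 1),
      ?_, ?_⟩
    · simp only [Fintype.sum_sum_type, Sum.elim_inl, Sum.elim_inr, v]
      ext j
      · simp [Prod.fst_sum, Finset.sum_apply, Pi.single_apply]
        omega
      · simp [Prod.snd_sum, Pi.single_apply]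
    · simp only [Fintype.sum_sum_type, Sum.elim_inl, Sum.elim_inr]
      rw [← Finset.sum_add_distrib, weight]
      refine add_le_add (Finset.sum_le_sum fun i _ => ?_) ?_
      · omega
      · simp

end Laurent

/-- Holomorphic functions are faithfully flat over the group algebra of a finitely generated abelian
group. -/
theorem faithfullyFlat_of_basis {A : Type*} [CommRing A] [Algebra ℂ A] {r : ℕ} {F : Type*}
    [AddCommGroup F] [Finite F] (b : Module.Basis ((Fin r → ℤ) × F) ℂ A)
    (hb : ∀ x y, b (x + y) = b x * b y) : (toHolomorphicFunctions A).toRingHom.FaithfullyFlat := by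
  obtain ⟨n, ⟨P⟩⟩ := Laurent.exists_monomialPresentation hb
  refine (Laurent.seriesExpansion hb).faithfullyFlat hb (fun x y => ?_) P
  rw [Laurent.weight, Laurent.weight, Laurent.weight, ← Finset.sum_add_distrib]
  exact Finset.sum_le_sum fun i _ => Int.natAbs_add_le _ _

/-! ### Representations of compact abelian groups -/

namespace Representation

/-- Isomorphic representations have the same character. -/
theorem trace_eq_of_equiv {T W W' : Type*} [Group T] [AddCommGroup W] [Module ℂ W] [AddCommGroup W']
    [Module ℂ W'] {σ : Representation ℂ T W} {τ : Representation ℂ T W'} (e : σ.Equiv τ) (t : T) :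
    LinearMap.trace ℂ W (σ t) = LinearMap.trace ℂ W' (τ t) := by
  rw [← LinearMap.trace_conj' (σ t) e.toLinearEquiv]
  congr 1
  refine LinearMap.ext fun v => ?_
  have h := LinearMap.congr_fun (e.isIntertwining' t) (e.toLinearEquiv.symm v)
  exact h.trans (congrArg (τ t) (e.toLinearEquiv.apply_symm_apply v))

variable {T : Type*} [CommGroup T] [TopologicalSpace T] [CompactSpace T] {V : Type*}
  [NormedAddCommGroup V] [NormedSpace ℂ V] {ρ : Representation ℂ T V}

theorem exists_norm_apply_le (hρ : ∀ v, Continuous fun t => ρ t v) (v : V) :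
    ∃ C : ℝ, ∀ t, ‖ρ t v‖ ≤ C := by
  obtain ⟨C, hC⟩ := (isCompact_range (hρ v)).isBounded.exists_norm_le
  exact ⟨C, fun t => hC _ ⟨t, rfl⟩⟩

/-- The eigenvalues of a representation of a compact group have modulus one, as the orbits are
bounded. -/
theorem norm_eigenvalue_eq_one (hρ : ∀ v, Continuous fun t => ρ t v) {t : T} {μ : ℂ} {v : V}
    (hv : v ≠ 0) (h : ρ t v = μ • v) : ‖μ‖ = 1 := by
  have hle : ∀ {t : T} {μ : ℂ}, ρ t v = μ • v → ‖μ‖ ≤ 1 := by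
    intro t μ h
    obtain ⟨C, hC⟩ := exists_norm_apply_le hρ v
    have hpow : ∀ k : ℕ, ρ (t ^ k) v = μ ^ k • v := by
      intro k
      induction k with
      | zero => simp
      | succ k ih => rw [pow_succ, map_mul, Module.End.mul_apply, h, map_smul, ih, smul_smul,
          pow_succ, mul_comm]
    by_contra! hμ
    obtain ⟨k, hk⟩ := pow_unbounded_of_one_lt (C / ‖v‖) hμ
    have h1 := hC (t ^ k)
    rw [hpow, norm_smul, norm_pow] at h1
    rw [div_lt_iff₀ (norm_pos_iff.2 hv)] at hk
    exact absurd h1 (not_le.2 hk)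
  have hinv : μ • ρ t⁻¹ v = v := by
    rw [← map_smul, ← h, ← Module.End.mul_apply, ← map_mul, inv_mul_cancel, map_one,
      Module.End.one_apply]
  have hμ : μ ≠ 0 := by
    rintro rfl
    rw [zero_smul] at hinv
    exact hv hinv.symm
  refine le_antisymm (hle h) ?_
  have h2 : ρ t⁻¹ v = μ⁻¹ • v := by rw [← hinv, smul_smul, inv_mul_cancel₀ hμ, one_smul, hinv]
  have h3 := hle h2
  rw [norm_inv] at h3
  exact (inv_le_one₀ (norm_pos_iff.2 hμ)).1 h3

/-- Generalised eigenvectors are eigenvectors: a Jordan block has unbounded powers. -/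
theorem maxGenEigenspace_le_eigenspace (hρ : ∀ v, Continuous fun t => ρ t v) (t : T) (μ : ℂ) :
    Module.End.maxGenEigenspace (ρ t) μ ≤ Module.End.eigenspace (ρ t) μ := by
  have hsq : ∀ v, ((ρ t - μ • 1) * (ρ t - μ • 1)) v = 0 → (ρ t - μ • 1) v = 0 := by
    intro v hv
    set u := (ρ t - μ • 1) v with hu
    have hfu : ρ t u = μ • u := by
      rw [Module.End.mul_apply, ← hu] at hv
      simpa [sub_eq_zero] using hv
    have hfv : ρ t v = μ • v + u := by simp [hu]
    by_contra hne
    have hμ := norm_eigenvalue_eq_one hρ hne hfu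
    have hpow : ∀ k : ℕ, ρ (t ^ (k + 1)) v = μ ^ (k + 1) • v + ((k + 1 : ℕ) * μ ^ k) • u := by
      intro k
      induction k with
      | zero => simp [hfv]
      | succ k ih =>
        rw [pow_succ' t, map_mul, Module.End.mul_apply, ih, map_add, map_smul, map_smul, hfv, hfu]
        push_cast
        module
    obtain ⟨C, hC⟩ := exists_norm_apply_le hρ v
    obtain ⟨k, hk⟩ := exists_nat_gt ((C + ‖v‖) / ‖u‖)
    rw [div_lt_iff₀ (norm_pos_iff.2 hne)] at hk
    have h1 : ((k + 1 : ℕ) * μ ^ k) • u = ρ (t ^ (k + 1)) v - μ ^ (k + 1) • v := by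
      rw [hpow, add_sub_cancel_left]
    have h2 : (k + 1 : ℝ) * ‖u‖ ≤ C + ‖v‖ := by
      have h3 := congrArg (fun x : V => ‖x‖) h1
      rw [norm_smul, norm_mul, norm_pow, hμ, one_pow, mul_one, Complex.norm_natCast] at h3
      push_cast at h3
      rw [h3]
      refine (norm_sub_le _ _).trans (add_le_add (hC _) ?_)
      rw [norm_smul, norm_pow, hμ, one_pow, one_mul]
    have h4 := norm_nonneg u
    linarith
  intro v hv
  rw [Module.End.mem_maxGenEigenspace] at hv
  obtain ⟨k, hk⟩ := hv
  have key : ∀ k : ℕ, ((ρ t - μ • 1) ^ (k + 1)) v = 0 → (ρ t - μ • 1) v = 0 := by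
    intro k
    induction k with
    | zero => simp
    | succ k ih =>
      intro h
      refine ih ?_
      rw [pow_succ', Module.End.mul_apply]
      refine hsq _ ?_
      rw [← Module.End.mul_apply, mul_assoc, ← pow_succ', ← pow_succ']
      exact h
  rw [Module.End.mem_eigenspace_iff]
  have h := key k (by rw [pow_succ', Module.End.mul_apply, hk, map_zero])
  simpa [sub_eq_zero] using h

variable [FiniteDimensional ℂ V]

/-- A finite-dimensional continuous representation of a compact abelian group is diagonalisable. -/
theorem exists_basis_eigenvectors (hρ : ∀ v, Continuous fun t => ρ t v) {n : ℕ}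
    (hn : Module.finrank ℂ V = n) : ∃ (B : Module.Basis (Fin n) ℂ V) (χ : Fin n → PontryaginDual T),
      ∀ t i, ρ t (B i) = (χ i t : ℂ) • B i := by
  let S : Set V := {v | ∃ μ : T → ℂ, ∀ t, ρ t v = μ t • v}
  have hS : ⊤ ≤ Submodule.span ℂ S := by
    rw [← Module.End.iSup_iInf_maxGenEigenspace_eq_top_of_iSup_maxGenEigenspace_eq_top_of_commute
      (fun t => ρ t) (fun s t _ => by
        change ρ s * ρ t = ρ t * ρ s
        rw [← map_mul, mul_comm, map_mul])
      fun t => Module.End.iSup_maxGenEigenspace_eq_top _]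
    refine iSup_le fun μ v hv => Submodule.subset_span ⟨μ, fun t => ?_⟩
    exact Module.End.mem_eigenspace_iff.1
      (maxGenEigenspace_le_eigenspace hρ t _ ((Submodule.mem_iInf _).1 hv t))
  let B₀ := Module.Basis.ofSpan hS
  have hfin : Finite ↑((linearIndepOn_empty ℂ id).extend (Set.empty_subset S)) :=
    Module.Finite.finite_basis B₀
  let e := Finite.equivFinOfCardEq ((Module.finrank_eq_nat_card_basis B₀).symm.trans hn)
  let B := B₀.reindex e
  have hB : ∀ i, B i ∈ S := fun i => by
    refine Module.Basis.ofSpan_subset hS ⟨e.symm i, ?_⟩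
    simp [B, B₀]
  choose μ hμ using hB
  have hnorm : ∀ i t, ‖μ i t‖ = 1 := fun i t => norm_eigenvalue_eq_one hρ (B.ne_zero i) (hμ i t)
  have hcoord : ∀ i t, μ i t = B.coord i (ρ t (B i)) := fun i t => by
    rw [hμ, map_smul, B.coord_apply, B.repr_self, Finsupp.single_eq_same, smul_eq_mul, mul_one]
  have hcont : ∀ i, Continuous (μ i) := fun i => by
    rw [funext (hcoord i)]
    exact (LinearMap.continuous_of_finiteDimensional (B.coord i)).comp (hρ _)
  have hinj : ∀ i (c c' : ℂ), c • B i = c' • B i → c = c' := fun i c c' h =>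
    smul_left_injective ℂ (B.ne_zero i) h
  let χ : Fin n → (T →ₜ* Circle) := fun i =>
    { toFun := fun t => ⟨μ i t, mem_sphere_zero_iff_norm.2 (hnorm i t)⟩
      map_one' := Subtype.ext (hinj i _ _ (by rw [← hμ]; simp))
      map_mul' := fun s t => Subtype.ext (hinj i _ _ (by
        rw [← hμ, map_mul, Module.End.mul_apply, hμ, map_smul, hμ, smul_smul, mul_comm]
        rfl))
      continuous_toFun := (hcont i).subtype_mk _ }
  exact ⟨B, χ, fun t i => hμ i t⟩

end Representation

namespace RepresentationRing

variable {T : Type*} [CommGroup T] [TopologicalSpace T]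

/-- The class of a representation. -/
def cls (V : ComplexRep T) : RepresentationRing T := Ideal.Quotient.mk _ (MvPolynomial.X V)

theorem cls_eq_add {V W₁ W₂ : ComplexRep T} (h : V.IsDirectSum W₁ W₂) :
    cls V = cls W₁ + cls W₂ := by
  rw [cls, cls, cls, ← map_add, Ideal.Quotient.eq]
  exact Ideal.subset_span (Or.inl (Or.inl ⟨V, W₁, W₂, h, rfl⟩))

theorem cls_eq_mul {V W₁ W₂ : ComplexRep T} (h : V.IsTensorProduct W₁ W₂) :
    cls V = cls W₁ * cls W₂ := by
  rw [cls, cls, cls, ← map_mul, Ideal.Quotient.eq]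
  exact Ideal.subset_span (Or.inl (Or.inr ⟨V, W₁, W₂, h, rfl⟩))

theorem cls_eq_one {V : ComplexRep T} (h : V.IsTrivialLine) : cls V = 1 := by
  rw [cls, ← map_one (Ideal.Quotient.mk _), Ideal.Quotient.eq]
  exact Ideal.subset_span (Or.inr ⟨V, h, rfl⟩)

/-- The diagonal representation given by finitely many characters. -/
def diag {n : ℕ} (χ : Fin n → PontryaginDual T) : ComplexRep T where
  dim := n
  ρ :=
    { toFun := fun t => LinearMap.pi fun i => (χ i t : ℂ) • LinearMap.proj i
      map_one' := by ext; simp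
      map_mul' := fun s t => by
        ext v i
        simp [mul_assoc] }
  continuous_action v := continuous_pi fun i =>
    (continuous_subtype_val.comp (map_continuous (χ i))).mul continuous_const

/-- The one-dimensional representation given by a character. -/
def line (χ : PontryaginDual T) : ComplexRep T := diag fun _ : Fin 1 => χ

theorem cls_diag_zero (χ : Fin 0 → PontryaginDual T) : cls (diag χ) = 0 := by
  have h : (diag χ).IsDirectSum (diag χ) (diag χ) :=
    ⟨.mk (LinearEquiv.ofSubsingleton (Fin 0 → ℂ) ((Fin 0 → ℂ) × (Fin 0 → ℂ)))
      fun t => Subsingleton.elim (α := (Fin 0 → ℂ) →ₗ[ℂ] ((Fin 0 → ℂ) × (Fin 0 → ℂ))) _ _⟩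
  simpa using cls_eq_add h

theorem cls_eq_of_equiv {V W : ComplexRep T} (e : V.ρ.Equiv W.ρ) : cls V = cls W := by
  let Z : ComplexRep T := diag Fin.elim0
  have h : V.IsDirectSum W Z := by
    refine ⟨.mk (e.toLinearEquiv.trans
      (LinearEquiv.prodUnique (R := ℂ) (M := Fin W.dim → ℂ) (M₂ := Fin 0 → ℂ)).symm) fun t => ?_⟩
    refine LinearMap.ext fun v => Prod.ext ?_ (Subsingleton.elim (α := Fin 0 → ℂ) _ _)
    exact LinearMap.congr_fun (e.isIntertwining' t) v
  rw [cls_eq_add h, cls_diag_zero, add_zero]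

theorem cls_diag {n : ℕ} (χ : Fin n → PontryaginDual T) : cls (diag χ) = ∑ i, cls (line (χ i)) := by
  induction n with
  | zero => rw [cls_diag_zero, Finset.univ_eq_empty, Finset.sum_empty]
  | succ n ih =>
    rw [Fin.sum_univ_succ, ← ih fun i => χ i.succ]
    refine cls_eq_add ⟨.mk
      { toFun := fun v => (fun _ => v (0 : Fin (n + 1)), fun i => v (Fin.succ i))
        map_add' := fun _ _ => rfl
        map_smul' := fun _ _ => rfl
        invFun := fun v => Fin.cons (v.1 (0 : Fin 1)) v.2
        left_inv := fun v => funext fun i => Fin.cases rfl (fun _ => rfl) i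
        right_inv := fun v => Prod.ext
          (funext fun i => congrArg v.1 (Subsingleton.elim (0 : Fin 1) i)) rfl }
      fun t => rfl⟩

theorem cls_line_one : cls (line (1 : PontryaginDual T)) = 1 := by
  refine cls_eq_one ⟨.mk (LinearEquiv.funUnique (Fin 1) ℂ ℂ) fun t => LinearMap.ext fun v => ?_⟩
  change ((1 : PontryaginDual T) t : ℂ) * v (0 : Fin 1) = v (0 : Fin 1)
  simp

theorem cls_line_mul (χ ψ : PontryaginDual T) :
    cls (line (χ * ψ)) = cls (line χ) * cls (line ψ) := by
  let u := LinearEquiv.funUnique (Fin 1) ℂ ℂ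
  let e : ((Fin 1 → ℂ) ⊗[ℂ] (Fin 1 → ℂ)) ≃ₗ[ℂ] (Fin 1 → ℂ) :=
    (TensorProduct.congr u u).trans ((TensorProduct.lid ℂ ℂ).trans u.symm)
  have he : ∀ t, e.toLinearMap ∘ₗ ((line χ).ρ.tprod (line ψ).ρ) t =
      (line (χ * ψ)).ρ t ∘ₗ e.toLinearMap := by
    intro t
    refine TensorProduct.ext' fun v w => funext fun i => ?_
    change ((χ t : ℂ) * v (0 : Fin 1)) * ((ψ t : ℂ) * w (0 : Fin 1)) =
      ((χ t * ψ t : Circle) : ℂ) * (v (0 : Fin 1) * w (0 : Fin 1))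
    rw [Circle.coe_mul]
    ring
  exact cls_eq_mul ⟨(Representation.Equiv.mk (ρ := (line χ).ρ.tprod (line ψ).ρ) e he).symm⟩

theorem cls_mem_span [CompactSpace T] (V : ComplexRep T) :
    cls V ∈ Submodule.span ℤ (Set.range fun χ : PontryaginDual T => cls (line χ)) := by
  obtain ⟨B, χ, h⟩ := Representation.exists_basis_eigenvectors V.continuous_action
    (Module.finrank_fin_fun ℂ)
  have e : V.ρ.Equiv (diag χ).ρ := .mk B.equivFun fun t => B.ext fun i => by
    refine funext fun j => ?_
    change B.equivFun (V.ρ t (B i)) j = (χ j t : ℂ) * B.equivFun (B i) j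
    rw [h, map_smul]
    have hc : ∀ i j, (χ i t : ℂ) * B.equivFun (B i) j = (χ j t : ℂ) * B.equivFun (B i) j := by
      intro i j
      rw [B.equivFun_self]
      by_cases hij : i = j
      · rw [hij]
      · rw [if_neg hij, mul_zero, mul_zero]
    exact hc i j
  rw [cls_eq_of_equiv e, cls_diag]
  exact Submodule.sum_mem _ fun i _ => Submodule.subset_span ⟨χ i, rfl⟩

theorem span_cls_line_eq_top [CompactSpace T] :
    Submodule.span ℤ (Set.range fun χ : PontryaginDual T => cls (line χ)) = ⊤ := by
  set S := Submodule.span ℤ (Set.range fun χ : PontryaginDual T => cls (line χ)) with hS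
  have hmul : S * S ≤ S := by
    rw [hS, Submodule.span_mul_span]
    refine Submodule.span_mono ?_
    rintro _ ⟨_, ⟨χ, rfl⟩, _, ⟨ψ, rfl⟩, rfl⟩
    exact ⟨χ * ψ, cls_line_mul χ ψ⟩
  rw [eq_top_iff]
  rintro x -
  obtain ⟨p, rfl⟩ := Ideal.Quotient.mk_surjective x
  induction p using MvPolynomial.induction_on with
  | C a =>
    have h1 : (1 : RepresentationRing T) ∈ S := Submodule.subset_span ⟨1, cls_line_one⟩
    have h2 := S.smul_mem a h1
    have h3 : Ideal.Quotient.mk (Ideal.span (repRelations T)) (MvPolynomial.C a) =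
        a • (1 : RepresentationRing T) := by
      rw [zsmul_one]
      exact eq_intCast ((Ideal.Quotient.mk (Ideal.span (repRelations T))).comp
        MvPolynomial.C) a
    rwa [← h3] at h2
  | add p q hp hq => rw [map_add]; exact S.add_mem hp hq
  | mul_X p V hp =>
    rw [map_mul]
    exact hmul (Submodule.mul_mem_mul hp (cls_mem_span V))

/-- The character of a virtual representation. -/
def trace : RepresentationRing T →+* (T → ℂ) :=
  Ideal.Quotient.lift _ (MvPolynomial.eval₂Hom (Int.castRingHom (T → ℂ))
    fun V t => LinearMap.trace ℂ _ (V.ρ t)) (by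
      intro p hp
      rw [← RingHom.mem_ker]
      refine (Ideal.span_le (I := RingHom.ker _)).2 ?_ hp
      rintro _ ((⟨V, W₁, W₂, ⟨e⟩, rfl⟩ | ⟨V, W₁, W₂, ⟨e⟩, rfl⟩) | ⟨V, ⟨e⟩, rfl⟩) <;>
      · rw [SetLike.mem_coe, RingHom.mem_ker]
        simp only [map_sub, map_add, map_mul, map_one, MvPolynomial.coe_eval₂Hom,
          MvPolynomial.eval₂_X, sub_eq_zero]
        funext t
        rw [Representation.trace_eq_of_equiv e]
        first
        | exact LinearMap.trace_prodMap' _ _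
        | exact LinearMap.trace_tensorProduct' _ _
        | exact (LinearMap.trace_one ℂ ℂ).trans (by simp))

theorem trace_cls_line (χ : PontryaginDual T) (t : T) : trace (cls (line χ)) t = χ t := by
  have h0 : trace (cls (line χ)) = fun t => LinearMap.trace ℂ _ ((line χ).ρ t) := by
    rw [trace, cls, Ideal.Quotient.lift_mk, MvPolynomial.eval₂Hom_X']
  rw [h0]
  change LinearMap.trace ℂ (Fin 1 → ℂ) ((χ t : ℂ) • (1 : (Fin 1 → ℂ) →ₗ[ℂ] (Fin 1 → ℂ))) = _
  rw [map_smul, LinearMap.trace_one]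
  simp

/-- The classes of the characters span the representation ring with complex coefficients. -/
theorem span_tmul_cls_line_eq_top [CompactSpace T] :
    ⊤ ≤ Submodule.span ℂ (Set.range fun χ : PontryaginDual T => (1 : ℂ) ⊗ₜ[ℤ] cls (line χ)) := by
  set S := Submodule.span ℂ (Set.range fun χ : PontryaginDual T => (1 : ℂ) ⊗ₜ[ℤ] cls (line χ))
  rintro x -
  induction x using TensorProduct.induction_on with
  | zero => exact S.zero_mem
  | add x y hx hy => exact S.add_mem hx hy
  | tmul c a =>
    have ha : (1 : ℂ) ⊗ₜ[ℤ] a ∈ S := by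
      have h : a ∈ Submodule.span ℤ (Set.range fun χ : PontryaginDual T => cls (line χ)) := by
        rw [span_cls_line_eq_top]; trivial
      induction h using Submodule.span_induction with
      | mem a ha =>
        obtain ⟨χ, rfl⟩ := ha
        exact Submodule.subset_span ⟨χ, rfl⟩
      | zero => rw [TensorProduct.tmul_zero]; exact S.zero_mem
      | add a b _ _ ha hb => rw [TensorProduct.tmul_add]; exact S.add_mem ha hb
      | smul n a _ ha =>
        rw [TensorProduct.tmul_smul]
        exact zsmul_mem ha n
    have h := S.smul_mem c ha
    rwa [TensorProduct.smul_tmul', smul_eq_mul, mul_one] at h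

/-- Distinct characters are linearly independent in the representation ring, as they are linearly
independent as functions. -/
theorem linearIndependent_tmul_cls_line :
    LinearIndependent ℂ fun χ : PontryaginDual T => (1 : ℂ) ⊗ₜ[ℤ] cls (line χ) := by
  let L : KT T →ₐ[ℂ] (T → ℂ) := Algebra.TensorProduct.lift (Algebra.ofId ℂ (T → ℂ))
    (trace (T := T)).toIntAlgHom fun _ _ => Commute.all _ _
  let toHom : PontryaginDual T → (T →* ℂ) := fun χ =>
    { toFun := fun t => χ t
      map_one' := by simp
      map_mul' := fun s t => by rw [map_mul, Circle.coe_mul] }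
  have hinj : Function.Injective toHom := fun χ ψ h =>
    PontryaginDual.ext fun t => Circle.ext (DFunLike.congr_fun h t)
  have h := (linearIndependent_monoidHom T ℂ).comp toHom hinj
  refine LinearIndependent.of_comp L.toLinearMap ?_
  have hL : (L.toLinearMap ∘ fun χ : PontryaginDual T => (1 : ℂ) ⊗ₜ[ℤ] cls (line χ)) =
      ((fun f : T →* ℂ => (f : T → ℂ)) ∘ toHom) := by
    funext χ
    have hχ : L ((1 : ℂ) ⊗ₜ[ℤ] cls (line χ)) = trace (cls (line χ)) := by
      refine (Algebra.TensorProduct.lift_tmul _ _ _ _ _).trans ?_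
      rw [map_one, one_mul]
      rfl
    exact hχ.trans (funext fun t => trace_cls_line χ t)
  rw [hL]
  exact h

/-- The basis of the complexified representation ring given by the characters. -/
def basis (T : Type*) [CommGroup T] [TopologicalSpace T] [CompactSpace T] :
    Module.Basis (PontryaginDual T) ℂ (KT T) :=
  .mk linearIndependent_tmul_cls_line span_tmul_cls_line_eq_top

theorem basis_mul [CompactSpace T] (χ ψ : PontryaginDual T) :
    basis T (χ * ψ) = basis T χ * basis T ψ := by
  rw [basis, Module.Basis.mk_apply, Module.Basis.mk_apply, Module.Basis.mk_apply,
    Algebra.TensorProduct.tmul_mul_tmul, one_mul, cls_line_mul]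

end RepresentationRing

/-! ### The character group of a compact abelian Lie group -/

open scoped BoundedContinuousFunction Topology

section LocalHomomorphisms

variable {T : Type*} [CommGroup T] [TopologicalSpace T] {K : Type*} [TopologicalSpace K]

/-- The real-valued local homomorphisms on a parametrised part of a group. -/
def localHoms (ι : C(K, T)) : Submodule ℝ (K →ᵇ ℝ) where
  carrier := {f | ∀ x y z, ι x * ι y = ι z → f z = f x + f y}
  add_mem' hf hg x y z h := by
    simp only [BoundedContinuousFunction.add_apply]
    rw [hf x y z h, hg x y z h]
    ring
  zero_mem' x y z _ := by simp
  smul_mem' c f hf x y z h := by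
    simp only [BoundedContinuousFunction.smul_apply, smul_eq_mul]
    rw [hf x y z h]
    ring

/-- The elements all of whose first powers lie in the given set. -/
def powersIn (W : Set T) (n : ℕ) : Set T := {v | ∀ j ≤ n, v ^ j ∈ W}

theorem powersIn_mem_nhds [IsTopologicalGroup T] {W : Set T} (hW : W ∈ 𝓝 1) (n : ℕ) :
    powersIn W n ∈ 𝓝 1 := by
  have h : ∀ j ∈ Set.Iic n, (fun v : T => v ^ j) ⁻¹' W ∈ 𝓝 1 := fun j _ =>
    (continuous_pow j).continuousAt.preimage_mem_nhds (by simpa using hW)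
  have h2 := (Filter.biInter_mem (Set.finite_Iic n)).2 h
  convert h2 using 1
  ext v
  simp [powersIn]

/-- A local homomorphism is small where many powers are defined. -/
theorem abs_apply_le_of_mem_powersIn {ι : C(K, T)} {f : K →ᵇ ℝ} (hf : f ∈ localHoms ι) {n : ℕ}
    {k : K} (hk : ι k ∈ powersIn (Set.range ι) n) : n * |f k| ≤ ‖f‖ := by
  have key : ∀ j ≤ n, ∀ x, ι x = ι k ^ j → f x = j * f k := by
    intro j
    induction j with
    | zero =>
      intro _ x hx
      rw [pow_zero] at hx
      have := hf x x x (by rw [hx, one_mul])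
      rw [Nat.cast_zero, zero_mul]
      linarith
    | succ j ih =>
      intro hj x hx
      obtain ⟨y, hy⟩ := hk j (by omega)
      rw [hf y k x (by rw [hy, hx, pow_succ]), ih (by omega) y hy]
      push_cast
      ring
  obtain ⟨x, hx⟩ := hk n le_rfl
  calc n * |f k| = ‖f x‖ := by rw [key n le_rfl x hx, Real.norm_eq_abs, abs_mul, Nat.abs_cast]
    _ ≤ ‖f‖ := f.norm_coe_le_norm x

theorem finiteDimensional_localHoms [IsTopologicalGroup T] [CompactSpace K] {ι : C(K, T)}
    (hι : Set.range ι ∈ 𝓝 1) : FiniteDimensional ℝ (localHoms ι) := by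
  refine FiniteDimensional.of_isCompact_closedBall₀ (V := localHoms ι) ℝ one_pos ?_
  rw [Subtype.isCompact_iff]
  let A : Set (K →ᵇ ℝ) := {f | f ∈ localHoms ι ∧ ‖f‖ ≤ 1}
  have hA : Subtype.val '' Metric.closedBall (0 : localHoms ι) 1 = A := by
    ext f
    simp [A, and_comm]
  rw [hA]
  refine BoundedContinuousFunction.arzela_ascoli₂ (Metric.closedBall 0 1)
    (isCompact_closedBall 0 1) A ?_ ?_ ?_
  · refine IsClosed.inter ?_ (isClosed_le continuous_norm continuous_const)
    have h : {f : K →ᵇ ℝ | f ∈ localHoms ι} =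
        ⋂ (x) (y) (z) (_ : ι x * ι y = ι z), {f | f z = f x + f y} := by
      ext f
      simp only [Set.mem_iInter]
      rfl
    change IsClosed {f : K →ᵇ ℝ | f ∈ localHoms ι}
    rw [h]
    refine isClosed_iInter fun x => isClosed_iInter fun y => isClosed_iInter fun z =>
      isClosed_iInter fun _ => isClosed_eq ?_ ?_
    · exact continuous_eval_const _
    · exact (continuous_eval_const _).add (continuous_eval_const _)
  · intro f x hf
    rw [mem_closedBall_zero_iff]
    exact (f.norm_coe_le_norm x).trans hf.2
  · intro x₀
    rw [Metric.equicontinuousAt_iff_right]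
    intro ε hε
    obtain ⟨n, hn⟩ := exists_nat_gt (1 / ε)
    have hn0 : (0 : ℝ) < n := lt_trans (by positivity) hn
    have hnhds : ∀ᶠ x in 𝓝 x₀, ι x / ι x₀ ∈ powersIn (Set.range ι) (n + 1) := by
      have hc : ContinuousAt (fun x => ι x / ι x₀) x₀ := by fun_prop
      refine hc.eventually_mem ?_
      rw [div_self']
      exact powersIn_mem_nhds hι (n + 1)
    filter_upwards [hnhds] with x hx
    rintro ⟨f, hf⟩
    obtain ⟨k, hk⟩ := hx 1 (by omega)
    rw [pow_one] at hk
    have h1 := abs_apply_le_of_mem_powersIn (n := n) hf.1 (k := k)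
      (fun j hj => by rw [hk]; exact hx j (by omega))
    have h2 := hf.1 k x₀ x (by rw [hk]; exact div_mul_cancel _ _)
    have h3 : |f k| < ε := by
      have h4 := h1.trans hf.2
      rw [div_lt_iff₀ hε] at hn
      by_contra! h5
      nlinarith
    rw [dist_comm, Real.dist_eq]
    change |f x - f x₀| < ε
    rwa [h2, add_sub_cancel_right]

end LocalHomomorphisms

theorem Circle.dist_eq_norm (z w : Circle) : dist z w = ‖(z : ℂ) - w‖ := by
  rw [← _root_.dist_eq_norm]
  rfl

theorem Circle.eq_one_of_forall_dist_pow_lt_one {z : Circle} (h : ∀ n : ℕ, dist (z ^ n) 1 < 1) :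
    z = 1 := by
  refine Circle.eq_one_of_forall_pow_mem_centeredArc_pi_div_two fun n _ => ?_
  rw [Circle.mem_centeredArc (by linarith [Real.pi_pos]), Complex.abs_arg_lt_pi_div_two_iff]
  left
  have h1 : ‖((z ^ n : Circle) : ℂ) - 1‖ < 1 := by
    have := h n
    rwa [Circle.dist_eq_norm] at this
  have h2 := (Complex.abs_re_le_norm _).trans_lt h1
  rw [Complex.sub_re, Complex.one_re, abs_lt] at h2
  linarith

/-- Only finitely many characters of a compact group are close to `1` on a neighbourhood of the
identity: the values at finitely many points determine them approximately, hence exactly. -/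
theorem PontryaginDual.finite_setOf_dist_le {T : Type*} [CommGroup T] [TopologicalSpace T]
    [IsTopologicalGroup T] [CompactSpace T] {V : Set T} (hV : V ∈ 𝓝 1) :
    {χ : PontryaginDual T | ∀ v ∈ V, dist (χ v) 1 ≤ 1 / 4}.Finite := by
  have hmul : ∀ a b c : Circle, dist (a * b) (a * c) = dist b c := fun a b c => by
    rw [Circle.dist_eq_norm, Circle.dist_eq_norm, Circle.coe_mul, Circle.coe_mul,
      ← mul_sub, norm_mul, Circle.norm_coe, one_mul]
  obtain ⟨t, ht⟩ := compact_covered_by_mul_left_translates (isCompact_univ (X := T))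
    ⟨1, mem_interior_iff_mem_nhds.2 hV⟩
  obtain ⟨c, -, hc, hcov⟩ := (isCompact_univ (X := t → Circle)).finite_cover_balls
    (e := 1 / 8) (by norm_num)
  let ev : PontryaginDual T → t → Circle := fun χ g => χ g
  have hctr : ∀ χ, ∃ p ∈ c, dist (ev χ) p < 1 / 8 := fun χ => by
    simpa using hcov (Set.mem_univ (ev χ))
  choose p hp hdist using hctr
  refine Set.Finite.of_finite_image (f := p) (hc.subset (by rintro _ ⟨χ, -, rfl⟩; exact hp χ)) ?_
  intro χ hχ ψ hψ hpe
  have hclose : ∀ g : t, dist (χ g) (ψ g) < 1 / 4 := by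
    intro g
    have h1 := hdist χ
    have h2 := hdist ψ
    rw [← hpe] at h2
    have h3 := (dist_le_pi_dist (ev χ) (ev ψ) g).trans (dist_triangle_right _ _ (p χ))
    change dist (χ g) (ψ g) ≤ _ at h3
    linarith
  have hall : ∀ x, dist (χ x) (ψ x) < 1 := by
    intro x
    obtain ⟨g, hg⟩ := Set.mem_iUnion.1 (ht (Set.mem_univ x))
    obtain ⟨hgt, hgx⟩ := Set.mem_iUnion.1 hg
    have hgx : g * x ∈ V := hgx
    have e1 : dist (χ x) (ψ x) = dist (χ (g * x)) (χ g * ψ x) := by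
      rw [_root_.map_mul, hmul]
    have e2 : dist (χ g * ψ x) (ψ (g * x)) = dist (χ g) (ψ g) := by
      rw [_root_.map_mul, mul_comm (χ g), mul_comm (ψ g), hmul]
    have h1 := hclose ⟨g, hgt⟩
    have h2 := hχ _ hgx
    have h3 := hψ _ hgx
    have h4 := dist_triangle_right (χ (g * x)) (ψ (g * x)) 1
    have h5 := dist_triangle_right (χ (g * x)) (χ g * ψ x) (ψ (g * x))
    change dist (χ g) (ψ g) < 1 / 4 at h1
    linarith
  refine PontryaginDual.ext fun x => ?_
  have h : (ψ x)⁻¹ * χ x = 1 := by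
    refine Circle.eq_one_of_forall_dist_pow_lt_one fun n => ?_
    have h1 := hall (x ^ n)
    rw [map_pow χ, map_pow ψ, ← hmul (ψ x ^ n)⁻¹, inv_mul_cancel] at h1
    rwa [mul_pow, inv_pow]
  exact (inv_mul_eq_one.1 h).symm

/-- A group with a homomorphism to a finite-dimensional normed space is finitely generated if only
finitely many elements have an image in the unit ball: the image is discrete and the kernel
finite. -/
theorem AddMonoidHom.finite_int_of_finite_norm_le {G E : Type*} [AddCommGroup G]
    [NormedAddCommGroup E] [NormedSpace ℝ E] [FiniteDimensional ℝ E] (Ψ : G →+ E)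
    (hfin : {x | ‖Ψ x‖ ≤ 1}.Finite) : Module.Finite ℤ G := by
  let Φ : G →ₗ[ℤ] E := Ψ.toIntLinearMap
  let L : Submodule ℤ E := LinearMap.range Φ
  have hLfin : (Metric.ball (0 : L) 1).Finite := by
    refine Set.Finite.of_finite_image (f := Subtype.val) ((hfin.image Φ).subset ?_)
      Subtype.val_injective.injOn
    rintro _ ⟨⟨_, x, rfl⟩, h, rfl⟩
    exact ⟨x, (mem_ball_zero_iff.1 h).le, rfl⟩
  have hdisc : DiscreteTopology L := by
    refine discreteTopology_of_isOpen_singleton_zero ?_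
    have h : ({0} : Set L) = Metric.ball 0 1 \ (Metric.ball 0 1 \ {0}) := by
      ext x
      simp +contextual
    rw [h]
    exact Metric.isOpen_ball.sdiff (hLfin.subset Set.sdiff_subset).isClosed
  refine ⟨Submodule.fg_of_fg_map_of_fg_inf_ker Φ ?_ ?_⟩
  · rw [← LinearMap.range_eq_map]
    exact Module.Finite.iff_fg.1 (instModuleFinite_of_discrete_submodule L)
  · rw [top_inf_eq]
    refine ⟨Set.Finite.toFinset (s := (LinearMap.ker Φ : Set G)) (hfin.subset fun x hx => ?_),
      by simp⟩
    have h : Ψ x = 0 := hx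
    simp [h]

/-- If the logarithms of the characters are local homomorphisms, then the character group is
finitely generated: its image in the finite-dimensional space of local homomorphisms is discrete,
and the kernel is finite. -/
theorem PontryaginDual.finite_of_localHoms {T : Type*} [CommGroup T] [TopologicalSpace T]
    [IsTopologicalGroup T] [CompactSpace T] {K : Type*} [TopologicalSpace K] [CompactSpace K]
    {ι : C(K, T)} (hι : Set.range ι ∈ 𝓝 1) (Ψ : Additive (PontryaginDual T) →+ localHoms ι)
    (hΨ : ∀ χ k, Circle.exp ((Ψ χ).1 k) = χ.toMul (ι k)) :
    Module.Finite ℤ (Additive (PontryaginDual T)) := by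
  have hfin : {χ | ‖Ψ χ‖ ≤ 1}.Finite := by
    -- where four powers are defined, the logarithms in the unit ball are at most `1 / 4`
    refine Set.Finite.subset (s := {χ : Additive (PontryaginDual T) | ∀ v ∈
      powersIn (Set.range ι) 4, dist (χ.toMul v) 1 ≤ 1 / 4})
      (PontryaginDual.finite_setOf_dist_le (powersIn_mem_nhds hι 4)) ?_
    intro χ hχ v hv
    obtain ⟨k, hk⟩ := hv 1 (by norm_num)
    rw [pow_one] at hk
    subst hk
    have h1 := abs_apply_le_of_mem_powersIn (Ψ χ).2 hv
    have h2 : ‖(Ψ χ).1‖ ≤ 1 := hχ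
    rw [← hΨ, Circle.dist_eq_norm, Circle.coe_exp, Circle.coe_one, mul_comm]
    refine Real.norm_exp_I_mul_ofReal_sub_one_le.trans ?_
    rw [Real.norm_eq_abs]
    push_cast at h1
    linarith
  have := finiteDimensional_localHoms hι
  exact AddMonoidHom.finite_int_of_finite_norm_le (E := localHoms ι) Ψ hfin

/-- The logarithms of the characters of a topological group that is locally Euclidean: the lifts
through the covering `ℝ → Circle`, on a coordinate ball, are local homomorphisms. -/
theorem PontryaginDual.exists_localHoms {T : Type*} [CommGroup T] [TopologicalSpace T]
    [IsTopologicalGroup T] {E : Type*} [NormedAddCommGroup E] [NormedSpace ℝ E]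
    [FiniteDimensional ℝ E] [ChartedSpace E T] :
    ∃ (K : Set E) (_ : CompactSpace K) (ι : C(K, T)) (_ : Set.range ι ∈ 𝓝 1)
      (Ψ : Additive (PontryaginDual T) →+ localHoms ι),
      ∀ χ k, Circle.exp ((Ψ χ).1 k) = χ.toMul (ι k) := by
  let φ := chartAt E (1 : T)
  have h1 : (1 : T) ∈ φ.source := mem_chart_source E 1
  set p : E := φ 1 with hp
  have hp1 : φ.symm p = 1 := φ.left_inv h1
  obtain ⟨R, hR, hRt⟩ := Metric.isOpen_iff.1 φ.open_target p (φ.map_source h1)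
  -- the coordinate ball on which the characters are lifted
  let B : Set E := Metric.ball p R
  have hBcontr : ContractibleSpace B := Metric.contractibleSpace_ball hR
  have hBloc : LocallyPathConnectedSpace B := Metric.isOpen_ball.locallyPathConnectedSpace
  let q : C(B, T) := ⟨fun x => φ.symm x, continuous_iff_continuousAt.2 fun x =>
    (φ.continuousAt_symm (hRt x.2)).comp continuous_subtype_val.continuousAt⟩
  let b₀ : B := ⟨p, Metric.mem_ball_self hR⟩
  have hlift : ∀ χ : PontryaginDual T,
      ∃ F : C(B, ℝ), F b₀ = 0 ∧ ∀ b, Circle.exp (F b) = χ (q b) := by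
    intro χ
    obtain ⟨F, ⟨hF0, hF⟩, -⟩ := Circle.isCoveringMap_exp.existsUnique_continuousMap_lifts
      (⟨fun b => χ (q b), (map_continuous χ).comp q.continuous⟩ : C(B, Circle)) b₀ 0
      (by change Circle.exp 0 = χ (φ.symm p); rw [hp1, Circle.exp_zero, _root_.map_one])
    exact ⟨F, hF0, fun b => congrFun hF b⟩
  choose ψ hψ0 hψ using hlift
  have hψadd : ∀ χ χ' b, ψ (χ * χ') b = ψ χ b + ψ χ' b := by
    intro χ χ' b
    refine congrFun (Circle.isCoveringMap_exp.eq_of_comp_eq (g₁ := ψ (χ * χ'))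
      (g₂ := fun b => ψ χ b + ψ χ' b) (map_continuous _)
      ((map_continuous _).add (map_continuous _)) ?_ b₀ ?_) b
    · ext b
      change (Circle.exp _ : ℂ) = Circle.exp _
      rw [Circle.exp_add, hψ, hψ, hψ]
      rfl
    · rw [hψ0, hψ0, hψ0, add_zero]
  -- a smaller ball whose products stay in the coordinate ball
  have hU : φ.source ∩ φ ⁻¹' B ∈ 𝓝 (1 : T) :=
    (φ.isOpen_inter_preimage Metric.isOpen_ball).mem_nhds ⟨h1, Metric.mem_ball_self hR⟩
  have hmul : ∀ᶠ x : E × E in 𝓝 (p, p), φ.symm x.1 * φ.symm x.2 ∈ φ.source ∩ φ ⁻¹' B := by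
    have hc : ContinuousAt φ.symm p := φ.continuousAt_symm (φ.map_source h1)
    have hc2 : ContinuousAt (fun x : E × E => φ.symm x.1 * φ.symm x.2) (p, p) :=
      (hc.comp (x := (p, p)) continuousAt_fst).mul (hc.comp (x := (p, p)) continuousAt_snd)
    refine hc2.eventually_mem ?_
    rw [hp1, one_mul]
    exact hU
  rw [nhds_prod_eq] at hmul
  obtain ⟨s, hs, hsB, hsmul⟩ : ∃ s > 0, Metric.closedBall p s ⊆ B ∧
      ∀ x ∈ Metric.closedBall p s, ∀ y ∈ Metric.closedBall p s,
        φ.symm x * φ.symm y ∈ φ.source ∩ φ ⁻¹' B := by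
    obtain ⟨W, hW, hWmul⟩ := Filter.mem_prod_self_iff.1 hmul
    obtain ⟨s, hs, hsW⟩ := Metric.nhds_basis_closedBall.mem_iff.1
      (Filter.inter_mem hW (Metric.ball_mem_nhds p hR))
    exact ⟨s, hs, fun x hx => (hsW hx).2, fun x hx y hy =>
      hWmul (Set.mk_mem_prod (hsW hx).1 (hsW hy).1)⟩
  let K : Set E := Metric.closedBall p s
  have hKc : CompactSpace K := isCompact_iff_compactSpace.1 (isCompact_closedBall p s)
  have hKconn : PreconnectedSpace K := isPreconnected_iff_preconnectedSpace.1
    (convex_closedBall p s).isPreconnected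
  let incl : C(K, B) := ⟨Set.inclusion hsB, continuous_inclusion hsB⟩
  let ι : C(K, T) := q.comp incl
  let m : C(K × K, B) := ⟨fun x => ⟨φ (ι x.1 * ι x.2), (hsmul _ x.1.2 _ x.2.2).2⟩, by
    refine Continuous.subtype_mk (φ.continuousOn.comp_continuous
      (f := fun x : K × K => ι x.1 * ι x.2)
      ((ι.continuous.comp continuous_fst).mul (ι.continuous.comp continuous_snd))
      fun x => (hsmul _ x.1.2 _ x.2.2).1) _⟩
  have hqm : ∀ x, q (m x) = ι x.1 * ι x.2 := fun x => φ.left_inv (hsmul _ x.1.2 _ x.2.2).1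
  let k₀ : K := ⟨p, Metric.mem_closedBall_self hs.le⟩
  have hι₀ : ι k₀ = 1 := hp1
  have hm₀ : m (k₀, k₀) = b₀ := by
    refine Subtype.ext ?_
    change φ (ι k₀ * ι k₀) = p
    rw [hι₀, one_mul]
  have hadd : ∀ χ x y, ψ χ (m (x, y)) = ψ χ (incl x) + ψ χ (incl y) := by
    intro χ x y
    refine congrFun (Circle.isCoveringMap_exp.eq_of_comp_eq (g₁ := fun x => ψ χ (m x))
      (g₂ := fun x : K × K => ψ χ (incl x.1) + ψ χ (incl x.2)) (by fun_prop) (by fun_prop) ?_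
      (k₀, k₀) ?_) (x, y)
    · ext x
      change (Circle.exp _ : ℂ) = Circle.exp _
      rw [Circle.exp_add, hψ, hψ, hψ, hqm, _root_.map_mul]
      rfl
    · change ψ χ (m (k₀, k₀)) = ψ χ b₀ + ψ χ b₀
      rw [hm₀, hψ0, add_zero]
  have hιinj : ∀ x y z, ι x * ι y = ι z → m (x, y) = incl z := by
    intro x y z h
    refine Subtype.ext ?_
    change φ (ι x * ι y) = z
    rw [h]
    exact φ.right_inv (hRt (hsB z.2))
  refine ⟨K, hKc, ι, ?_, AddMonoidHom.mk'
    (fun χ => ⟨BoundedContinuousFunction.mkOfCompact ((ψ χ.toMul).comp incl), fun x y z h => ?_⟩)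
    fun χ χ' => ?_, fun χ k => hψ _ _⟩
  · have h2 : φ.source ∩ φ ⁻¹' Metric.ball p s ∈ 𝓝 (1 : T) :=
      (φ.isOpen_inter_preimage Metric.isOpen_ball).mem_nhds ⟨h1, Metric.mem_ball_self hs⟩
    refine Filter.mem_of_superset h2 fun x hx => ⟨⟨φ x, Metric.ball_subset_closedBall hx.2⟩, ?_⟩
    exact φ.left_inv hx.1
  · change ψ χ.toMul (incl z) = ψ χ.toMul (incl x) + ψ χ.toMul (incl y)
    rw [← hadd, hιinj x y z h]
  · refine Subtype.ext (BoundedContinuousFunction.ext fun k => ?_)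
    exact hψadd _ _ _

/-- The character group of a compact abelian Lie group is finitely generated. -/
theorem PontryaginDual.finite_int {T : Type*} [CommGroup T] [TopologicalSpace T]
    [IsTopologicalGroup T] [CompactSpace T] {E : Type*} [NormedAddCommGroup E] [NormedSpace ℝ E]
    [FiniteDimensional ℝ E] [ChartedSpace E T] :
    Module.Finite ℤ (Additive (PontryaginDual T)) := by
  obtain ⟨K, _, ι, hι, Ψ, hΨ⟩ := PontryaginDual.exists_localHoms (T := T) (E := E)
  exact PontryaginDual.finite_of_localHoms hι Ψ hΨ

end

theorem mainTheorem10 (d : ℕ) (T : Type*) [CommGroup T] [TopologicalSpace T]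
    [ChartedSpace (EuclideanSpace ℝ (Fin d)) T]
    [LieGroup (modelWithCornersSelf ℝ (EuclideanSpace ℝ (Fin d))) ∞ T]
    [T2Space T] [CompactSpace T] :
    (toHolomorphicFunctions (KT T)).toRingHom.FaithfullyFlat := by
  have : IsTopologicalGroup T := topologicalGroup_of_lieGroup
    (modelWithCornersSelf ℝ (EuclideanSpace ℝ (Fin d))) ∞
  have hfin : Module.Finite ℤ (Additive (PontryaginDual T)) :=
    PontryaginDual.finite_int (E := EuclideanSpace ℝ (Fin d))
  have hfg : AddGroup.FG (Additive (PontryaginDual T)) := Module.Finite.iff_addGroup_fg.1 hfin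
  obtain ⟨r, κ, _, p, hp, e, ⟨f⟩⟩ :=
    AddCommGroup.equiv_free_prod_directSum_zmod (Additive (PontryaginDual T))
  have hne : ∀ i, NeZero (p i ^ e i) := fun i => ⟨pow_ne_zero _ (hp i).ne_zero⟩
  classical
  have hF : Finite (DirectSum κ fun i => ZMod (p i ^ e i)) :=
    Finite.of_equiv _ (DirectSum.addEquivProd fun i => ZMod (p i ^ e i)).symm.toEquiv
  let g : Additive (PontryaginDual T) ≃+ (Fin r → ℤ) × (DirectSum κ fun i => ZMod (p i ^ e i)) :=
    f.trans ((Finsupp.linearEquivFunOnFinite ℤ ℤ (Fin r)).toAddEquiv.prodCongr (AddEquiv.refl _))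
  refine faithfullyFlat_of_basis
    ((RepresentationRing.basis T).reindex (Additive.ofMul.trans g.toEquiv)) fun x y => ?_
  simp only [Module.Basis.reindex_apply]
  rw [← RepresentationRing.basis_mul]
  congr 1
  change (g.symm (x + y)).toMul = (g.symm x).toMul * (g.symm y).toMul
  rw [map_add, toMul_add]
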